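/- Let $\pi:\mathbb{E}\to M$ be a Killing submersion: $\mathbb{E}$ is an oriented smooth Riemannian $3$-manifold, $M$ is a smooth Riemannian surface, $\pi$ is a Riemannian submersion, and its fibers are the trajectories of a complete unit Killing vector field $\xi$ on $\mathbb{E}$. Let $G\in C^\infty(M)$ be the Gaussian curvature of $M$, and let $r\in C^\infty(\mathbb{E})$ be the bundle curvature, i.e. the function with $\overline\nabla_Z\xi=r\,Z\wedge\xi$ for every vector $Z$ tangent to $\mathbb{E}$, where $\overline\nabla$ is the Levi-Civita connection and $\wedge$ the cross product of $\mathbb{E}$; the function $G\circ\pi$ on $\mathbb{E}$ is again denoted by $G$. Let $f:S\to\mathbb{E}$ be a smoothly immersed surface with the induced metric and with constant mean curvature (that is, $H=\operatorname{trace}A$ is constant, where $A$ is the shape operator with respect to a unit normal field). Assume that $G-4r^2=0$ and $\operatorname{grad} r\neq 0$ (gradient in $\mathbb{E}$) at every point of $S$, i.e. at $f(p)$ for every $p\in S$. Then $S$ is not proper biharmonic: it is not the case that the bitension field $$\tau_2(f)=-\Delta\tau(f)-\operatorname{trace}\overline R(df,\tau(f))\,df$$ vanishes identically while the tension field $\tau(f)=\operatorname{trace}\nabla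 df$ does not vanish identically. Here $\Delta=-\operatorname{trace}\nabla^2$ is the rough Laplacian on sections of $f^{-1}T\mathbb{E}$ and $\overline R(X,Y)=[\overline\nabla_X,\overline\nabla_Y]-\overline\nabla_{[X,Y]}$. -/

import Mathlib

open scoped Manifold ContDiff
open Set

noncomputable section

namespace KillingBiharmonic

/-! ### Riemannian geometry in coordinates

A metric on an open subset of `ℝⁿ` is given by a function `g` with values in bilinear forms.
All objects below depend at `u` only on the germs at `u` of the data. -/

/-- Coordinate space `ℝⁿ`. -/
abbrev Eu (n : ℕ) := EuclideanSpace ℝ (Fin n)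

/-- Bilinear forms on `ℝⁿ`. -/
abbrev Form (n : ℕ) := Eu n →L[ℝ] Eu n →L[ℝ] ℝ

/-- The coordinate vector `∂ᵢ`. -/
def coordVec {n : ℕ} (i : Fin n) : Eu n := EuclideanSpace.single i (1 : ℝ)

/-- The matrix `Bᵢⱼ = B(∂ᵢ, ∂ⱼ)`. -/
def gram {n : ℕ} (B : Form n) : Matrix (Fin n) (Fin n) ℝ :=
  Matrix.of fun i j => B (coordVec i) (coordVec j)

/-- Raising an index: for a scalar product `B` and a linear form `α`, the vector `Bⁱʲ αⱼ ∂ᵢ`,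
i.e. the vector `X` with `B(X, w) = α(w)` for all `w`. -/
def sharp {n : ℕ} (B : Form n) (α : Eu n → ℝ) : Eu n :=
  ∑ i, ∑ j, ((gram B)⁻¹ i j * α (coordVec j)) • coordVec i

/-- The trace `Bⁱʲ T(∂ᵢ, ∂ⱼ)` of a bilinear `T` with respect to a scalar product `B`, i.e.
`∑ T(eᵢ, eᵢ)` over a `B`-orthonormal basis. -/
def traceForm {n k : ℕ} (B : Form n) (T : Eu n → Eu n → Eu k) : Eu k :=
  ∑ i, ∑ j, (gram B)⁻¹ i j • T (coordVec i) (coordVec j)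

/-- The Christoffel symbols `Γᵘ(v, w) = vⁱ wʲ Γᵏᵢⱼ(u) ∂ₖ` of the Levi-Civita connection of `g`:
`g(Γ(v, w), z) = (∂ᵥ g(w, z) + ∂_w g(v, z) - ∂_z g(v, w)) / 2`. -/
def christoffel {n : ℕ} (g : Eu n → Form n) (u v w : Eu n) : Eu n :=
  sharp (g u) fun z => (fderiv ℝ g u v w z + fderiv ℝ g u w v z - fderiv ℝ g u z v w) / 2

/-- The Levi-Civita covariant derivative `∇ᵥ Y` at `u` of a vector field `Y`. -/
def covDeriv {n : ℕ} (g : Eu n → Form n) (Y : Eu n → Eu n) (u v : Eu n) : Eu n :=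
  fderiv ℝ Y u v + christoffel g u v (Y u)

/-- The covariant derivative `∇ᵥ σ` at `u` of a vector field `σ` along a map `φ`, for the
pull-back by `φ` of the Levi-Civita connection of the target metric `h`. -/
def covAlong {m n : ℕ} (h : Eu n → Form n) (φ σ : Eu m → Eu n) (u v : Eu m) : Eu n :=
  fderiv ℝ σ u v + christoffel h (φ u) (fderiv ℝ φ u v) (σ u)

/-- The curvature `R(X, Y)Z = ∇_X ∇_Y Z - ∇_Y ∇_X Z - ∇_[X,Y] Z` at `u`; the vectors are extended
to fields with constant coordinates, for which `[X, Y] = 0` and `∇_Y Z = Γ(Y, Z)`. -/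
def curvature {n : ℕ} (g : Eu n → Form n) (u X Y Z : Eu n) : Eu n :=
  covDeriv g (fun y => christoffel g y Y Z) u X - covDeriv g (fun y => christoffel g y X Z) u Y

/-- The Gaussian curvature `⟨R(∂₁, ∂₂)∂₂, ∂₁⟩ / det g` of a metric in two variables. -/
def gaussK (g : Eu 2 → Form 2) (u : Eu 2) : ℝ :=
  g u (curvature g u (coordVec 0) (coordVec 1) (coordVec 1)) (coordVec 0) / (gram (g u)).det

/-- The tension field `τ(φ) = trace ∇dφ` of a map `φ` from the metric `g` to the metric `h`, where
`∇dφ(v, w) = ∇ᵥ (dφ w) - dφ(∇ᵥ w)`. -/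
def tension {m n : ℕ} (g : Eu m → Form m) (h : Eu n → Form n) (φ : Eu m → Eu n) (u : Eu m) :
    Eu n :=
  traceForm (g u) fun v w =>
    covAlong h φ (fun y => fderiv ℝ φ y w) u v - fderiv ℝ φ u (christoffel g u v w)

/-- The rough Laplacian `Δσ = - trace ∇²σ` on vector fields along `φ`, where
`∇²σ(v, w) = ∇ᵥ ∇_w σ - ∇_{∇ᵥ w} σ`. -/
def roughLaplacian {m n : ℕ} (g : Eu m → Form m) (h : Eu n → Form n) (φ σ : Eu m → Eu n)
    (u : Eu m) : Eu n :=
  -traceForm (g u) fun v w =>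
    covAlong h φ (fun y => covAlong h φ σ y w) u v - covAlong h φ σ u (christoffel g u v w)

/-- The bitension field `τ₂(φ) = - Δ τ(φ) - trace R(dφ, τ(φ)) dφ`. -/
def bitension {m n : ℕ} (g : Eu m → Form m) (h : Eu n → Form n) (φ : Eu m → Eu n) (u : Eu m) :
    Eu n :=
  -roughLaplacian g h φ (tension g h φ) u -
    traceForm (g u) fun v w =>
      curvature h (φ u) (fderiv ℝ φ u v) (tension g h φ u) (fderiv ℝ φ u w)

/-- The shape operator `A` of an immersion `φ` with induced metric `g` and unit normal `η`:
`⟨A v, w⟩ = - ⟨∇ᵥ η, dφ w⟩`. -/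
def shapeOp {m n : ℕ} (g : Eu m → Form m) (h : Eu n → Form n) (φ η : Eu m → Eu n) (u v : Eu m) :
    Eu m :=
  sharp (g u) fun w => -h (φ u) (covAlong h φ η u v) (fderiv ℝ φ u w)

/-- The mean curvature function `H = trace A`. -/
def meanCurv {m n : ℕ} (g : Eu m → Form m) (h : Eu n → Form n) (φ η : Eu m → Eu n) (u : Eu m) :
    ℝ :=
  ∑ i, shapeOp g h φ η u (coordVec i) i

/-! ### Riemannian manifolds -/

/-- Smooth Riemannian metrics on an `n`-dimensional manifold. -/
abbrev RMetric (n : ℕ) (N : Type*) [TopologicalSpace N] [ChartedSpace (Eu n) N]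
    [IsManifold (𝓡 n) ∞ N] :=
  Bundle.ContMDiffRiemannianMetric (IB := 𝓡 n) (n := ∞) (Eu n)
    (fun x : N => TangentSpace (𝓡 n) x)

section Manifold

variable {m n : ℕ}
  {S : Type*} [TopologicalSpace S] [ChartedSpace (Eu m) S] [IsManifold (𝓡 m) ∞ S]
  {N : Type*} [TopologicalSpace N] [ChartedSpace (Eu n) N] [IsManifold (𝓡 n) ∞ N]

/-- The coordinate vectors of the chart `ψ`, as a linear map from `ℝⁿ` to the tangent space. -/
def fromChart (ψ : OpenPartialHomeomorph N (Eu n)) (u : Eu n) :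
    Eu n →L[ℝ] TangentSpace (𝓡 n) (ψ.symm u) :=
  mfderiv (𝓡 n) (𝓡 n) ψ.symm u

/-- The coordinates in the chart `ψ` of tangent vectors at `x`. -/
def toChart (ψ : OpenPartialHomeomorph N (Eu n)) (x : N) :
    TangentSpace (𝓡 n) x →L[ℝ] Eu n :=
  mfderiv (𝓡 n) (𝓡 n) ψ x

/-- The metric `g` in the chart `ψ`: `(v, w) ↦ g(vⁱ ∂ᵢ, wʲ ∂ⱼ)`. -/
def chartMetric (g : RMetric n N) (ψ : OpenPartialHomeomorph N (Eu n)) (u : Eu n) : Form n :=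
  let B : Form n := g.inner (ψ.symm u)
  let L : Eu n →L[ℝ] Eu n := fromChart ψ u
  B.bilinearComp L L

/-- The vector field `ξ` in the chart `ψ`. -/
def chartField (ξ : ∀ x : N, TangentSpace (𝓡 n) x) (ψ : OpenPartialHomeomorph N (Eu n))
    (u : Eu n) : Eu n :=
  toChart ψ (ψ.symm u) (ξ (ψ.symm u))

/-- The set of coordinates on which `f` can be written in the charts `κ` and `ψ`. -/
def chartDomain (f : S → N) (κ : OpenPartialHomeomorph S (Eu m))
    (ψ : OpenPartialHomeomorph N (Eu n)) : Set (Eu m) :=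
  {u | u ∈ κ.target ∧ f (κ.symm u) ∈ ψ.source}

/-- The map `f` in the charts `κ` and `ψ`. -/
def chartMap (f : S → N) (κ : OpenPartialHomeomorph S (Eu m))
    (ψ : OpenPartialHomeomorph N (Eu n)) (u : Eu m) : Eu n :=
  ψ (f (κ.symm u))

/-- The vector field `η` along `f` in the charts `κ` and `ψ`. -/
def chartAlong (f : S → N) (η : ∀ p : S, TangentSpace (𝓡 n) (f p))
    (κ : OpenPartialHomeomorph S (Eu m)) (ψ : OpenPartialHomeomorph N (Eu n)) (u : Eu m) : Eu n :=
  toChart ψ (f (κ.symm u)) (η (κ.symm u))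

/-- `f` is harmonic: its tension field vanishes. -/
def IsHarmonic (gS : RMetric m S) (gN : RMetric n N) (f : S → N) : Prop :=
  ∀ κ ∈ atlas (Eu m) S, ∀ ψ ∈ atlas (Eu n) N, ∀ u ∈ chartDomain f κ ψ,
    tension (chartMetric gS κ) (chartMetric gN ψ) (chartMap f κ ψ) u = 0

/-- `f` is biharmonic: its bitension field vanishes. -/
def IsBiharmonic (gS : RMetric m S) (gN : RMetric n N) (f : S → N) : Prop :=
  ∀ κ ∈ atlas (Eu m) S, ∀ ψ ∈ atlas (Eu n) N, ∀ u ∈ chartDomain f κ ψ,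
    bitension (chartMetric gS κ) (chartMetric gN ψ) (chartMap f κ ψ) u = 0

/-- `f` is proper biharmonic: biharmonic and not harmonic. -/
def IsProperBiharmonic (gS : RMetric m S) (gN : RMetric n N) (f : S → N) : Prop :=
  IsBiharmonic gS gN f ∧ ¬ IsHarmonic gS gN f

/-- `f` is a smooth isometric immersion, i.e. a smooth immersion whose induced metric is `gS`
(the differential is injective because `gS` is positive definite). -/
def IsIsometricImmersion (gS : RMetric m S) (gN : RMetric n N) (f : S → N) : Prop :=
  ContMDiff (𝓡 m) (𝓡 n) ∞ f ∧
    ∀ (p : S) (v w : TangentSpace (𝓡 m) p),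
      gN.inner (f p) (mfderiv (𝓡 m) (𝓡 n) f p v) (mfderiv (𝓡 m) (𝓡 n) f p w) = gS.inner p v w

/-- `η` is a smooth unit normal vector field of `f` on `U`. -/
def IsUnitNormalOn (gN : RMetric n N) (f : S → N) (η : ∀ p : S, TangentSpace (𝓡 n) (f p))
    (U : Set S) : Prop :=
  ContMDiffOn (𝓡 m) (𝓡 n).tangent ∞ (fun p => (⟨f p, η p⟩ : TangentBundle (𝓡 n) N)) U ∧
    ∀ p ∈ U, gN.inner (f p) (η p) (η p) = 1 ∧
      ∀ v : TangentSpace (𝓡 m) p, gN.inner (f p) (η p) (mfderiv (𝓡 m) (𝓡 n) f p v) = 0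

/-- The hypersurface `f` has constant mean curvature: for some constant `c` there are unit normal
fields near every point with respect to which `H = c`. (An oriented hypersurface with `H`
constant for its global unit normal field satisfies this.) -/
def IsCMC (gS : RMetric m S) (gN : RMetric n N) (f : S → N) : Prop :=
  ∃ c : ℝ, ∀ p : S, ∃ U : Set S, IsOpen U ∧ p ∈ U ∧
    ∃ η : ∀ q : S, TangentSpace (𝓡 n) (f q), IsUnitNormalOn (m := m) gN f η U ∧
      ∀ κ ∈ atlas (Eu m) S, ∀ ψ ∈ atlas (Eu n) N, ∀ u ∈ chartDomain f κ ψ, κ.symm u ∈ U →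
        meanCurv (chartMetric gS κ) (chartMetric gN ψ) (chartMap f κ ψ)
          (chartAlong f η κ ψ) u = c

/-- `ξ` is a Killing vector field: `⟨∇ᵥ ξ, w⟩ + ⟨v, ∇_w ξ⟩ = 0`. -/
def IsKilling (g : RMetric n N) (ξ : ∀ x : N, TangentSpace (𝓡 n) x) : Prop :=
  ∀ ψ ∈ atlas (Eu n) N, ∀ u ∈ ψ.target, ∀ v w : Eu n,
    chartMetric g ψ u (covDeriv (chartMetric g ψ) (chartField ξ ψ) u v) w +
      chartMetric g ψ u v (covDeriv (chartMetric g ψ) (chartField ξ ψ) u w) = 0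

/-- The gradient of a function: `⟨grad r, w⟩ = dr(w)`. -/
def gradient (g : RMetric n N) (r : N → ℝ) (x : N) : TangentSpace (𝓡 n) x :=
  sharp (n := n) (g.inner x) fun w => mfderiv (𝓡 n) 𝓘(ℝ, ℝ) r x w

/-- The Gaussian curvature of a Riemannian surface. -/
def gaussCurvature {M : Type*} [TopologicalSpace M] [ChartedSpace (Eu 2) M]
    [IsManifold (𝓡 2) ∞ M] (g : RMetric 2 M) (b : M) : ℝ :=
  gaussK (chartMetric g (chartAt (Eu 2) b)) (chartAt (Eu 2) b b)

end Manifold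

/-! ### Killing submersions -/

section Killing

variable {E : Type*} [TopologicalSpace E] [ChartedSpace (Eu 3) E] [IsManifold (𝓡 3) ∞ E]
  {M : Type*} [TopologicalSpace M] [ChartedSpace (Eu 2) M] [IsManifold (𝓡 2) ∞ M]

/-- `π : E → M` is a Riemannian submersion: a smooth surjective submersion whose differential is
isometric on the orthogonal complement of its kernel. -/
structure IsRiemannianSubmersion (gE : RMetric 3 E) (gM : RMetric 2 M) (π : E → M) : Prop where
  smooth : ContMDiff (𝓡 3) (𝓡 2) ∞ π
  surjective : Function.Surjective π
  submersion : ∀ x : E, Function.Surjective (mfderiv (𝓡 3) (𝓡 2) π x)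
  isometry : ∀ (x : E) (v w : TangentSpace (𝓡 3) x),
    (∀ z : TangentSpace (𝓡 3) x, mfderiv (𝓡 3) (𝓡 2) π x z = 0 → gE.inner x v z = 0) →
    (∀ z : TangentSpace (𝓡 3) x, mfderiv (𝓡 3) (𝓡 2) π x z = 0 → gE.inner x w z = 0) →
    gM.inner (π x) (mfderiv (𝓡 3) (𝓡 2) π x v) (mfderiv (𝓡 3) (𝓡 2) π x w) = gE.inner x v w

/-- `π : E → M` is a Killing submersion with vertical unit Killing field `ξ`: a Riemannian
submersion whose fibers are the trajectories of the complete unit Killing field `ξ`. -/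
structure IsKillingSubmersion (gE : RMetric 3 E) (gM : RMetric 2 M) (π : E → M)
    (ξ : ∀ x : E, TangentSpace (𝓡 3) x) : Prop where
  riemannianSubmersion : IsRiemannianSubmersion gE gM π
  smooth : ContMDiff (𝓡 3) (𝓡 3).tangent ∞ (fun x => (⟨x, ξ x⟩ : TangentBundle (𝓡 3) E))
  unit : ∀ x : E, gE.inner x (ξ x) (ξ x) = 1
  killing : IsKilling gE ξ
  /-- Through each point there is an integral curve of `ξ` defined on all of `ℝ` (completeness),
  and it runs through exactly the fiber of the point. -/
  fiber : ∀ x : E, ∃ γ : ℝ → E, γ 0 = x ∧ IsMIntegralCurve γ ξ ∧ range γ = π ⁻¹' {π x}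

/-- `vol` is the volume form of the metric `gE` for some orientation of `E`: a continuous field of
alternating 3-forms with values `±1` on orthonormal bases. Giving it is the same as giving an
orientation of `E`. -/
def IsVolumeForm (gE : RMetric 3 E)
    (vol : ∀ x : E, (TangentSpace (𝓡 3) x) [⋀^Fin 3]→ₗ[ℝ] ℝ) : Prop :=
  (∀ (x : E) (e : Fin 3 → TangentSpace (𝓡 3) x),
    (∀ i j, gE.inner x (e i) (e j) = if i = j then 1 else 0) → |vol x e| = 1) ∧
  ∀ ψ ∈ atlas (Eu 3) E,
    ContinuousOn (fun u => vol (ψ.symm u) fun i => fromChart ψ u (coordVec i)) ψ.target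

/-- The cross product `v ∧ w` in the chart `ψ`: `⟨v ∧ w, z⟩ = vol(v, w, z)`. -/
def chartCross (gE : RMetric 3 E) (vol : ∀ x : E, (TangentSpace (𝓡 3) x) [⋀^Fin 3]→ₗ[ℝ] ℝ)
    (ψ : OpenPartialHomeomorph E (Eu 3)) (u v w : Eu 3) : Eu 3 :=
  sharp (chartMetric gE ψ u) fun z =>
    vol (ψ.symm u) ![fromChart ψ u v, fromChart ψ u w, fromChart ψ u z]

/-- `r` is the bundle curvature: the smooth function with `∇_Z ξ = r Z ∧ ξ` for all `Z`. -/
def IsBundleCurvature (gE : RMetric 3 E) (ξ : ∀ x : E, TangentSpace (𝓡 3) x)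
    (vol : ∀ x : E, (TangentSpace (𝓡 3) x) [⋀^Fin 3]→ₗ[ℝ] ℝ) (r : E → ℝ) : Prop :=
  ContMDiff (𝓡 3) 𝓘(ℝ, ℝ) ∞ r ∧
  ∀ ψ ∈ atlas (Eu 3) E, ∀ u ∈ ψ.target, ∀ v : Eu 3,
    covDeriv (chartMetric gE ψ) (chartField ξ ψ) u v =
      r (ψ.symm u) • chartCross gE vol ψ u v (chartField ξ ψ u)

end Killing

end KillingBiharmonic

end

noncomputable section

namespace KillingBiharmonic

/-! Being harmonic or biharmonic is a local condition, so it suffices to work in one pair of charts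
around a point where the tension field is non-zero. There τ = cη with c the constant mean curvature,
hence c ≠ 0, and a contradiction is derived on that coordinate patch (`IsBiharmonicSurface.false`).

Ambient geometry. Differentiating ∇ξ = r(· ∧ ξ) gives R(x, y)ξ (`IsKillingData.curvature_field`):
vertical planes have curvature r², and ξ(r) = 0. By O'Neill's formula
(`IsSubmersionData.sectional_eq`) the horizontal plane has curvature G - 3r², which is also r² when
G = 4r². The Ricci tensor is then 2r² times the metric plus a term linear in grad r, namely
⟨ξ,X⟩⟨Y∧ξ, grad r⟩ + ⟨ξ,Y⟩⟨X∧ξ, grad r⟩ (`IsKillingData.ricci_eq`).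

Biharmonicity. With H = c ≠ 0 the equation splits into Ric(η)ᵀ = 0 and Ric(η, η) = |A|²
(`IsSurface.ricci_normal_tangent`, `IsSurface.ricci_normal_normal`). Put a = ⟨ξ,η⟩ and b = ⟨η∧ξ,
grad r⟩. The first equation says that η is an eigenvector of Ric, which forces a(2a² - 1) = 0
(`IsBiharmonicSurface.eigenvector`). So a is locally constant, and da = 0 determines the second
fundamental form on the tangential part T of ξ: II(T,T) = 0, and the mixed entry of the matrix of II
in the frame (e₀, e₁) with e₀ ∥ T is ±r, so the remaining entry II(e₁,e₁) is c. Thus |A|² = c² +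
2r², while Ric(η,η) = 2r² + 2ab, whence 2ab = c² ≠ 0. The eigenvector equation now gives that grad r
is tangent to the surface and that |grad r|² = c⁴ is constant along it
(`IsBiharmonicSurface.grad_facts`).

Contradiction. Hess r(grad r, ·) vanishes on tangent vectors, because |grad r| is constant, and on
ξ, because ⟨grad r, ξ⟩ = 0; as a ≠ 0 it vanishes on η too. Differentiating ⟨η, grad r⟩ = 0 along
grad r then gives II(grad r, grad r) = 0. But grad r is orthogonal to T, so it is a multiple of e₁
and II(grad r, grad r) = c|grad r|² = c⁵ ≠ 0. -/

/-! ### Scalar products -/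

/-- A symmetric positive definite bilinear form. -/
structure IsInner {n : ℕ} (B : Form n) : Prop where
  symm : ∀ v w, B v w = B w v
  pos : ∀ v, v ≠ 0 → 0 < B v v

/-- An orthonormal family. -/
def IsOrtho {n k : ℕ} (B : Form n) (e : Fin k → Eu n) : Prop :=
  ∀ i j, B (e i) (e j) = if i = j then 1 else 0

lemma eq_sum_coordVec {n : ℕ} (v : Eu n) : v = ∑ i, v i • coordVec i := by
  ext j
  simp [coordVec, Finset.sum_apply, Pi.single_apply]

lemma IsInner.eq_of_forall {n : ℕ} {B : Form n} (hB : IsInner B) {v w : Eu n}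
    (h : ∀ z, B v z = B w z) : v = w := by
  by_contra hne
  have h1 := hB.pos (v - w) (sub_ne_zero.mpr hne)
  have h2 := h (v - w)
  simp only [map_sub, sub_apply] at h1 h2
  linarith

lemma form_apply_eq_sum {n : ℕ} (B : Form n) (v w : Eu n) :
    B v w = ∑ i, ∑ j, v i * w j * gram B i j := by
  conv_lhs => rw [eq_sum_coordVec v, eq_sum_coordVec w]
  simp only [map_sum, map_smul, sum_apply, smul_apply,
    smul_eq_mul, gram, Matrix.of_apply, Finset.mul_sum]
  rw [Finset.sum_comm]
  refine Finset.sum_congr rfl fun i _ => Finset.sum_congr rfl fun j _ => by ring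

lemma IsInner.gram_isUnit {n : ℕ} {B : Form n} (hB : IsInner B) : IsUnit (gram B).det := by
  rw [← Matrix.isUnit_iff_isUnit_det, ← Matrix.mulVec_injective_iff_isUnit]
  intro x y hxy
  have h0 : (gram B).mulVec (x - y) = 0 := by rw [Matrix.mulVec_sub, hxy, sub_self]
  have h1 : B (WithLp.toLp 2 (x - y)) (WithLp.toLp 2 (x - y)) = 0 := by
    rw [form_apply_eq_sum]
    have : ∀ i, ∑ j, gram B i j * (x - y) j = 0 := fun i => congrFun h0 i
    calc _ = ∑ i, (x - y) i * ∑ j, gram B i j * (x - y) j := by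
          refine Finset.sum_congr rfl fun i _ => ?_
          rw [Finset.mul_sum]
          refine Finset.sum_congr rfl fun j _ => by simp; ring
      _ = 0 := Finset.sum_eq_zero fun i _ => by rw [this, mul_zero]
  by_contra hne
  refine (hB.pos (WithLp.toLp 2 (x - y)) ?_).ne' h1
  intro h
  apply hne
  have := congrArg WithLp.ofLp h
  simpa [sub_eq_zero] using this

lemma IsInner.apply_sharp {n : ℕ} {B : Form n} (hB : IsInner B) {α : Eu n → ℝ}
    (hα : IsLinearMap ℝ α) (w : Eu n) : B (sharp B α) w = α w := by
  have key : ∀ l, B (sharp B α) (coordVec l) = α (coordVec l) := by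
    intro l
    have h1 : gram B * (gram B)⁻¹ = 1 := Matrix.mul_nonsing_inv _ hB.gram_isUnit
    have h2 : ∀ j, ∑ i, gram B l i * (gram B)⁻¹ i j = (1 : Matrix _ _ ℝ) l j := by
      intro j; rw [← h1, Matrix.mul_apply]
    rw [hB.symm]
    simp only [sharp, map_sum, map_smul, smul_eq_mul]
    rw [Finset.sum_comm]
    calc _ = ∑ j, (∑ i, gram B l i * (gram B)⁻¹ i j) * α (coordVec j) := by
          refine Finset.sum_congr rfl fun j _ => ?_
          rw [Finset.sum_mul]
          refine Finset.sum_congr rfl fun i _ => ?_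
          simp only [gram, Matrix.of_apply]; ring
      _ = _ := by simp [h2, Matrix.one_apply]
  let a : Eu n →ₗ[ℝ] ℝ := hα.mk' α
  change _ = a w
  rw [eq_sum_coordVec w, map_sum, map_sum]
  refine Finset.sum_congr rfl fun i _ => ?_
  rw [map_smul, map_smul, key]; rfl

lemma IsInner.sharp_eq {n : ℕ} {B : Form n} (hB : IsInner B) {α : Eu n → ℝ} {X : Eu n}
    (h : ∀ w, B X w = α w) : sharp B α = X := by
  have hα : IsLinearMap ℝ α :=
    ⟨fun x y => by simp [← h], fun c x => by simp [← h]⟩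
  exact hB.eq_of_forall fun z => by rw [hB.apply_sharp hα, h]

/-- A scalar product as an isomorphism to the dual space. -/
def IsInner.equiv {n : ℕ} {B : Form n} (hB : IsInner B) : Eu n ≃L[ℝ] (Eu n →L[ℝ] ℝ) :=
  (LinearEquiv.ofBijective (B : Eu n →ₗ[ℝ] (Eu n →L[ℝ] ℝ))
    ⟨fun v w h => hB.eq_of_forall fun z => congrArg (fun L : Eu n →L[ℝ] ℝ => L z) h,
      fun α => ⟨sharp B α, by
        ext w
        exact hB.apply_sharp ⟨map_add α, map_smul α⟩ w⟩⟩).toContinuousLinearEquiv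

lemma IsInner.equiv_apply {n : ℕ} {B : Form n} (hB : IsInner B) (v : Eu n) :
    hB.equiv v = B v := rfl

lemma IsInner.coe_equiv {n : ℕ} {B : Form n} (hB : IsInner B) :
    (hB.equiv : Eu n →L[ℝ] (Eu n →L[ℝ] ℝ)) = B := rfl

/-- Identifies raising an index with operator inversion, which is known to be smooth; smoothness of
the inverse Gram matrix is obtained this way. -/
lemma IsInner.inverse_apply {n : ℕ} {B : Form n} (hB : IsInner B) (α : Eu n →L[ℝ] ℝ) :
    ContinuousLinearMap.inverse B α = sharp B α := by
  have h1 : ContinuousLinearMap.inverse B = (hB.equiv.symm : (Eu n →L[ℝ] ℝ) →L[ℝ] Eu n) := by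
    conv_lhs => rw [← hB.coe_equiv]
    exact ContinuousLinearMap.inverse_equiv _
  rw [h1]
  symm
  apply hB.sharp_eq
  intro w
  have : hB.equiv (hB.equiv.symm α) = α := hB.equiv.apply_symm_apply α
  rw [hB.equiv_apply] at this
  exact congrArg (fun L : Eu n →L[ℝ] ℝ => L w) this

lemma IsInner.contDiffAt_inverse {n : ℕ} {B : Form n} (hB : IsInner B) {k : WithTop ℕ∞} :
    ContDiffAt ℝ k (ContinuousLinearMap.inverse : Form n → _) B := by
  have := contDiffAt_map_inverse (n := k) hB.equiv
  rwa [hB.coe_equiv] at this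

/-! ### Orthonormal frames and traces -/

/-- Fewer than n linear functionals have a common non-zero kernel vector, which is then normalised.
All orthonormal frames below come from repeated use of this. -/
lemma IsInner.exists_unit_orthogonal {n k : ℕ} {B : Form n} (hB : IsInner B) (hk : k < n)
    (v : Fin k → Eu n) : ∃ w, B w w = 1 ∧ ∀ i, B (v i) w = 0 := by
  let L : Eu n →ₗ[ℝ] (Fin k → ℝ) := LinearMap.pi fun i => (B (v i) : Eu n →ₗ[ℝ] ℝ)
  obtain ⟨w, hw, hw0⟩ := Submodule.exists_mem_ne_zero_of_ne_bot
    (LinearMap.ker_ne_bot_of_finrank_lt (f := L) (by simpa using hk))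
  have hpos := hB.pos w hw0
  have hw' : ∀ i, B (v i) w = 0 := fun i => congrFun (LinearMap.mem_ker.mp hw) i
  refine ⟨(Real.sqrt (B w w))⁻¹ • w, ?_, fun i => by simp [hw']⟩
  have hs := Real.mul_self_sqrt hpos.le
  have hs0 : Real.sqrt (B w w) ≠ 0 := (Real.sqrt_pos.mpr hpos).ne'
  simp only [map_smul, smul_apply, smul_eq_mul]
  field_simp
  rw [sq, hs]

/-- The matrix of coordinates of a family of vectors. -/
def coordMatrix {n : ℕ} (e : Fin n → Eu n) : Matrix (Fin n) (Fin n) ℝ :=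
  Matrix.of fun k i => e i k

lemma transpose_mul_gram_mul {n : ℕ} (B : Form n) (e : Fin n → Eu n) :
    (coordMatrix e).transpose * gram B * coordMatrix e = Matrix.of fun i j => B (e i) (e j) := by
  ext i j
  rw [Matrix.of_apply, form_apply_eq_sum, Matrix.mul_apply]
  simp only [Matrix.mul_apply, Matrix.transpose_apply, Finset.sum_mul]
  rw [Finset.sum_comm]
  refine Finset.sum_congr rfl fun k _ => Finset.sum_congr rfl fun l _ => ?_
  simp [coordMatrix]; ring

lemma IsOrtho.matrix_eq {n : ℕ} {B : Form n} {e : Fin n → Eu n} (he : IsOrtho B e) :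
    (coordMatrix e).transpose * gram B * coordMatrix e = 1 := by
  rw [transpose_mul_gram_mul]
  ext i j
  simp [he i j, Matrix.one_apply]

lemma IsOrtho.gram_inv {n : ℕ} {B : Form n} {e : Fin n → Eu n} (he : IsOrtho B e) :
    (gram B)⁻¹ = coordMatrix e * (coordMatrix e).transpose := by
  have h1 := he.matrix_eq
  have h2 := mul_eq_one_comm.mp h1
  apply Matrix.inv_eq_left_inv
  rw [Matrix.mul_assoc]; exact h2

/-- If the columns of P are orthonormal for the Gram matrix Γ then PᵀΓP = 1, so Γ⁻¹ = PPᵀ. This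
turns every coordinate trace into a sum over an orthonormal frame. -/
lemma IsOrtho.sum_sum_gram_inv {n : ℕ} {B : Form n} {e : Fin n → Eu n} (he : IsOrtho B e)
    {F : Type*} [AddCommGroup F] [Module ℝ F] {T : Eu n → Eu n → F}
    (h1 : ∀ w, IsLinearMap ℝ fun v => T v w) (h2 : ∀ v, IsLinearMap ℝ (T v)) :
    ∑ i, ∑ j, (gram B)⁻¹ i j • T (coordVec i) (coordVec j) = ∑ i, T (e i) (e i) := by
  have hT : ∀ v w, T v w = ∑ i, ∑ j, (v i * w j) • T (coordVec i) (coordVec j) := by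
    intro v w
    let L1 : ∀ w, Eu n →ₗ[ℝ] F := fun w => (h1 w).mk' _
    let L2 : ∀ w, Eu n →ₗ[ℝ] F := fun v => (h2 v).mk' _
    have e1 : T v w = L1 w v := rfl
    rw [e1]
    conv_lhs => rw [eq_sum_coordVec v]
    rw [map_sum]
    refine Finset.sum_congr rfl fun i _ => ?_
    rw [map_smul]
    have e2 : L1 w (coordVec i) = L2 (coordVec i) w := rfl
    rw [e2]
    conv_lhs => rw [eq_sum_coordVec w]
    rw [map_sum, Finset.smul_sum]
    refine Finset.sum_congr rfl fun j _ => ?_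
    rw [map_smul, smul_smul]
    rfl
  rw [he.gram_inv]
  have h3 : ∀ k, T (e k) (e k) = ∑ i, ∑ j, (e k i * e k j) • T (coordVec i) (coordVec j) :=
    fun k => hT _ _
  rw [Finset.sum_congr rfl fun k _ => h3 k]
  conv_rhs => rw [Finset.sum_comm]
  refine Finset.sum_congr rfl fun i _ => ?_
  conv_rhs => rw [Finset.sum_comm]
  refine Finset.sum_congr rfl fun j _ => ?_
  rw [← Finset.sum_smul]
  simp [Matrix.mul_apply, coordMatrix]

lemma IsOrtho.traceForm_eq {n k : ℕ} {B : Form n} {e : Fin n → Eu n} (he : IsOrtho B e)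
    {T : Eu n → Eu n → Eu k}
    (h1 : ∀ w, IsLinearMap ℝ fun v => T v w) (h2 : ∀ v, IsLinearMap ℝ (T v)) :
    traceForm B T = ∑ i, T (e i) (e i) :=
  he.sum_sum_gram_inv h1 h2

lemma IsOrtho.sum_eq_sum {n : ℕ} {B : Form n} {e e' : Fin n → Eu n} (he : IsOrtho B e)
    (he' : IsOrtho B e') {T : Eu n → Eu n → ℝ}
    (h1 : ∀ w, IsLinearMap ℝ fun v => T v w) (h2 : ∀ v, IsLinearMap ℝ (T v)) :
    ∑ i, T (e i) (e i) = ∑ i, T (e' i) (e' i) := by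
  rw [← he.sum_sum_gram_inv h1 h2, he'.sum_sum_gram_inv h1 h2]

lemma IsOrtho.expand {n : ℕ} {B : Form n} (hB : IsInner B) {e : Fin n → Eu n}
    (he : IsOrtho B e) (v : Eu n) : v = ∑ i, B v (e i) • e i := by
  apply hB.eq_of_forall
  intro z
  -- The trace of (x, y) ↦ B(v, x) B(y, z) is B(v, z), computed once in the frame and once in
  -- coordinates.
  have h := he.sum_sum_gram_inv (F := ℝ) (T := fun x y => B v x * B y z)
    (fun w => ⟨fun x y => by simp; ring, fun c x => by simp; ring⟩)
    (fun w => ⟨fun x y => by simp; ring, fun c x => by simp; ring⟩)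
  simp only [map_sum, map_smul, sum_apply, smul_apply,
    smul_eq_mul]
  rw [← h]
  have h3 : B v z = B (sharp B fun w => B v w) z := by
    rw [hB.sharp_eq (X := v) fun w => rfl]
  rw [h3]
  rw [hB.symm]
  simp only [sharp, map_sum, map_smul, smul_eq_mul]
  rw [Finset.sum_comm]
  refine Finset.sum_congr rfl fun i _ => Finset.sum_congr rfl fun j _ => ?_
  have hs : (gram B)⁻¹ j i = (gram B)⁻¹ i j := by
    rw [he.gram_inv]; simp [Matrix.mul_apply, mul_comm]
  rw [hs, hB.symm z]; ring

/-- The trace of an endomorphism in an orthonormal frame. -/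
lemma IsOrtho.sum_apply_eq {n : ℕ} {B : Form n} (hB : IsInner B) {e : Fin n → Eu n}
    (he : IsOrtho B e) {A : Eu n → Eu n} (hA : IsLinearMap ℝ A) :
    ∑ i, A (coordVec i) i = ∑ i, B (A (e i)) (e i) := by
  let A' : Eu n →ₗ[ℝ] Eu n := hA.mk' A
  have hA' : ∀ v, A v = A' v := fun _ => rfl
  rw [← he.sum_sum_gram_inv (F := ℝ) (T := fun x y => B (A x) y)
    (fun w => ⟨fun x y => by simp [hA'], fun c x => by simp [hA']⟩)
    (fun w => ⟨fun x y => by simp, fun c x => by simp⟩)]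
  refine Finset.sum_congr rfl fun i _ => ?_
  have h1 : sharp B (fun w => B w (A (coordVec i))) = A (coordVec i) :=
    hB.sharp_eq fun w => hB.symm _ _
  have h1' : sharp B (fun w => B (A (coordVec i)) w) = A (coordVec i) :=
    hB.sharp_eq fun w => rfl
  conv_lhs => rw [← h1']
  simp only [sharp, smul_eq_mul]
  simp [coordVec, Pi.single_apply]

/-! ### Smooth metrics on open sets -/

/-- A smooth Riemannian metric on an open subset of `ℝⁿ`. -/
structure IsMetricOn {n : ℕ} (h : Eu n → Form n) (O : Set (Eu n)) : Prop where
  isOpen : IsOpen O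
  smooth : ∀ u ∈ O, ContDiffAt ℝ ∞ h u
  inner : ∀ u ∈ O, IsInner (h u)

variable {m n : ℕ}

lemma contDiffAt_form_apply {k : ℕ} {h : Eu k → Form n} {V W : Eu k → Eu n} {u : Eu k}
    (hh : ContDiffAt ℝ ∞ h u) (hV : ContDiffAt ℝ ∞ V u) (hW : ContDiffAt ℝ ∞ W u) :
    ContDiffAt ℝ ∞ (fun y => h y (V y) (W y)) u :=
  (hh.clm_apply hV).clm_apply hW

lemma contDiffAt_fderiv {F G : Type*} [NormedAddCommGroup F] [NormedSpace ℝ F]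
    [NormedAddCommGroup G] [NormedSpace ℝ G] {f : F → G} {u : F}
    (hf : ContDiffAt ℝ ∞ f u) : ContDiffAt ℝ ∞ (fderiv ℝ f) u :=
  hf.fderiv_right (by simp)

lemma contDiffAt_fderiv_apply {F G : Type*} [NormedAddCommGroup F] [NormedSpace ℝ F]
    [NormedAddCommGroup G] [NormedSpace ℝ G] {f : F → G} {u : F} {V : F → F}
    (hf : ContDiffAt ℝ ∞ f u) (hV : ContDiffAt ℝ ∞ V u) :
    ContDiffAt ℝ ∞ (fun y => fderiv ℝ f y (V y)) u :=
  (contDiffAt_fderiv hf).clm_apply hV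

lemma differentiableAt_of_smooth {F G : Type*} [NormedAddCommGroup F] [NormedSpace ℝ F]
    [NormedAddCommGroup G] [NormedSpace ℝ G] {f : F → G} {u : F}
    (hf : ContDiffAt ℝ ∞ f u) : DifferentiableAt ℝ f u :=
  hf.differentiableAt (by simp)

/-- In finite dimension a space of operators is a finite product, via the values on a basis;
smoothness of forms and Christoffel symbols can thus be checked on fixed vectors. -/
lemma contDiffAt_clm_apply_iff {F G : Type*} [NormedAddCommGroup F] [NormedSpace ℝ F]
    [NormedAddCommGroup G] [NormedSpace ℝ G] {k : ℕ} {f : F → Eu k →L[ℝ] G} {u : F} :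
    ContDiffAt ℝ ∞ f u ↔ ∀ v, ContDiffAt ℝ ∞ (fun y => f y v) u := by
  refine ⟨fun h v => h.clm_apply contDiffAt_const, fun h => ?_⟩
  let d := Module.finrank ℝ (Eu k)
  have hd : d = Module.finrank ℝ (Fin d → ℝ) := (Module.finrank_fin_fun ℝ).symm
  let e₁ := ContinuousLinearEquiv.ofFinrankEq hd
  let e₂ := (e₁.arrowCongr (1 : G ≃L[ℝ] G)).trans (ContinuousLinearEquiv.piRing (Fin d))
  rw [← e₂.comp_contDiffAt_iff]
  exact contDiffAt_pi.mpr fun i => h _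

lemma two_le_smooth : minSmoothness ℝ 2 ≤ (∞ : WithTop ℕ∞) := by
  simp only [minSmoothness_of_isRCLikeNormedField]
  exact WithTop.coe_le_coe.mpr le_top

lemma sharp_add (B : Form n) (α β : Eu n → ℝ) :
    sharp B (fun z => α z + β z) = sharp B α + sharp B β := by
  simp only [sharp, ← Finset.sum_add_distrib, ← add_smul, mul_add]

lemma sharp_smul (B : Form n) (c : ℝ) (α : Eu n → ℝ) :
    sharp B (fun z => c * α z) = c • sharp B α := by
  simp only [sharp, Finset.smul_sum, smul_smul]
  refine Finset.sum_congr rfl fun i _ => Finset.sum_congr rfl fun j _ => ?_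
  ring_nf

lemma contDiffAt_gram_inv {k : ℕ} {h : Eu k → Form n} {u : Eu k} (hh : ContDiffAt ℝ ∞ h u)
    (hi : ∀ᶠ y in nhds u, IsInner (h y)) (i j : Fin n) :
    ContDiffAt ℝ ∞ (fun y => (gram (h y))⁻¹ i j) u := by
  have h1 : ContDiffAt ℝ ∞ (fun y => ContinuousLinearMap.inverse (h y)) u :=
    ContDiffAt.comp u (g := ContinuousLinearMap.inverse) hi.self_of_nhds.contDiffAt_inverse hh
  let π : Fin n → Eu n →L[ℝ] ℝ := fun i => EuclideanSpace.proj i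
  have h2 : ContDiffAt ℝ ∞ (fun y => π i (ContinuousLinearMap.inverse (h y) (π j))) u :=
    (π i).contDiff.contDiffAt.comp u (h1.clm_apply contDiffAt_const)
  refine h2.congr_of_eventuallyEq ?_
  filter_upwards [hi] with y hy
  rw [hy.inverse_apply]
  simp [π, sharp, coordVec]

lemma contDiffAt_sharp {k : ℕ} {h : Eu k → Form n} {u : Eu k} (hh : ContDiffAt ℝ ∞ h u)
    (hi : ∀ᶠ y in nhds u, IsInner (h y)) {α : Eu k → Eu n → ℝ}
    (hα : ∀ z, ContDiffAt ℝ ∞ (fun y => α y z) u) :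
    ContDiffAt ℝ ∞ (fun y => sharp (h y) (α y)) u := by
  unfold sharp
  exact ContDiffAt.sum fun i _ => ContDiffAt.sum fun j _ =>
    ((contDiffAt_gram_inv hh hi i j).mul (hα _)).smul contDiffAt_const

lemma IsMetricOn.eventually {h : Eu n → Form n} {O : Set (Eu n)} (hO : IsMetricOn h O)
    {u : Eu n} (hu : u ∈ O) : ∀ᶠ y in nhds u, IsInner (h y) := by
  filter_upwards [hO.isOpen.mem_nhds hu] with y hy using hO.inner y hy

/-! ### Christoffel symbols -/

/-- The Christoffel symbols as a continuous bilinear map. -/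
def christoffelL (h : Eu n → Form n) (u : Eu n) : Eu n →L[ℝ] Eu n →L[ℝ] Eu n :=
  LinearMap.toContinuousLinearMap
    ((LinearMap.toContinuousLinearMap :
        (Eu n →ₗ[ℝ] Eu n) ≃ₗ[ℝ] (Eu n →L[ℝ] Eu n)).toLinearMap ∘ₗ
      LinearMap.mk₂ ℝ (christoffel h u)
        (fun v v' w => by
          simp only [christoffel]; rw [← sharp_add]; congr 1; ext z; simp; ring)
        (fun c v w => by
          simp only [christoffel]; rw [← sharp_smul]; congr 1; ext z; simp; ring)
        (fun v w w' => by
          simp only [christoffel]; rw [← sharp_add]; congr 1; ext z; simp; ring)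
        (fun c v w => by
          simp only [christoffel]; rw [← sharp_smul]; congr 1; ext z; simp; ring))

lemma christoffelL_apply (h : Eu n → Form n) (u v w : Eu n) :
    christoffelL h u v w = christoffel h u v w := rfl

lemma fderiv_form_apply {h : Eu n → Form n} {u : Eu n} (hh : DifferentiableAt ℝ h u)
    (x v w : Eu n) : fderiv ℝ (fun y => h y v w) u x = fderiv ℝ h u x v w := by
  have h1 : HasFDerivAt (fun y => h y v w) _ u :=
    (hh.hasFDerivAt.clm_apply (hasFDerivAt_const v u)).clm_apply (hasFDerivAt_const w u)
  rw [h1.fderiv]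
  simp

section metric

variable {h : Eu n → Form n} {O : Set (Eu n)} (hO : IsMetricOn h O)
include hO

lemma IsMetricOn.diff {u : Eu n} (hu : u ∈ O) : DifferentiableAt ℝ h u :=
  differentiableAt_of_smooth (hO.smooth u hu)

lemma IsMetricOn.fderiv_symm {u : Eu n} (hu : u ∈ O) (x v w : Eu n) :
    fderiv ℝ h u x v w = fderiv ℝ h u x w v := by
  rw [← fderiv_form_apply (hO.diff hu), ← fderiv_form_apply (hO.diff hu)]
  congr 1
  apply Filter.EventuallyEq.fderiv_eq
  filter_upwards [hO.eventually hu] with y hy using hy.symm v w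

lemma IsMetricOn.christoffel_inner {u : Eu n} (hu : u ∈ O) (v w z : Eu n) :
    h u (christoffel h u v w) z =
      (fderiv ℝ h u v w z + fderiv ℝ h u w v z - fderiv ℝ h u z v w) / 2 := by
  rw [christoffel, (hO.inner u hu).apply_sharp]
  exact ⟨fun a b => by simp; ring, fun c a => by simp; ring⟩

lemma IsMetricOn.christoffel_comm {u : Eu n} (hu : u ∈ O) (v w : Eu n) :
    christoffel h u v w = christoffel h u w v := by
  apply (hO.inner u hu).eq_of_forall
  intro z
  rw [hO.christoffel_inner hu, hO.christoffel_inner hu, hO.fderiv_symm hu z v w]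
  ring

/-- In the sum of the two Koszul expressions all derivatives cancel except the one in the direction
`x`. -/
lemma IsMetricOn.christoffel_compat {u : Eu n} (hu : u ∈ O) (x v w : Eu n) :
    h u (christoffel h u x v) w + h u v (christoffel h u x w) = fderiv ℝ h u x v w := by
  rw [(hO.inner u hu).symm v, hO.christoffel_inner hu, hO.christoffel_inner hu,
    hO.fderiv_symm hu x w v, hO.fderiv_symm hu v x w, hO.fderiv_symm hu w x v]
  ring

lemma IsMetricOn.smooth_christoffelL {u : Eu n} (hu : u ∈ O) :
    ContDiffAt ℝ ∞ (christoffelL h) u := by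
  rw [contDiffAt_clm_apply_iff]
  intro v
  rw [contDiffAt_clm_apply_iff]
  intro w
  simp only [christoffelL_apply, christoffel]
  refine contDiffAt_sharp (hO.smooth u hu) (hO.eventually hu) fun z => ?_
  have hD := contDiffAt_fderiv (hO.smooth u hu)
  have key : ∀ a b c : Eu n, ContDiffAt ℝ ∞ (fun y => fderiv ℝ h y a b c) u := fun a b c =>
    ((hD.clm_apply contDiffAt_const).clm_apply contDiffAt_const).clm_apply contDiffAt_const
  exact (((key v w z).add (key w v z)).sub (key z v w)).div_const 2

end metric

/-! ### Covariant derivatives along maps -/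

lemma covAlong_eq (h : Eu n → Form n) (φ σ : Eu m → Eu n) (u v : Eu m) :
    covAlong h φ σ u v = fderiv ℝ σ u v + christoffelL h (φ u) (fderiv ℝ φ u v) (σ u) := rfl

lemma covDeriv_eq_covAlong (h : Eu n → Form n) (σ : Eu n → Eu n) (u v : Eu n) :
    covDeriv h σ u v = covAlong h (fun y => y) σ u v := by
  simp [covDeriv, covAlong]

lemma covAlong_add_right (h : Eu n → Form n) (φ σ : Eu m → Eu n) (u v w : Eu m) :
    covAlong h φ σ u (v + w) = covAlong h φ σ u v + covAlong h φ σ u w := by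
  simp only [covAlong_eq, map_add, add_apply]; abel

lemma covAlong_smul_right (h : Eu n → Form n) (φ σ : Eu m → Eu n) (u : Eu m) (c : ℝ) (v : Eu m) :
    covAlong h φ σ u (c • v) = c • covAlong h φ σ u v := by
  simp only [covAlong_eq, map_smul, smul_apply, smul_add]

lemma covAlong_congr (h : Eu n → Form n) (φ : Eu m → Eu n) {σ τ : Eu m → Eu n} {u : Eu m}
    (hστ : σ =ᶠ[nhds u] τ) (v : Eu m) : covAlong h φ σ u v = covAlong h φ τ u v := by
  simp only [covAlong_eq, hστ.fderiv_eq, hστ.self_of_nhds]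

lemma covAlong_add (h : Eu n → Form n) (φ : Eu m → Eu n) {σ τ : Eu m → Eu n} {u : Eu m}
    (hσ : DifferentiableAt ℝ σ u) (hτ : DifferentiableAt ℝ τ u) (v : Eu m) :
    covAlong h φ (fun y => σ y + τ y) u v = covAlong h φ σ u v + covAlong h φ τ u v := by
  simp only [covAlong_eq, fderiv_fun_add hσ hτ, map_add, add_apply]; abel

lemma covAlong_smul (h : Eu n → Form n) (φ : Eu m → Eu n) {f : Eu m → ℝ} {σ : Eu m → Eu n}
    {u : Eu m} (hf : DifferentiableAt ℝ f u) (hσ : DifferentiableAt ℝ σ u) (v : Eu m) :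
    covAlong h φ (fun y => f y • σ y) u v =
      fderiv ℝ f u v • σ u + f u • covAlong h φ σ u v := by
  simp only [covAlong_eq, fderiv_fun_smul hf hσ, map_smul, add_apply, smul_apply, smul_add,
    ContinuousLinearMap.smulRight_apply]
  abel

lemma covAlong_const_smul (h : Eu n → Form n) (φ : Eu m → Eu n) (c : ℝ) {σ : Eu m → Eu n}
    {u : Eu m} (hσ : DifferentiableAt ℝ σ u) (v : Eu m) :
    covAlong h φ (fun y => c • σ y) u v = c • covAlong h φ σ u v := by
  simp only [covAlong_eq, fderiv_fun_const_smul hσ, map_smul, smul_apply, smul_add]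

/-- The covariant derivative along `φ` of the restriction to `φ` of a vector field. -/
lemma covAlong_comp (h : Eu n → Form n) {φ : Eu m → Eu n} {Y : Eu n → Eu n} {u : Eu m}
    (hφ : DifferentiableAt ℝ φ u) (hY : DifferentiableAt ℝ Y (φ u)) (v : Eu m) :
    covAlong h φ (fun y => Y (φ y)) u v = covDeriv h Y (φ u) (fderiv ℝ φ u v) := by
  have : HasFDerivAt (fun y => Y (φ y)) _ u := hY.hasFDerivAt.comp u hφ.hasFDerivAt
  simp [covAlong, covDeriv, this.fderiv]

section metric

variable {h : Eu n → Form n} {O : Set (Eu n)} (hO : IsMetricOn h O) {φ : Eu m → Eu n} {u : Eu m}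
include hO

lemma IsMetricOn.smooth_covAlong {σ : Eu m → Eu n} {V : Eu m → Eu m} (hu : φ u ∈ O)
    (hφ : ContDiffAt ℝ ∞ φ u) (hσ : ContDiffAt ℝ ∞ σ u) (hV : ContDiffAt ℝ ∞ V u) :
    ContDiffAt ℝ ∞ (fun y => covAlong h φ σ y (V y)) u := by
  simp only [covAlong_eq]
  exact (contDiffAt_fderiv_apply hσ hV).add
    (((ContDiffAt.comp u (g := christoffelL h) (hO.smooth_christoffelL hu) hφ).clm_apply
      (contDiffAt_fderiv_apply hφ hV)).clm_apply hσ)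

lemma IsMetricOn.smooth_inner {V W : Eu m → Eu n} (hu : φ u ∈ O)
    (hφ : ContDiffAt ℝ ∞ φ u) (hV : ContDiffAt ℝ ∞ V u) (hW : ContDiffAt ℝ ∞ W u) :
    ContDiffAt ℝ ∞ (fun y => h (φ y) (V y) (W y)) u :=
  contDiffAt_form_apply (ContDiffAt.comp u (g := h) (hO.smooth _ hu) hφ) hV hW

/-- The Levi-Civita connection is metric. -/
lemma IsMetricOn.fderiv_inner {V W : Eu m → Eu n} (hu : φ u ∈ O)
    (hφ : DifferentiableAt ℝ φ u) (hV : DifferentiableAt ℝ V u) (hW : DifferentiableAt ℝ W u)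
    (x : Eu m) :
    fderiv ℝ (fun y => h (φ y) (V y) (W y)) u x =
      h (φ u) (covAlong h φ V u x) (W u) + h (φ u) (V u) (covAlong h φ W u x) := by
  have h1 : HasFDerivAt (fun y => h (φ y)) ((fderiv ℝ h (φ u)).comp (fderiv ℝ φ u)) u :=
    HasFDerivAt.comp (g := h) u (hO.diff hu).hasFDerivAt hφ.hasFDerivAt
  have h2 := (h1.clm_apply hV.hasFDerivAt).clm_apply hW.hasFDerivAt
  have h3 := hO.christoffel_compat hu (fderiv ℝ φ u x) (V u) (W u)
  rw [h2.fderiv]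
  simp only [covAlong, map_add, add_apply]
  simp only [add_apply, ContinuousLinearMap.comp_apply, ContinuousLinearMap.flip_apply]
  rw [← h3]
  ring

/-- The Levi-Civita connection is torsion free. -/
lemma IsMetricOn.covAlong_fderiv_comm (hu : φ u ∈ O) (hφ : ContDiffAt ℝ ∞ φ u) (v w : Eu m) :
    covAlong h φ (fun y => fderiv ℝ φ y w) u v = covAlong h φ (fun y => fderiv ℝ φ y v) u w := by
  have hd := differentiableAt_of_smooth (contDiffAt_fderiv hφ)
  have h1 : ∀ a b, fderiv ℝ (fun y => fderiv ℝ φ y a) u b = fderiv ℝ (fderiv ℝ φ) u b a := by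
    intro a b
    rw [(hd.hasFDerivAt.clm_apply (hasFDerivAt_const a u)).fderiv]; simp
  simp only [covAlong, h1]
  rw [hO.christoffel_comm hu, (hφ.isSymmSndFDerivAt two_le_smooth) v w]

lemma curvature_eq {u : Eu n} (hu : u ∈ O) (X Y Z : Eu n) :
    curvature h u X Y Z = fderiv ℝ (christoffelL h) u X Y Z - fderiv ℝ (christoffelL h) u Y X Z
      + christoffelL h u X (christoffelL h u Y Z) - christoffelL h u Y (christoffelL h u X Z) := by
  have hd := differentiableAt_of_smooth (hO.smooth_christoffelL hu)
  have h1 : ∀ a b c, fderiv ℝ (fun y => christoffel h y a b) u c =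
      fderiv ℝ (christoffelL h) u c a b := by
    intro a b c
    have := ((hd.hasFDerivAt.clm_apply (hasFDerivAt_const a u)).clm_apply (hasFDerivAt_const b u))
    simp only [christoffelL_apply] at this
    rw [this.fderiv]; simp
  simp only [curvature, covDeriv, h1]
  simp only [← christoffelL_apply]
  abel

/-- The curvature as commutator of covariant derivatives. -/
lemma IsMetricOn.covAlong_covAlong_sub {σ : Eu m → Eu n} (hu : φ u ∈ O)
    (hφ : ContDiffAt ℝ ∞ φ u) (hσ : ContDiffAt ℝ ∞ σ u) (v w : Eu m) :
    covAlong h φ (fun y => covAlong h φ σ y w) u v - covAlong h φ (fun y => covAlong h φ σ y v) u w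
      = curvature h (φ u) (fderiv ℝ φ u v) (fderiv ℝ φ u w) (σ u) := by
  have hdφ := differentiableAt_of_smooth (contDiffAt_fderiv hφ)
  have hdσ := differentiableAt_of_smooth (contDiffAt_fderiv hσ)
  have hG := differentiableAt_of_smooth (hO.smooth_christoffelL hu)
  have hGφ : HasFDerivAt (fun y => christoffelL h (φ y)) _ u :=
    hG.hasFDerivAt.comp u (differentiableAt_of_smooth hφ).hasFDerivAt
  have h1 : ∀ a b, fderiv ℝ (fun y => covAlong h φ σ y a) u b =
      fderiv ℝ (fderiv ℝ σ) u b a + (fderiv ℝ (christoffelL h) (φ u) (fderiv ℝ φ u b)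
        (fderiv ℝ φ u a) (σ u) + christoffelL h (φ u) (fderiv ℝ (fderiv ℝ φ) u b a) (σ u)
        + christoffelL h (φ u) (fderiv ℝ φ u a) (fderiv ℝ σ u b)) := by
    intro a b
    have e1 := (hdσ.hasFDerivAt.clm_apply (hasFDerivAt_const a u)).add
      ((hGφ.clm_apply (hdφ.hasFDerivAt.clm_apply (hasFDerivAt_const a u))).clm_apply
        (differentiableAt_of_smooth hσ).hasFDerivAt)
    have e2 : fderiv ℝ (fun y => covAlong h φ σ y a) u = _ := e1.fderiv
    rw [e2]
    simp
    abel
  -- The second derivatives of `φ` and `σ` are symmetric in `v, w` and drop out of the commutator;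
  -- only the derivative of Γ and the quadratic terms in Γ remain.
  have s1 := (hφ.isSymmSndFDerivAt two_le_smooth) v w
  have s2 := (hσ.isSymmSndFDerivAt two_le_smooth) v w
  rw [curvature_eq hO hu]
  rw [covAlong_eq h φ (fun y => covAlong h φ σ y w), covAlong_eq h φ (fun y => covAlong h φ σ y v),
    h1, h1]
  simp only [covAlong_eq, map_add]
  rw [s1, s2]
  abel

end metric

/-! ### Covariant derivatives of vector fields and curvature identities -/

/-- The curvature tensor as a trilinear map. -/
def curvatureL {n : ℕ} (h : Eu n → Form n) (u : Eu n) : Eu n →ₗ[ℝ] Eu n →ₗ[ℝ] Eu n →ₗ[ℝ] Eu n :=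
  LinearMap.mk₂ ℝ
    (fun X Y =>
      { toFun := fun Z => fderiv ℝ (christoffelL h) u X Y Z - fderiv ℝ (christoffelL h) u Y X Z
          + christoffelL h u X (christoffelL h u Y Z) - christoffelL h u Y (christoffelL h u X Z)
        map_add' := fun Z W => by simp only [map_add]; abel
        map_smul' := fun c Z => by simp only [map_smul, RingHom.id_apply]; module })
    (fun X X' Y => by ext1 Z; simp only [LinearMap.coe_mk, AddHom.coe_mk, LinearMap.add_apply,
      map_add, add_apply]; abel)
    (fun c X Y => by ext1 Z; simp only [LinearMap.coe_mk, AddHom.coe_mk, LinearMap.smul_apply,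
      map_smul, smul_apply]; module)
    (fun X Y Y' => by ext1 Z; simp only [LinearMap.coe_mk, AddHom.coe_mk, LinearMap.add_apply,
      map_add, add_apply]; abel)
    (fun c X Y => by ext1 Z; simp only [LinearMap.coe_mk, AddHom.coe_mk, LinearMap.smul_apply,
      map_smul, smul_apply]; module)

section

variable {n : ℕ} {h : Eu n → Form n} {O : Set (Eu n)}

lemma covDeriv_const (h : Eu n → Form n) (u v w : Eu n) :
    covDeriv h (fun _ => w) u v = christoffel h u v w := by
  simp [covDeriv]

lemma curvature_antisymm (u X Y Z : Eu n) : curvature h u X Y Z = -curvature h u Y X Z := by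
  simp [curvature]

variable (hO : IsMetricOn h O) {u : Eu n} (hu : u ∈ O)
include hO hu

lemma IsMetricOn.curvature_eq_curvatureL (X Y Z : Eu n) :
    curvature h u X Y Z = curvatureL h u X Y Z := by
  rw [curvature_eq hO hu]
  rfl

lemma IsMetricOn.smooth_covDeriv {σ V : Eu n → Eu n} (hσ : ContDiffAt ℝ ∞ σ u)
    (hV : ContDiffAt ℝ ∞ V u) : ContDiffAt ℝ ∞ (fun y => covDeriv h σ y (V y)) u := by
  simp only [covDeriv_eq_covAlong]
  exact hO.smooth_covAlong hu contDiffAt_id hσ hV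

lemma IsMetricOn.smooth_christoffel (v w : Eu n) :
    ContDiffAt ℝ ∞ (fun y => christoffel h y v w) u :=
  ((hO.smooth_christoffelL hu).clm_apply contDiffAt_const).clm_apply contDiffAt_const

lemma IsMetricOn.fderiv_inner_field {V W : Eu n → Eu n}
    (hV : DifferentiableAt ℝ V u) (hW : DifferentiableAt ℝ W u) (x : Eu n) :
    fderiv ℝ (fun y => h y (V y) (W y)) u x =
      h u (covDeriv h V u x) (W u) + h u (V u) (covDeriv h W u x) := by
  simp only [covDeriv_eq_covAlong]
  exact hO.fderiv_inner (φ := fun y => y) hu differentiableAt_id hV hW x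

lemma IsMetricOn.covDeriv_covDeriv_sub {σ : Eu n → Eu n} (hσ : ContDiffAt ℝ ∞ σ u)
    (X Y : Eu n) :
    covDeriv h (fun y => covDeriv h σ y Y) u X - covDeriv h (fun y => covDeriv h σ y X) u Y
      = curvature h u X Y (σ u) := by
  have := hO.covAlong_covAlong_sub (φ := fun y => y) hu contDiffAt_id hσ X Y
  simpa [covDeriv_eq_covAlong] using this

/-- The second derivative of ⟨Z, W⟩ for constant Z, W is symmetric in X, Y. The products of two
Christoffel terms are symmetric as well, so the antisymmetric part ⟨R(X,Y)Z, W⟩ + ⟨Z, R(X,Y)W⟩ must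
vanish. -/
lemma IsMetricOn.curvature_skew (X Y Z W : Eu n) :
    h u (curvature h u X Y Z) W = -h u (curvature h u X Y W) Z := by
  have hc : ∀ y : Eu n, ∀ v : Eu n, DifferentiableAt ℝ (fun _ : Eu n => v) y :=
    fun y v => differentiableAt_const v
  have hf : ContDiffAt ℝ ∞ (fun y => h y Z W) u :=
    contDiffAt_form_apply (hO.smooth u hu) contDiffAt_const contDiffAt_const
  have h1 : ∀ Y, (fun y => fderiv ℝ (fun y => h y Z W) y Y) =ᶠ[nhds u]
      fun y => h y (christoffel h y Y Z) W + h y Z (christoffel h y Y W) := by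
    intro Y
    filter_upwards [hO.isOpen.mem_nhds hu] with y hy
    rw [hO.fderiv_inner_field hy (hc y Z) (hc y W), covDeriv_const, covDeriv_const]
  have hG : ∀ v w, DifferentiableAt ℝ (fun y => christoffel h y v w) u := fun v w =>
    differentiableAt_of_smooth (hO.smooth_christoffel hu v w)
  have hd : ∀ a b : Eu n → Eu n, DifferentiableAt ℝ a u → DifferentiableAt ℝ b u →
      DifferentiableAt ℝ (fun y => h y (a y) (b y)) u := fun a b ha hb =>
    ((hO.diff hu).clm_apply ha).clm_apply hb
  have h2 : ∀ X Y, fderiv ℝ (fderiv ℝ (fun y => h y Z W)) u X Y =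
      h u (covDeriv h (fun y => christoffel h y Y Z) u X) W +
        h u (christoffel h u Y Z) (christoffel h u X W) +
      (h u (christoffel h u X Z) (christoffel h u Y W) +
        h u Z (covDeriv h (fun y => christoffel h y Y W) u X)) := by
    intro X Y
    have e1 : fderiv ℝ (fun y => fderiv ℝ (fun y => h y Z W) y Y) u X =
        fderiv ℝ (fderiv ℝ (fun y => h y Z W)) u X Y := by
      have hdd := differentiableAt_of_smooth (contDiffAt_fderiv hf)
      rw [(hdd.hasFDerivAt.clm_apply (hasFDerivAt_const Y u)).fderiv]; simp
    rw [← e1, (h1 Y).fderiv_eq, fderiv_fun_add (hd _ _ (hG _ _) (hc u _)) (hd _ _ (hc u _) (hG _ _)),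
      add_apply, hO.fderiv_inner_field hu (hG _ _) (hc u _),
      hO.fderiv_inner_field hu (hc u _) (hG _ _), covDeriv_const, covDeriv_const]
  have h3 := (hf.isSymmSndFDerivAt two_le_smooth) X Y
  rw [h2, h2] at h3
  simp only [curvature, map_sub, sub_apply]
  rw [(hO.inner u hu).symm _ Z, (hO.inner u hu).symm _ Z] at *
  linarith

/-- Holds because Γ, and hence its derivative, is symmetric in its two arguments (no torsion). -/
lemma IsMetricOn.bianchi (X Y Z : Eu n) :
    curvature h u X Y Z + curvature h u Y Z X + curvature h u Z X Y = 0 := by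
  have hd := differentiableAt_of_smooth (hO.smooth_christoffelL hu)
  have h1 : ∀ a b c, fderiv ℝ (christoffelL h) u a b c = fderiv ℝ (christoffelL h) u a c b := by
    intro a b c
    have e : ∀ b c, fderiv ℝ (fun y => christoffelL h y b c) u a =
        fderiv ℝ (christoffelL h) u a b c := by
      intro b c
      rw [((hd.hasFDerivAt.clm_apply (hasFDerivAt_const b u)).clm_apply
        (hasFDerivAt_const c u)).fderiv]; simp
    rw [← e, ← e]
    congr 1
    apply Filter.EventuallyEq.fderiv_eq
    filter_upwards [hO.isOpen.mem_nhds hu] with y hy using hO.christoffel_comm hy b c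
  have h2 : ∀ a b, christoffelL h u a b = christoffelL h u b a := hO.christoffel_comm hu
  simp only [curvature_eq hO hu]
  rw [h1 X Y Z, h1 Y Z X, h1 Z X Y, h2 Y Z, h2 Z X, h2 X Y]
  abel

/-- The classical octahedron argument: four instances of the Bianchi identity combined with the two
antisymmetries. -/
lemma IsMetricOn.curvature_pair (X Y Z W : Eu n) :
    h u (curvature h u X Y Z) W = h u (curvature h u Z W X) Y := by
  have a : ∀ X Y Z W, h u (curvature h u X Y Z) W = -h u (curvature h u Y X Z) W := by
    intro X Y Z W; rw [curvature_antisymm]; simp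
  have s := hO.curvature_skew hu
  have b : ∀ X Y Z W, h u (curvature h u X Y Z) W + h u (curvature h u Y Z X) W
      + h u (curvature h u Z X Y) W = 0 := by
    intro X Y Z W
    rw [← add_apply, ← map_add, ← add_apply, ← map_add, hO.bianchi hu]; simp
  linarith [b X Y Z W, b Y Z W X, b Z W X Y, b W X Y Z, s X Y Z W, s Y Z X W, s Z X Y W,
    s Z W X Y, s W X Y Z, s Y W X Z, s X Z W Y, s Y Z W X, s W X Z Y, a X Y Z W, a Y Z X W,
    a Z X Y W, a Z W X Y, a W X Y Z, a Z W Y X, a Y W Z X, a W Y X Z, a X Z Y W, a Z X W Y,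
    a Y W X Z, s W Y X Z, s W X Z Y, s X Z Y W, s W Y Z X]

end

/-! ### Unit Killing fields in dimension three -/

/-- A unit field `ξ` on a three-dimensional domain with `∇_Z ξ = r Z ∧ ξ`, where
`j u v w = ⟨v ∧ ξ, w⟩`. -/
structure IsKillingData (h : Eu 3 → Form 3) (O : Set (Eu 3)) (ξ : Eu 3 → Eu 3)
    (j : Eu 3 → Form 3) (r : Eu 3 → ℝ) : Prop where
  metric : IsMetricOn h O
  smooth_field : ∀ u ∈ O, ContDiffAt ℝ ∞ ξ u
  unit : ∀ u ∈ O, h u (ξ u) (ξ u) = 1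
  smooth_cross : ∀ u ∈ O, ContDiffAt ℝ ∞ j u
  cross_skew : ∀ u ∈ O, ∀ v w, j u v w = -j u w v
  cross_field : ∀ u ∈ O, ∀ v, j u (ξ u) v = 0
  -- The right side is the Gram determinant of v, ξ, w with |ξ| = 1, i.e. the square of the volume
  -- they span. It determines `j` up to sign, so no separate volume form is needed.
  cross_sq : ∀ u ∈ O, ∀ v w, j u v w ^ 2 =
    h u v v * h u w w + 2 * h u v w * h u (ξ u) v * h u (ξ u) w - h u v v * h u (ξ u) w ^ 2
      - h u w w * h u (ξ u) v ^ 2 - h u v w ^ 2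
  smooth_curv : ∀ u ∈ O, ContDiffAt ℝ ∞ r u
  covDeriv_field : ∀ u ∈ O, ∀ v z, h u (covDeriv h ξ u v) z = r u * j u v z

/-- An orthonormal frame whose third vector is `ξ`. -/
structure IsAdaptedFrame (h : Eu 3 → Form 3) (ξ : Eu 3 → Eu 3) (j : Eu 3 → Form 3) (u : Eu 3)
    (e : Fin 3 → Eu 3) : Prop where
  ortho : IsOrtho (h u) e
  third : e 2 = ξ u
  cross : j u (e 0) (e 1) = 1

section Killing

variable {h : Eu 3 → Form 3} {O : Set (Eu 3)} {ξ : Eu 3 → Eu 3} {j : Eu 3 → Form 3} {r : Eu 3 → ℝ}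
  (hK : IsKillingData h O ξ j r) {u : Eu 3} (hu : u ∈ O)
include hK hu

lemma IsKillingData.cross_self (v : Eu 3) : j u v v = 0 := by
  linarith [hK.cross_skew u hu v v]

lemma IsKillingData.cross_field_right (v : Eu 3) : j u v (ξ u) = 0 := by
  rw [hK.cross_skew u hu, hK.cross_field u hu, neg_zero]

/-- For orthonormal horizontal vectors the Gram identity gives j² = 1; if the sign is wrong, the two
vectors are exchanged. -/
lemma IsKillingData.exists_frame : ∃ e, IsAdaptedFrame h ξ j u e := by
  have hB := hK.metric.inner u hu
  obtain ⟨e₁, h11, h1⟩ := hB.exists_unit_orthogonal (k := 1) (by norm_num) ![ξ u]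
  obtain ⟨e₂, h22, h2⟩ := hB.exists_unit_orthogonal (k := 2) (by norm_num) ![ξ u, e₁]
  have a1 : h u (ξ u) e₁ = 0 := h1 0
  have a2 : h u (ξ u) e₂ = 0 := h2 0
  have a3 : h u e₁ e₂ = 0 := h2 1
  have b1 := hB.symm (ξ u) e₁
  have b2 := hB.symm (ξ u) e₂
  have b3 := hB.symm e₁ e₂
  have hξ := hK.unit u hu
  have hj := hK.cross_sq u hu e₁ e₂
  rw [a1, a2, a3, h11, h22] at hj
  have hj' : (j u e₁ e₂ - 1) * (j u e₁ e₂ + 1) = 0 := by linarith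
  rcases mul_eq_zero.mp hj' with hj' | hj'
  · refine ⟨![e₁, e₂, ξ u], ⟨fun i k => ?_, rfl, by simpa using sub_eq_zero.mp hj'⟩⟩
    fin_cases i <;> fin_cases k <;> simp <;> linarith
  · refine ⟨![e₂, e₁, ξ u], ⟨fun i k => ?_, rfl, ?_⟩⟩
    · fin_cases i <;> fin_cases k <;> simp <;> linarith
    · have := hK.cross_skew u hu e₂ e₁
      simp; linarith

omit hK hu in
lemma IsAdaptedFrame.inner {e : Fin 3 → Eu 3} (he : IsAdaptedFrame h ξ j u e) :
    h u (e 0) (e 0) = 1 ∧ h u (e 1) (e 1) = 1 ∧ h u (ξ u) (ξ u) = 1 ∧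
    h u (e 0) (e 1) = 0 ∧ h u (e 1) (e 0) = 0 ∧ h u (e 0) (ξ u) = 0 ∧ h u (ξ u) (e 0) = 0 ∧
    h u (e 1) (ξ u) = 0 ∧ h u (ξ u) (e 1) = 0 := by
  rw [← he.third]
  have := he.ortho
  simp only [IsOrtho] at this
  simp [this]

lemma IsKillingData.frame_expand {e : Fin 3 → Eu 3} (he : IsAdaptedFrame h ξ j u e) (v : Eu 3) :
    v = h u v (e 0) • e 0 + h u v (e 1) • e 1 + h u v (ξ u) • ξ u := by
  have := he.ortho.expand (hK.metric.inner u hu) v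
  rw [Fin.sum_univ_three, he.third] at this
  exact this

lemma IsKillingData.frame_cross {e : Fin 3 → Eu 3} (he : IsAdaptedFrame h ξ j u e) (v w : Eu 3) :
    j u v w = h u v (e 0) * h u w (e 1) - h u v (e 1) * h u w (e 0) := by
  conv_lhs => rw [hK.frame_expand hu he v, hK.frame_expand hu he w]
  have h10 := hK.cross_skew u hu (e 1) (e 0)
  rw [he.cross] at h10
  simp only [map_add, map_smul, add_apply, smul_apply, smul_eq_mul, hK.cross_self hu,
    hK.cross_field_right hu, hK.cross_field u hu, he.cross, h10]
  ring

lemma IsKillingData.frame_inner {e : Fin 3 → Eu 3} (he : IsAdaptedFrame h ξ j u e) (v w : Eu 3) :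
    h u v w = h u v (e 0) * h u w (e 0) + h u v (e 1) * h u w (e 1)
      + h u v (ξ u) * h u w (ξ u) := by
  conv_lhs => rw [hK.frame_expand hu he w]
  simp only [map_add, map_smul, smul_eq_mul]
  ring

lemma IsKillingData.diff_field : DifferentiableAt ℝ ξ u :=
  differentiableAt_of_smooth (hK.smooth_field u hu)

lemma IsKillingData.covDeriv_field_eq {e : Fin 3 → Eu 3} (he : IsAdaptedFrame h ξ j u e)
    (v : Eu 3) :
    covDeriv h ξ u v = (-r u * h u v (e 1)) • e 0 + (r u * h u v (e 0)) • e 1 := by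
  apply (hK.metric.inner u hu).eq_of_forall
  intro z
  rw [hK.covDeriv_field u hu, hK.frame_cross hu he]
  simp only [map_add, map_smul, add_apply, smul_apply, smul_eq_mul]
  rw [(hK.metric.inner u hu).symm (e 0) z, (hK.metric.inner u hu).symm (e 1) z]
  ring

/-- The derivative of `⟨ξ, V⟩`. -/
lemma IsKillingData.fderiv_dual {V : Eu 3 → Eu 3} (hV : DifferentiableAt ℝ V u) (x : Eu 3) :
    fderiv ℝ (fun y => h y (ξ y) (V y)) u x =
      r u * j u x (V u) + h u (ξ u) (covDeriv h V u x) := by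
  rw [hK.metric.fderiv_inner_field hu (hK.diff_field hu) hV, hK.covDeriv_field u hu]

omit hK hu in
/-- The covariant derivative of the bilinear form `j`. -/
def covCross (h : Eu 3 → Form 3) (j : Eu 3 → Form 3) (u x v w : Eu 3) : ℝ :=
  fderiv ℝ j u x v w - j u (christoffel h u x v) w - j u v (christoffel h u x w)

lemma IsKillingData.fderiv_cross {V W : Eu 3 → Eu 3} (hV : DifferentiableAt ℝ V u)
    (hW : DifferentiableAt ℝ W u) (x : Eu 3) :
    fderiv ℝ (fun y => j y (V y) (W y)) u x =
      covCross h j u x (V u) (W u) + j u (covDeriv h V u x) (W u)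
        + j u (V u) (covDeriv h W u x) := by
  have hj := differentiableAt_of_smooth (hK.smooth_cross u hu)
  rw [((hj.hasFDerivAt.clm_apply hV.hasFDerivAt).clm_apply hW.hasFDerivAt).fderiv]
  simp only [covCross, covDeriv, map_add, add_apply, ContinuousLinearMap.comp_apply,
    ContinuousLinearMap.flip_apply]
  ring

omit hK hu in
/-- An extension of the vector `v` at `u` that is parallel at `u`. -/
def parallelExt (h : Eu 3 → Form 3) (u v y : Eu 3) : Eu 3 := v - christoffelL h u (y - u) v

omit hK hu in
lemma parallelExt_self (v : Eu 3) : parallelExt h u v u = v := by simp [parallelExt]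

omit hK hu in
lemma hasFDerivAt_parallelExt (v : Eu 3) :
    HasFDerivAt (parallelExt h u v) (-(christoffelL h u).flip v) u := by
  have h1 : ∀ L : Eu 3 →L[ℝ] Eu 3, HasFDerivAt (fun y => v - L (y - u)) (-L) u := by
    intro L
    have h2 : HasFDerivAt (fun y => L y - L u) L u := L.hasFDerivAt.sub_const (L u)
    have h3 : HasFDerivAt (fun y => v - (L y - L u)) (-L) u := h2.const_sub v
    simpa only [map_sub] using h3
  exact h1 ((christoffelL h u).flip v)

omit hK hu in
lemma covDeriv_parallelExt (v x : Eu 3) : covDeriv h (parallelExt h u v) u x = 0 := by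
  simp [covDeriv, (hasFDerivAt_parallelExt v).fderiv, parallelExt_self, christoffelL_apply]

lemma IsKillingData.covCross_skew (x v w : Eu 3) :
    covCross h j u x v w = -covCross h j u x w v := by
  have hd := differentiableAt_of_smooth (hK.smooth_cross u hu)
  have h1 : fderiv ℝ j u x v w = -fderiv ℝ j u x w v := by
    rw [← fderiv_form_apply hd, ← fderiv_form_apply hd]
    have : (fun y => j y v w) =ᶠ[nhds u] fun y => -j y w v := by
      filter_upwards [hK.metric.isOpen.mem_nhds hu] with y hy using hK.cross_skew y hy v w
    rw [this.fderiv_eq, fderiv_fun_neg]; simp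
  rw [covCross, covCross, h1, hK.cross_skew u hu (christoffel h u x v),
    hK.cross_skew u hu v]
  ring

/-- Derivative of the identity j(ξ, w) = 0. -/
lemma IsKillingData.covCross_field (x w : Eu 3) :
    covCross h j u x (ξ u) w = -j u (covDeriv h ξ u x) w := by
  have h1 := hK.fderiv_cross hu (hK.diff_field hu) (differentiableAt_const w) x
  have h2 : (fun y => j y (ξ y) w) =ᶠ[nhds u] fun _ => 0 := by
    filter_upwards [hK.metric.isOpen.mem_nhds hu] with y hy using hK.cross_field y hy w
  rw [h2.fderiv_eq, hK.cross_field u hu] at h1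
  simp at h1
  linarith

/-- This replaces parallelism of the volume form. The Gram identity for j² is differentiated on
extensions V, W of the frame vectors that are parallel at `u`: inner products among V and W are
stationary, and the terms with ⟨ξ, V⟩ and ⟨ξ, W⟩ are products of two factors vanishing at `u`. Hence
2j·∇j = 0 with j = 1. -/
lemma IsKillingData.covCross_frame {e : Fin 3 → Eu 3} (he : IsAdaptedFrame h ξ j u e) (x : Eu 3) :
    covCross h j u x (e 0) (e 1) = 0 := by
  set V := parallelExt h u (e 0) with hV
  set W := parallelExt h u (e 1) with hW
  have dV : DifferentiableAt ℝ V u := (hasFDerivAt_parallelExt _).differentiableAt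
  have dW : DifferentiableAt ℝ W u := (hasFDerivAt_parallelExt _).differentiableAt
  have V0 : V u = e 0 := parallelExt_self _
  have W0 : W u = e 1 := parallelExt_self _
  have hd := hK.metric.diff hu
  have hξ := hK.diff_field hu
  have dd : ∀ a b : Eu 3 → Eu 3, DifferentiableAt ℝ a u → DifferentiableAt ℝ b u →
      DifferentiableAt ℝ (fun y => h y (a y) (b y)) u := fun a b ha hb =>
    (hd.clm_apply ha).clm_apply hb
  have dj : DifferentiableAt ℝ (fun y => j y (V y) (W y)) u :=
    ((differentiableAt_of_smooth (hK.smooth_cross u hu)).clm_apply dV).clm_apply dW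
  obtain ⟨i1, i2, i3, i4, i5, i6, i7, i8, i9⟩ := he.inner
  have zero : ∀ a b : Eu 3 → Eu 3, DifferentiableAt ℝ a u → DifferentiableAt ℝ b u →
      covDeriv h a u x = 0 → covDeriv h b u x = 0 →
      fderiv ℝ (fun y => h y (a y) (b y)) u x = 0 := by
    intro a b ha hb h1 h2
    rw [hK.metric.fderiv_inner_field hu ha hb, h1, h2]; simp
  have pV : covDeriv h V u x = 0 := covDeriv_parallelExt _ _
  have pW : covDeriv h W u x = 0 := covDeriv_parallelExt _ _
  have eqn : (fun y => j y (V y) (W y) * j y (V y) (W y)) =ᶠ[nhds u] fun y =>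
      h y (V y) (V y) * h y (W y) (W y)
        + 2 * (h y (V y) (W y) * (h y (ξ y) (V y) * h y (ξ y) (W y)))
        - h y (V y) (V y) * (h y (ξ y) (W y) * h y (ξ y) (W y))
        - h y (W y) (W y) * (h y (ξ y) (V y) * h y (ξ y) (V y))
        - h y (V y) (W y) * h y (V y) (W y) := by
    filter_upwards [hK.metric.isOpen.mem_nhds hu] with y hy
    linear_combination hK.cross_sq y hy (V y) (W y)
  have f1 := (dd V V dV dV).hasFDerivAt
  have f2 := (dd W W dW dW).hasFDerivAt
  have f3 := (dd V W dV dW).hasFDerivAt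
  have f4 := (dd ξ V hξ dV).hasFDerivAt
  have f5 := (dd ξ W hξ dW).hasFDerivAt
  have F := ((((f1.mul f2).add ((f3.mul (f4.mul f5)).const_mul (2 : ℝ))).sub
    (f1.mul (f5.mul f5))).sub (f2.mul (f4.mul f4))).sub (f3.mul f3)
  have L := dj.hasFDerivAt.mul dj.hasFDerivAt
  have e1 := (L.congr_of_eventuallyEq eqn.symm).unique F
  have e2 := congrArg (fun L : Eu 3 →L[ℝ] ℝ => L x) e1
  simp [V0, W0, he.cross, i4, i7, i9, zero V V dV dV pV pV, zero W W dW dW pW pW] at e2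
  rw [hK.fderiv_cross hu dV dW, pV, pW, V0, W0] at e2
  simpa using e2

/-- Conceptually j(v, w) = vol(v, ξ, w) with vol parallel, so the derivative is vol(v, r x∧ξ, w),
expanded by the identity of Lagrange. The proof checks it on an adapted frame, where only the slots
containing ξ contribute. -/
lemma IsKillingData.covCross_eq (x v w : Eu 3) :
    covCross h j u x v w =
      r u * (h u (ξ u) v * h u x w - h u (ξ u) w * h u x v) := by
  obtain ⟨e, he⟩ := hK.exists_frame hu
  have hB := hK.metric.inner u hu
  have add1 : ∀ a b c, covCross h j u x (a + b) c = covCross h j u x a c + covCross h j u x b c := by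
    intro a b c
    simp only [covCross, ← christoffelL_apply, map_add, add_apply]; ring
  have smul1 : ∀ (t : ℝ) a c, covCross h j u x (t • a) c = t * covCross h j u x a c := by
    intro t a c
    simp only [covCross, ← christoffelL_apply, map_smul, smul_apply, smul_eq_mul]; ring
  have add2 : ∀ a b c, covCross h j u x c (a + b) = covCross h j u x c a + covCross h j u x c b := by
    intro a b c
    simp only [covCross, ← christoffelL_apply, map_add]; ring
  have smul2 : ∀ (t : ℝ) a c, covCross h j u x c (t • a) = t * covCross h j u x c a := by
    intro t a c
    simp only [covCross, ← christoffelL_apply, map_smul, smul_eq_mul]; ring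
  have sk := hK.covCross_skew hu x
  have self : ∀ a, covCross h j u x a a = 0 := fun a => by linarith [sk a a]
  obtain ⟨i1, i2, i3, i4, i5, i6, i7, i8, i9⟩ := he.inner
  have fe : ∀ w, covCross h j u x (ξ u) w = r u * (h u x w - h u (ξ u) w * h u x (ξ u)) := by
    intro w
    rw [hK.covCross_field hu, hK.covDeriv_field_eq hu he, hK.frame_cross hu he,
      hK.frame_inner hu he x w]
    simp only [map_add, map_smul, add_apply, smul_apply, smul_eq_mul, i1, i2, i4, i5]
    rw [hB.symm (ξ u) w]
    ring
  conv_lhs => rw [hK.frame_expand hu he v, hK.frame_expand hu he w]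
  simp only [add1, smul1, add2, smul2, self, hK.covCross_frame hu he, fe, sk (e 0) (ξ u),
    sk (e 1) (ξ u), sk (e 1) (e 0), i7, i9]
  rw [hK.frame_inner hu he x w, hK.frame_inner hu he x v, hB.symm (ξ u) v, hB.symm (ξ u) w]
  ring

/-- The curvature `R(x, y)ξ`. -/
lemma IsKillingData.curvature_field (x y z : Eu 3) :
    h u (curvature h u x y (ξ u)) z =
      fderiv ℝ r u x * j u y z - fderiv ℝ r u y * j u x z
        + r u ^ 2 * (h u (ξ u) y * h u x z - h u (ξ u) x * h u y z) := by
  have hr := differentiableAt_of_smooth (hK.smooth_curv u hu)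
  have hj := differentiableAt_of_smooth (hK.smooth_cross u hu)
  -- Derivative in the direction `x` of ⟨∇_y ξ, z⟩ = r j(y, z) with constant y, z. The Christoffel
  -- term is symmetric in x, y and disappears in the commutator.
  have key : ∀ x y, h u (covDeriv h (fun p => covDeriv h ξ p y) u x) z =
      fderiv ℝ r u x * j u y z + r u * (covCross h j u x y z + j u (christoffel h u x y) z) := by
    intro x y
    have d1 : DifferentiableAt ℝ (fun p => covDeriv h ξ p y) u := differentiableAt_of_smooth
      (hK.metric.smooth_covDeriv hu (hK.smooth_field u hu) contDiffAt_const)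
    have h1 := hK.metric.fderiv_inner_field hu d1 (differentiableAt_const z) x
    have h2 : (fun p => h p (covDeriv h ξ p y) z) =ᶠ[nhds u] fun p => r p * j p y z := by
      filter_upwards [hK.metric.isOpen.mem_nhds hu] with p hp using hK.covDeriv_field p hp y z
    have dj : DifferentiableAt ℝ (fun p => j p y z) u :=
      (hj.clm_apply (differentiableAt_const y)).clm_apply (differentiableAt_const z)
    rw [h2.fderiv_eq, fderiv_fun_mul hr dj, covDeriv_const, hK.covDeriv_field u hu] at h1
    have h3 := hK.fderiv_cross hu (differentiableAt_const y) (differentiableAt_const z) x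
    rw [covDeriv_const, covDeriv_const] at h3
    simp only [add_apply, smul_apply, smul_eq_mul] at h1
    rw [h3] at h1
    linear_combination -h1
  rw [← hK.metric.covDeriv_covDeriv_sub hu (hK.smooth_field u hu)]
  simp only [map_sub, sub_apply]
  rw [key, key, hK.covCross_eq hu, hK.covCross_eq hu, hK.metric.christoffel_comm hu x y,
    (hK.metric.inner u hu).symm x y]
  ring

/-- The bundle curvature is constant along the trajectories of `ξ`. -/
lemma IsKillingData.fderiv_curv_field : fderiv ℝ r u (ξ u) = 0 := by
  obtain ⟨e, he⟩ := hK.exists_frame hu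
  obtain ⟨i1, i2, i3, i4, i5, i6, i7, i8, i9⟩ := he.inner
  -- The form (x, y) ↦ ⟨R(x, ξ)ξ, y⟩ is symmetric, whereas the formula for R(·, ξ)ξ gives -ξ(r) on
  -- (e₀, e₁) and +ξ(r) on (e₁, e₀).
  have h1 := hK.curvature_field hu (e 0) (ξ u) (e 1)
  have h2 := hK.curvature_field hu (e 1) (ξ u) (e 0)
  have h3 := hK.metric.curvature_pair hu (e 0) (ξ u) (ξ u) (e 1)
  have h4 := hK.metric.curvature_skew hu (ξ u) (e 1) (e 0) (ξ u)
  have h5 : h u (curvature h u (ξ u) (e 1) (ξ u)) (e 0) =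
    -h u (curvature h u (e 1) (ξ u) (ξ u)) (e 0) := by
    rw [curvature_antisymm]; simp
  have h6 := hK.cross_skew u hu (e 1) (e 0)
  rw [hK.cross_field u hu, he.cross, i7, i4] at h1
  rw [hK.cross_field u hu, h6, he.cross, i9, i5] at h2
  linarith

end Killing

/-! ### Ricci curvature -/

lemma IsOrtho.ext_bilin {n : ℕ} {B : Form n} (hB : IsInner B) {e : Fin n → Eu n}
    (he : IsOrtho B e) {T T' : Eu n → Eu n → ℝ}
    (h1 : ∀ w, IsLinearMap ℝ fun v => T v w) (h2 : ∀ v, IsLinearMap ℝ (T v))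
    (h1' : ∀ w, IsLinearMap ℝ fun v => T' v w) (h2' : ∀ v, IsLinearMap ℝ (T' v))
    (h : ∀ i k, T (e i) (e k) = T' (e i) (e k)) (v w : Eu n) : T v w = T' v w := by
  have key : ∀ S : Eu n → Eu n → ℝ, (∀ w, IsLinearMap ℝ fun v => S v w) →
      (∀ v, IsLinearMap ℝ (S v)) →
      S v w = ∑ i, ∑ k, B v (e i) * (B w (e k) * S (e i) (e k)) := by
    intro S s1 s2
    have a1 : ∀ w, S v w = ∑ i, B v (e i) * S (e i) w := by
      intro w
      have : S v w = (s1 w).mk' _ v := rfl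
      rw [this]
      conv_lhs => rw [he.expand hB v]
      rw [map_sum]
      simp only [map_smul, smul_eq_mul]
      rfl
    rw [a1]
    refine Finset.sum_congr rfl fun i _ => ?_
    have : S (e i) w = (s2 (e i)).mk' _ w := rfl
    rw [this]
    conv_lhs => rw [he.expand hB w]
    rw [map_sum, Finset.mul_sum]
    simp only [map_smul, smul_eq_mul]
    rfl
  rw [key T h1 h2, key T' h1' h2']
  exact Finset.sum_congr rfl fun i _ => Finset.sum_congr rfl fun k _ => by rw [h]

/-- The Ricci tensor. -/
def ricci {n : ℕ} (h : Eu n → Form n) (e : Fin n → Eu n) (u X Y : Eu n) : ℝ :=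
  ∑ i, h u (curvature h u (e i) X Y) (e i)

lemma IsMetricOn.ricci_frame {n : ℕ} {h : Eu n → Form n} {O : Set (Eu n)} (hO : IsMetricOn h O)
    {u : Eu n} (hu : u ∈ O) {e e' : Fin n → Eu n} (he : IsOrtho (h u) e) (he' : IsOrtho (h u) e')
    (X Y : Eu n) : ricci h e u X Y = ricci h e' u X Y := by
  refine he.sum_eq_sum he' (T := fun v w => h u (curvature h u v X Y) w) (fun w => ?_) fun v => ?_
  · simp only [hO.curvature_eq_curvatureL hu]
    exact ⟨fun x y => by simp, fun c x => by simp⟩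
  · exact ⟨fun x y => by simp, fun c x => by simp⟩

section

variable {h : Eu 3 → Form 3} {O : Set (Eu 3)} {ξ : Eu 3 → Eu 3} {j : Eu 3 → Form 3} {r : Eu 3 → ℝ}
  (hK : IsKillingData h O ξ j r) {u : Eu 3} (hu : u ∈ O)
include hK hu

/-- The Ricci tensor of a space with a unit Killing field. -/
lemma IsKillingData.ricci_eq {e : Fin 3 → Eu 3} (he : IsAdaptedFrame h ξ j u e)
    (hsec : h u (curvature h u (e 0) (e 1) (e 1)) (e 0) = r u ^ 2)
    {G : Eu 3} (hG : ∀ z, h u G z = fderiv ℝ r u z) (X Y : Eu 3) :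
    ricci h e u X Y =
      2 * r u ^ 2 * h u X Y + h u (ξ u) X * j u Y G + h u (ξ u) Y * j u X G := by
  have hB := hK.metric.inner u hu
  have hc := hK.metric.curvature_eq_curvatureL hu
  refine he.ortho.ext_bilin hB (T := ricci h e u) (T' := fun X Y =>
    2 * r u ^ 2 * h u X Y + h u (ξ u) X * j u Y G + h u (ξ u) Y * j u X G)
    (fun w => ?_) (fun w => ?_) (fun w => ?_) (fun w => ?_) ?_ X Y
  · simp only [ricci, hc]
    exact ⟨fun x y => by simp [Finset.sum_add_distrib], fun c x => by simp [Finset.mul_sum]⟩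
  · change IsLinearMap ℝ fun Y => ricci h e u w Y
    simp only [ricci, hc]
    exact ⟨fun x y => by simp [Finset.sum_add_distrib], fun c x => by simp [Finset.mul_sum]⟩
  · exact ⟨fun x y => by simp; ring, fun c x => by simp; ring⟩
  · exact ⟨fun x y => by simp; ring, fun c x => by simp; ring⟩
  obtain ⟨i1, i2, i3, i4, i5, i6, i7, i8, i9⟩ := he.inner
  have F := hK.curvature_field hu
  have S := hK.metric.curvature_skew hu
  have P := hK.metric.curvature_pair hu
  have A : ∀ X Y Z W, h u (curvature h u X Y Z) W = -h u (curvature h u Y X Z) W := by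
    intro X Y Z W; rw [curvature_antisymm]; simp
  have A0 : ∀ X Z W, h u (curvature h u X X Z) W = 0 := fun X Z W => by linarith [A X X Z W]
  have S0 : ∀ X Y Z, h u (curvature h u X Y Z) Z = 0 := fun X Y Z => by linarith [S X Y Z Z]
  have r0 := hK.fderiv_curv_field hu
  have c01 := he.cross
  have c10 : j u (e 1) (e 0) = -1 := by rw [hK.cross_skew u hu, c01]
  have cs := hK.cross_self hu
  have cf := hK.cross_field u hu
  have jG : ∀ X, j u X G = h u X (e 0) * fderiv ℝ r u (e 1) - h u X (e 1) * fderiv ℝ r u (e 0) := by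
    intro X
    rw [hK.frame_cross hu he, hG, hG]
  have L : ∀ a b, h u (curvature h u (ξ u) a b) (ξ u) = -h u (curvature h u (ξ u) a (ξ u)) b :=
    fun a b => S _ _ _ _
  have R1 : h u (curvature h u (e 1) (e 0) (e 0)) (e 1) = r u ^ 2 := by
    rw [A, S, neg_neg, hsec]
  -- The mixed components are moved by pair symmetry into the form R(e₀, e₁)ξ; they are where grad r
  -- enters the Ricci tensor.
  have M1 : h u (curvature h u (e 1) (ξ u) (e 0)) (e 1) = fderiv ℝ r u (e 1) := by
    rw [P, S, F, c01, cs, i7, i9]; ring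
  have M2 : h u (curvature h u (e 0) (ξ u) (e 1)) (e 0) = -fderiv ℝ r u (e 0) := by
    rw [P, S, F, c10, cs, i7, i9]; ring
  intro i k
  simp only [ricci, Fin.sum_univ_three, he.third]
  fin_cases i <;> fin_cases k <;>
    simp only [Fin.zero_eta, Fin.mk_one, Fin.reduceFinMk, he.third, A0, S0, L, F, jG, R1, hsec,
      i1, i2, i3, i4, i5, i6, i7, i8, i9, c01, c10, cs, cf, r0, M1, M2] <;> ring

end

/-! ### Curvature of a Riemannian submersion with a unit Killing field -/

lemma IsOrtho.det_sq_mul {n : ℕ} {B : Form n} {e : Fin n → Eu n} (he : IsOrtho B e) :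
    (coordMatrix e).det ^ 2 * (gram B).det = 1 := by
  have := congrArg Matrix.det he.matrix_eq
  rw [Matrix.det_mul, Matrix.det_mul, Matrix.det_transpose, Matrix.det_one] at this
  linarith

/-- Under a change of basis with determinant d the numerator is multiplied by d², and an orthonormal
basis has d² det g = 1. -/
lemma IsMetricOn.gaussK_eq {g : Eu 2 → Form 2} {O : Set (Eu 2)} (hO : IsMetricOn g O)
    {p : Eu 2} (hp : p ∈ O) {e : Fin 2 → Eu 2} (he : IsOrtho (g p) e) :
    gaussK g p = g p (curvature g p (e 0) (e 1) (e 1)) (e 0) := by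
  have hd := he.det_sq_mul
  have hc := hO.curvature_eq_curvatureL hp
  have A : ∀ X Y Z W, g p (curvature g p X Y Z) W = -g p (curvature g p Y X Z) W := by
    intro X Y Z W; rw [curvature_antisymm]; simp
  have S := hO.curvature_skew hp
  have A0 : ∀ X Z W, g p (curvature g p X X Z) W = 0 := fun X Z W => by linarith [A X X Z W]
  have S0 : ∀ X Y Z, g p (curvature g p X Y Z) Z = 0 := fun X Y Z => by linarith [S X Y Z Z]
  have ee : ∀ i, e i = e i 0 • coordVec 0 + e i 1 • coordVec 1 := by
    intro i
    have := eq_sum_coordVec (e i)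
    rwa [Fin.sum_univ_two] at this
  set K := g p (curvature g p (coordVec 0) (coordVec 1) (coordVec 1)) (coordVec 0) with hKdef
  have k1 : g p (curvature g p (coordVec 1) (coordVec 0) (coordVec 1)) (coordVec 0) = -K := A _ _ _ _
  have k2 : g p (curvature g p (coordVec 0) (coordVec 1) (coordVec 0)) (coordVec 1) = -K := S _ _ _ _
  have k3 : g p (curvature g p (coordVec 1) (coordVec 0) (coordVec 0)) (coordVec 1) = K := by
    rw [A, k2, neg_neg]
  have key : g p (curvature g p (e 0) (e 1) (e 1)) (e 0) = (coordMatrix e).det ^ 2 * K := by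
    rw [ee 0, ee 1]
    rw [hc] at k1 k2 k3 hKdef
    simp only [hc] at A0 S0
    rw [hc]
    simp only [map_add, map_smul, LinearMap.add_apply, LinearMap.smul_apply, add_apply, smul_apply,
      smul_eq_mul, A0, S0, k1, k2, k3, ← hKdef, Matrix.det_fin_two]
    simp [coordMatrix]
    ring
  have hdet : (gram (g p)).det ≠ 0 := fun h0 => by rw [h0] at hd; simp at hd
  rw [key, gaussK, ← hKdef, div_eq_iff hdet]
  linear_combination -K * hd

/-- A submersion `φ` onto a surface with metric `g`, horizontally isometric and with fibres tangent
to `ξ`. -/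
structure IsSubmersionData (h : Eu 3 → Form 3) (O : Set (Eu 3)) (ξ : Eu 3 → Eu 3)
    (g : Eu 2 → Form 2) (Q : Set (Eu 2)) (φ : Eu 3 → Eu 2) : Prop where
  metric : IsMetricOn g Q
  mapsTo : ∀ u ∈ O, φ u ∈ Q
  smooth : ∀ u ∈ O, ContDiffAt ℝ ∞ φ u
  surj : ∀ u ∈ O, Function.Surjective (fderiv ℝ φ u)
  inner_eq : ∀ u ∈ O, ∀ v w,
    h u v w = g (φ u) (fderiv ℝ φ u v) (fderiv ℝ φ u w) + h u (ξ u) v * h u (ξ u) w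

section

variable {h : Eu 3 → Form 3} {O : Set (Eu 3)} {ξ : Eu 3 → Eu 3} {j : Eu 3 → Form 3} {r : Eu 3 → ℝ}
  (hK : IsKillingData h O ξ j r) {g : Eu 2 → Form 2} {Q : Set (Eu 2)} {φ : Eu 3 → Eu 2}
  (hS : IsSubmersionData h O ξ g Q φ)
include hK hS

/-- The differential of the submersion does not commute with covariant differentiation because of
the twisting of the horizontal distribution. -/
lemma IsSubmersionData.map_christoffel {u : Eu 3} (hu : u ∈ O) (x y : Eu 3) :
    fderiv ℝ φ u (christoffel h u x y) =
      covAlong g φ (fun p => fderiv ℝ φ p y) u x + h u (ξ u) y • fderiv ℝ φ u (covDeriv h ξ u x)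
        + h u (ξ u) x • fderiv ℝ φ u (covDeriv h ξ u y) := by
  have hgB := hS.metric.inner _ (hS.mapsTo u hu)
  have dφ : ∀ y, DifferentiableAt ℝ (fun p => fderiv ℝ φ p y) u := fun y =>
    differentiableAt_of_smooth (contDiffAt_fderiv_apply (hS.smooth u hu) contDiffAt_const)
  have dc : ∀ y : Eu 3, DifferentiableAt ℝ (fun _ : Eu 3 => y) u := fun y => differentiableAt_const y
  have dh : ∀ y, DifferentiableAt ℝ (fun p => h p (ξ p) y) u := fun y =>
    ((hK.metric.diff hu).clm_apply (hK.diff_field hu)).clm_apply (dc y)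
  have dg : ∀ y z, DifferentiableAt ℝ
      (fun p => g (φ p) (fderiv ℝ φ p y) (fderiv ℝ φ p z)) u := fun y z =>
    differentiableAt_of_smooth (hS.metric.smooth_inner (hS.mapsTo u hu) (hS.smooth u hu)
      (contDiffAt_fderiv_apply (hS.smooth u hu) contDiffAt_const)
      (contDiffAt_fderiv_apply (hS.smooth u hu) contDiffAt_const))
  -- The second fundamental form ∇dφ of the submersion, symmetric since neither connection has
  -- torsion.
  set D : Eu 3 → Eu 3 → Eu 2 := fun x y =>
    covAlong g φ (fun p => fderiv ℝ φ p y) u x - fderiv ℝ φ u (christoffel h u x y) with hD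
  have Dcomm : ∀ x y, D x y = D y x := by
    intro x y
    simp only [hD]
    rw [hS.metric.covAlong_fderiv_comm (hS.mapsTo u hu) (hS.smooth u hu),
      hK.metric.christoffel_comm hu]
  set om : Eu 3 → Eu 3 → ℝ := fun x y => h u (covDeriv h ξ u x) y with hom
  have omskew : ∀ x y, om x y = -om y x := by
    intro x y
    simp only [hom]
    rw [hK.covDeriv_field u hu, hK.covDeriv_field u hu, hK.cross_skew u hu]; ring
  -- Covariant derivative of h = φ*g + θ ⊗ θ, where θ = ⟨ξ, ·⟩ and `om` is ∇θ, antisymmetric by the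
  -- Killing equation.
  have key : ∀ x y z, g (φ u) (D x y) (fderiv ℝ φ u z) + g (φ u) (D x z) (fderiv ℝ φ u y)
      + om x y * h u (ξ u) z + om x z * h u (ξ u) y = 0 := by
    intro x y z
    have e1 := hK.metric.fderiv_inner_field hu (dc y) (dc z) x
    have e2 : (fun p => h p y z) =ᶠ[nhds u] fun p =>
        g (φ p) (fderiv ℝ φ p y) (fderiv ℝ φ p z) + h p (ξ p) y * h p (ξ p) z := by
      filter_upwards [hK.metric.isOpen.mem_nhds hu] with p hp using hS.inner_eq p hp y z
    have d1 : DifferentiableAt ℝ (fun p => h p (ξ p) y * h p (ξ p) z) u := (dh y).mul (dh z)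
    rw [e2.fderiv_eq, fderiv_fun_add (dg y z) d1, fderiv_fun_mul (dh y) (dh z)]
      at e1
    simp only [add_apply, smul_apply, smul_eq_mul] at e1
    rw [hS.metric.fderiv_inner (hS.mapsTo u hu) (differentiableAt_of_smooth (hS.smooth u hu))
      (dφ y) (dφ z), hK.metric.fderiv_inner_field hu (hK.diff_field hu) (dc y),
      hK.metric.fderiv_inner_field hu (hK.diff_field hu) (dc z), covDeriv_const, covDeriv_const,
      hS.inner_eq u hu (christoffel h u x y) z, hS.inner_eq u hu y (christoffel h u x z)] at e1
    simp only [hD, hom, map_sub, sub_apply]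
    rw [hgB.symm (fderiv ℝ φ u y)] at e1
    rw [hgB.symm (fderiv ℝ φ u y)] at e1
    linear_combination e1
  -- Koszul's alternating sum of three cyclic instances of `key` isolates D(x, y), since D is
  -- symmetric and `om` is antisymmetric.
  have main : D x y = -(h u (ξ u) y • fderiv ℝ φ u (covDeriv h ξ u x)
      + h u (ξ u) x • fderiv ℝ φ u (covDeriv h ξ u y)) := by
    apply hgB.eq_of_forall
    intro z'
    obtain ⟨z, rfl⟩ := hS.surj u hu z'
    have c1 := key x y z
    have c2 := key y z x
    have c3 := key z x y
    have hθ : ∀ a, h u (ξ u) (covDeriv h ξ u a) = 0 := by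
      intro a
      rw [(hK.metric.inner u hu).symm, hK.covDeriv_field u hu, hK.cross_field_right hu, mul_zero]
    have gom : ∀ a, g (φ u) (fderiv ℝ φ u (covDeriv h ξ u a)) (fderiv ℝ φ u z) = om a z := by
      intro a
      have := hS.inner_eq u hu (covDeriv h ξ u a) z
      rw [hθ, zero_mul, add_zero] at this
      exact this.symm
    simp only [map_neg, map_add, map_smul, neg_apply, add_apply, smul_apply, smul_eq_mul, gom]
    rw [Dcomm y x, Dcomm y z] at c2
    rw [Dcomm z x] at c3
    linear_combination (c1 + c2 - c3) / 2 + (h u (ξ u) x / 2) * omskew y z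
      + (h u (ξ u) y / 2) * omskew z x - (h u (ξ u) z / 2) * omskew x y
  have : fderiv ℝ φ u (christoffel h u x y) =
      covAlong g φ (fun p => fderiv ℝ φ p y) u x - D x y := by simp [hD]
  rw [this, main]
  abel

lemma IsSubmersionData.map_covDeriv {u : Eu 3} (hu : u ∈ O) {Y : Eu 3 → Eu 3}
    (hY : DifferentiableAt ℝ Y u) (x : Eu 3) :
    fderiv ℝ φ u (covDeriv h Y u x) =
      covAlong g φ (fun p => fderiv ℝ φ p (Y p)) u x
        + h u (ξ u) (Y u) • fderiv ℝ φ u (covDeriv h ξ u x)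
        + h u (ξ u) x • fderiv ℝ φ u (covDeriv h ξ u (Y u)) := by
  have hd := differentiableAt_of_smooth (contDiffAt_fderiv (hS.smooth u hu))
  have e1 := (hd.hasFDerivAt.clm_apply hY.hasFDerivAt).fderiv
  have e2 := (hd.hasFDerivAt.clm_apply (hasFDerivAt_const (Y u) u)).fderiv
  have h1 := hS.map_christoffel hK hu x (Y u)
  rw [covAlong, e2] at h1
  rw [covDeriv, map_add, h1, covAlong, e1]
  simp
  abel

/-- O'Neill's formula. -/
lemma IsSubmersionData.sectional_eq {u : Eu 3} (hu : u ∈ O) {e : Fin 3 → Eu 3}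
    (he : IsAdaptedFrame h ξ j u e) :
    gaussK g (φ u) = h u (curvature h u (e 0) (e 1) (e 1)) (e 0) + 3 * r u ^ 2 := by
  obtain ⟨i1, i2, i3, i4, i5, i6, i7, i8, i9⟩ := he.inner
  have hor : IsOrtho (g (φ u)) ![fderiv ℝ φ u (e 0), fderiv ℝ φ u (e 1)] := by
    have e00 := hS.inner_eq u hu (e 0) (e 0)
    have e01 := hS.inner_eq u hu (e 0) (e 1)
    have e10 := hS.inner_eq u hu (e 1) (e 0)
    have e11 := hS.inner_eq u hu (e 1) (e 1)
    rw [i1, i7] at e00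
    rw [i4, i7] at e01
    rw [i5, i7] at e10
    rw [i2, i9] at e11
    intro a b
    fin_cases a <;> fin_cases b <;> simp <;> linarith
  rw [hS.metric.gaussK_eq (hS.mapsTo u hu) hor]
  simp only [Matrix.cons_val_zero, Matrix.cons_val_one]
  have sm : ContDiffAt ℝ ∞ (fun p => fderiv ℝ φ p (e 1)) u :=
    contDiffAt_fderiv_apply (hS.smooth u hu) contDiffAt_const
  rw [← hS.metric.covAlong_covAlong_sub (hS.mapsTo u hu) (hS.smooth u hu) sm]
  have dc : ∀ y : Eu 3, DifferentiableAt ℝ (fun _ : Eu 3 => y) u := fun y => differentiableAt_const y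
  have dh : ∀ y, DifferentiableAt ℝ (fun p => h p (ξ p) y) u := fun y =>
    ((hK.metric.diff hu).clm_apply (hK.diff_field hu)).clm_apply (dc y)
  have sF : ∀ y, ContDiffAt ℝ ∞ (fun p => fderiv ℝ φ p (covDeriv h ξ p y)) u := fun y =>
    contDiffAt_fderiv_apply (hS.smooth u hu)
      (hK.metric.smooth_covDeriv hu (hK.smooth_field u hu) contDiffAt_const)
  have sG : ∀ y z, ContDiffAt ℝ ∞ (fun p => fderiv ℝ φ p (christoffel h p y z)) u := fun y z =>
    contDiffAt_fderiv_apply (hS.smooth u hu) (hK.metric.smooth_christoffel hu y z)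
  -- The pull-back connection is replaced by the ambient one twice. The factors ⟨ξ, y⟩ and ⟨ξ, z⟩
  -- vanish at `u`, but their derivatives do not, and these carry the twisting of the horizontal
  -- planes. In the commutator the factors ⟨ξ, Γ⟩ cancel and -3r dφ(∇_{e₁}ξ) remains; as ∇_{e₁}ξ =
  -- -r e₀, this contributes 3r².
  have key : ∀ x y z, h u (ξ u) x = 0 → h u (ξ u) y = 0 → h u (ξ u) z = 0 →
      covAlong g φ (fun p => covAlong g φ (fun q => fderiv ℝ φ q z) p y) u x =
        fderiv ℝ φ u (covDeriv h (fun p => christoffel h p y z) u x)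
        - h u (ξ u) (christoffel h u y z) • fderiv ℝ φ u (covDeriv h ξ u x)
        - (r u * j u x z + h u (ξ u) (christoffel h u x z)) • fderiv ℝ φ u (covDeriv h ξ u y)
        - (r u * j u x y + h u (ξ u) (christoffel h u x y)) • fderiv ℝ φ u (covDeriv h ξ u z) := by
    intro x y z hx hy hz
    have e1 : (fun p => covAlong g φ (fun q => fderiv ℝ φ q z) p y) =ᶠ[nhds u] fun p =>
        fderiv ℝ φ p (christoffel h p y z) + ((-h p (ξ p) z) • fderiv ℝ φ p (covDeriv h ξ p y)
          + (-h p (ξ p) y) • fderiv ℝ φ p (covDeriv h ξ p z)) := by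
      filter_upwards [hK.metric.isOpen.mem_nhds hu] with p hp
      rw [hS.map_christoffel hK hp y z]
      module
    have d1 := differentiableAt_of_smooth (sG y z)
    have d2 := fun y => differentiableAt_of_smooth (sF y)
    have fd : ∀ z, fderiv ℝ (fun p => -h p (ξ p) z) u x =
        -(r u * j u x z + h u (ξ u) (christoffel h u x z)) := by
      intro z
      rw [fderiv_fun_neg, neg_apply, hK.fderiv_dual hu (dc z), covDeriv_const]
    have e2 := hS.map_covDeriv hK hu
      (differentiableAt_of_smooth (hK.metric.smooth_christoffel hu y z)) x
    have d3 : ∀ a b, DifferentiableAt ℝ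
        (fun p => (-h p (ξ p) a) • fderiv ℝ φ p (covDeriv h ξ p b)) u :=
      fun a b => (dh a).neg.smul (d2 b)
    have d5 : ∀ a, DifferentiableAt ℝ (fun p => -h p (ξ p) a) u := fun a => (dh a).neg
    have d4 : DifferentiableAt ℝ (fun p => (-h p (ξ p) z) • fderiv ℝ φ p (covDeriv h ξ p y)
        + (-h p (ξ p) y) • fderiv ℝ φ p (covDeriv h ξ p z)) u := (d3 z y).add (d3 y z)
    rw [covAlong_congr g φ e1, covAlong_add g φ d1 d4, covAlong_add g φ (d3 z y) (d3 y z),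
      covAlong_smul g φ (d5 z) (d2 y), covAlong_smul g φ (d5 y) (d2 z), e2, fd, fd,
      hx, hy, hz]
    module
  rw [key (e 0) (e 1) (e 1) i7 i9 i9, key (e 1) (e 0) (e 1) i9 i7 i9, hK.cross_self hu,
    hK.cross_skew u hu (e 1), he.cross, hK.metric.christoffel_comm hu (e 1) (e 0)]
  have F1 : covDeriv h ξ u (e 1) = (-r u) • e 0 := by
    rw [hK.covDeriv_field_eq hu he, i2, i5]; simp
  have hφ : ∀ v, g (φ u) (fderiv ℝ φ u v) (fderiv ℝ φ u (e 0)) = h u v (e 0) := by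
    intro v
    have := hS.inner_eq u hu v (e 0)
    rw [i7, mul_zero, add_zero] at this
    exact this.symm
  simp only [map_sub, map_smul, sub_apply, smul_apply, hφ, curvature, smul_eq_mul, F1, i1]
  ring

end

/-! ### Surfaces in three-dimensional spaces -/

/-- An isometric immersion `φ` of a surface with unit normal `η`, in coordinates. -/
structure IsSurface (h : Eu 3 → Form 3) (O : Set (Eu 3)) (g : Eu 2 → Form 2) (W : Set (Eu 2))
    (φ η : Eu 2 → Eu 3) : Prop where
  target : IsMetricOn h O
  source : IsMetricOn g W
  mapsTo : ∀ u ∈ W, φ u ∈ O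
  smooth : ∀ u ∈ W, ContDiffAt ℝ ∞ φ u
  smooth_normal : ∀ u ∈ W, ContDiffAt ℝ ∞ η u
  isometric : ∀ u ∈ W, ∀ v w, h (φ u) (fderiv ℝ φ u v) (fderiv ℝ φ u w) = g u v w
  unit : ∀ u ∈ W, h (φ u) (η u) (η u) = 1
  normal : ∀ u ∈ W, ∀ v, h (φ u) (η u) (fderiv ℝ φ u v) = 0

/-- The second fundamental form. -/
def secondForm (h : Eu 3 → Form 3) (φ η : Eu 2 → Eu 3) (u v w : Eu 2) : ℝ :=
  -h (φ u) (covAlong h φ η u v) (fderiv ℝ φ u w)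

/-- The second covariant derivative of the normal. -/
def hessNormal (h : Eu 3 → Form 3) (g : Eu 2 → Form 2) (φ η : Eu 2 → Eu 3) (u v w : Eu 2) : Eu 3 :=
  covAlong h φ (fun y => covAlong h φ η y w) u v - covAlong h φ η u (christoffel g u v w)

/-- The frame of the ambient space given by a frame of the surface and the normal. -/
def normalFrame (φ η : Eu 2 → Eu 3) (u : Eu 2) (e : Fin 2 → Eu 2) : Fin 3 → Eu 3 :=
  ![fderiv ℝ φ u (e 0), fderiv ℝ φ u (e 1), η u]

section

variable {h : Eu 3 → Form 3} {O : Set (Eu 3)} {g : Eu 2 → Form 2} {W : Set (Eu 2)}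
  {φ η : Eu 2 → Eu 3} (hF : IsSurface h O g W φ η) {u : Eu 2} (hu : u ∈ W)
include hF hu

lemma IsSurface.inner : IsInner (h (φ u)) := hF.target.inner _ (hF.mapsTo u hu)

lemma IsSurface.diff : DifferentiableAt ℝ φ u := differentiableAt_of_smooth (hF.smooth u hu)

lemma IsSurface.diff_normal : DifferentiableAt ℝ η u :=
  differentiableAt_of_smooth (hF.smooth_normal u hu)

lemma IsSurface.eventually {P : Eu 2 → Prop} (hP : ∀ y ∈ W, P y) : ∀ᶠ y in nhds u, P y := by
  filter_upwards [hF.source.isOpen.mem_nhds hu] with y hy using hP y hy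

lemma IsSurface.smooth_fderiv (w : Eu 2) : ContDiffAt ℝ ∞ (fun y => fderiv ℝ φ y w) u :=
  contDiffAt_fderiv_apply (hF.smooth u hu) contDiffAt_const

lemma IsSurface.diff_fderiv (w : Eu 2) : DifferentiableAt ℝ (fun y => fderiv ℝ φ y w) u :=
  differentiableAt_of_smooth (hF.smooth_fderiv hu w)

lemma IsSurface.smooth_covAlong_normal (w : Eu 2) :
    ContDiffAt ℝ ∞ (fun y => covAlong h φ η y w) u :=
  hF.target.smooth_covAlong (hF.mapsTo u hu) (hF.smooth u hu) (hF.smooth_normal u hu)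
    contDiffAt_const

lemma IsSurface.fderiv_inner {V V' : Eu 2 → Eu 3} (hV : DifferentiableAt ℝ V u)
    (hV' : DifferentiableAt ℝ V' u) (x : Eu 2) :
    fderiv ℝ (fun y => h (φ y) (V y) (V' y)) u x =
      h (φ u) (covAlong h φ V u x) (V' u) + h (φ u) (V u) (covAlong h φ V' u x) :=
  hF.target.fderiv_inner (hF.mapsTo u hu) (hF.diff hu) hV hV' x

lemma IsSurface.covAlong_normal_normal (v : Eu 2) : h (φ u) (covAlong h φ η u v) (η u) = 0 := by
  have h1 := hF.fderiv_inner hu (hF.diff_normal hu) (hF.diff_normal hu) v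
  have h2 : (fun y => h (φ y) (η y) (η y)) =ᶠ[nhds u] fun _ => 1 := hF.eventually hu hF.unit
  rw [h2.fderiv_eq, (hF.inner hu).symm (η u)] at h1
  simp at h1
  linarith

lemma IsSurface.secondForm_eq (v w : Eu 2) :
    secondForm h φ η u v w = h (φ u) (η u) (covAlong h φ (fun y => fderiv ℝ φ y w) u v) := by
  have h1 := hF.fderiv_inner hu (hF.diff_normal hu) (hF.diff_fderiv hu w) v
  have h2 : (fun y => h (φ y) (η y) (fderiv ℝ φ y w)) =ᶠ[nhds u] fun _ => 0 :=
    hF.eventually hu fun y hy => hF.normal y hy w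
  rw [h2.fderiv_eq] at h1
  simp at h1
  rw [secondForm]
  linarith

lemma IsSurface.secondForm_comm (v w : Eu 2) :
    secondForm h φ η u v w = secondForm h φ η u w v := by
  rw [hF.secondForm_eq hu, hF.secondForm_eq hu,
    hF.target.covAlong_fderiv_comm (hF.mapsTo u hu) (hF.smooth u hu)]

/-- Uniqueness of the Levi-Civita connection: both sides are symmetric in v, w and satisfy the same
product rule for the induced metric, so Koszul's alternating sum identifies them. -/
lemma IsSurface.tangential_part (v w z : Eu 2) :
    h (φ u) (covAlong h φ (fun y => fderiv ℝ φ y w) u v) (fderiv ℝ φ u z) =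
      g u (christoffel g u v w) z := by
  have key : ∀ v w z, h (φ u) (covAlong h φ (fun y => fderiv ℝ φ y w) u v) (fderiv ℝ φ u z)
      + h (φ u) (fderiv ℝ φ u w) (covAlong h φ (fun y => fderiv ℝ φ y z) u v) =
      g u (christoffel g u v w) z + g u w (christoffel g u v z) := by
    intro v w z
    have h1 := hF.fderiv_inner hu (hF.diff_fderiv hu w) (hF.diff_fderiv hu z) v
    have h2 : (fun y => h (φ y) (fderiv ℝ φ y w) (fderiv ℝ φ y z)) =ᶠ[nhds u] fun y => g y w z :=
      hF.eventually hu fun y hy => hF.isometric y hy w z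
    rw [h2.fderiv_eq, fderiv_form_apply (hF.source.diff hu),
      ← hF.source.christoffel_compat hu] at h1
    exact h1.symm
  have c := fun a b => hF.target.covAlong_fderiv_comm (hF.mapsTo u hu) (hF.smooth u hu) a b
  have c' := fun a b => hF.source.christoffel_comm hu a b
  have s := (hF.inner hu).symm
  have s' := (hF.source.inner u hu).symm
  have k1 := key v w z
  have k2 := key w z v
  have k3 := key z v w
  rw [s (fderiv ℝ φ u w), s' w] at k1
  rw [s (fderiv ℝ φ u z), s' z, c w v, c' w v] at k2
  rw [s (fderiv ℝ φ u v), s' v, c z w, c' z w, c z v, c' z v] at k3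
  linarith

lemma IsSurface.isOrtho_normalFrame {e : Fin 2 → Eu 2} (he : IsOrtho (g u) e) :
    IsOrtho (h (φ u)) (normalFrame φ η u e) := by
  have i := hF.isometric u hu
  have n := hF.normal u hu
  have n' : ∀ v, h (φ u) (fderiv ℝ φ u v) (η u) = 0 := fun v => by rw [(hF.inner hu).symm, n]
  have c := hF.unit u hu
  intro a b
  fin_cases a <;> fin_cases b <;> simp [normalFrame, i, n, n', c, he _ _]

lemma IsSurface.exists_frame : ∃ e : Fin 2 → Eu 2, IsOrtho (g u) e := by
  have hB := hF.source.inner u hu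
  obtain ⟨a, ha, -⟩ := hB.exists_unit_orthogonal (k := 0) (by norm_num) ![]
  obtain ⟨b, hb, h1⟩ := hB.exists_unit_orthogonal (k := 1) (by norm_num) ![a]
  have hab : g u a b = 0 := h1 0
  have hba := hB.symm a b
  refine ⟨![a, b], fun i k => ?_⟩
  fin_cases i <;> fin_cases k <;> simp <;> linarith

lemma IsSurface.ext {X Y : Eu 3} (h1 : h (φ u) X (η u) = h (φ u) Y (η u))
    (h2 : ∀ w, h (φ u) X (fderiv ℝ φ u w) = h (φ u) Y (fderiv ℝ φ u w)) : X = Y := by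
  obtain ⟨e, he⟩ := hF.exists_frame hu
  have ho := hF.isOrtho_normalFrame hu he
  rw [ho.expand (hF.inner hu) X, ho.expand (hF.inner hu) Y]
  simp [Fin.sum_univ_three, normalFrame, h1, h2]

/-- The formula of Gauss. -/
lemma IsSurface.gauss_formula (v w : Eu 2) :
    covAlong h φ (fun y => fderiv ℝ φ y w) u v - fderiv ℝ φ u (christoffel g u v w) =
      secondForm h φ η u v w • η u := by
  apply hF.ext hu
  · rw [hF.secondForm_eq hu]
    simp only [map_sub, sub_apply, map_smul, smul_apply, hF.unit u hu, smul_eq_mul]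
    rw [(hF.inner hu).symm _ (η u), (hF.inner hu).symm _ (η u), hF.normal u hu]
    ring
  · intro z
    simp only [map_sub, sub_apply, map_smul, smul_apply, smul_eq_mul]
    rw [hF.tangential_part hu, hF.isometric u hu, hF.normal u hu]
    ring

omit hF hu in
lemma secondForm_linear_left (w : Eu 2) :
    IsLinearMap ℝ fun v => secondForm h φ η u v w :=
  ⟨fun x y => by simp only [secondForm, covAlong_add_right, map_add, add_apply]; ring,
    fun c x => by simp only [secondForm, covAlong_smul_right, map_smul, smul_apply, smul_eq_mul]; ring⟩

omit hF hu in
lemma secondForm_linear_right (v : Eu 2) :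
    IsLinearMap ℝ (secondForm h φ η u v) :=
  ⟨fun x y => by simp only [secondForm, map_add]; ring,
    fun c x => by simp only [secondForm, map_smul, smul_eq_mul]; ring⟩

lemma IsSurface.shapeOp_inner (v w : Eu 2) :
    g u (shapeOp g h φ η u v) w = secondForm h φ η u v w := by
  rw [shapeOp, (hF.source.inner u hu).apply_sharp]
  · rfl
  · exact secondForm_linear_right v

lemma IsSurface.shapeOp_linear : IsLinearMap ℝ (shapeOp g h φ η u) := by
  have hB := hF.source.inner u hu
  refine ⟨fun x y => hB.eq_of_forall fun z => ?_, fun c x => hB.eq_of_forall fun z => ?_⟩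
  · simp only [map_add, add_apply, hF.shapeOp_inner hu, (secondForm_linear_left z).map_add]
  · simp only [map_smul, smul_apply, hF.shapeOp_inner hu, (secondForm_linear_left z).map_smul]

lemma IsSurface.meanCurv_eq {e : Fin 2 → Eu 2} (he : IsOrtho (g u) e) :
    meanCurv g h φ η u = ∑ i, secondForm h φ η u (e i) (e i) := by
  rw [meanCurv, he.sum_apply_eq (hF.source.inner u hu) (hF.shapeOp_linear hu)]
  simp only [hF.shapeOp_inner hu]

/-- Trace of the formula of Gauss; H is the full trace of A, so no factor 2 appears. -/
lemma IsSurface.tension_eq : tension g h φ u = meanCurv g h φ η u • η u := by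
  obtain ⟨e, he⟩ := hF.exists_frame hu
  rw [hF.meanCurv_eq hu he, tension]
  simp only [hF.gauss_formula hu]
  rw [he.traceForm_eq, Finset.sum_smul]
  · exact fun w => ⟨fun x y => by rw [(secondForm_linear_left w).map_add, add_smul],
      fun c x => by rw [(secondForm_linear_left w).map_smul, smul_assoc]⟩
  · exact fun w => ⟨fun x y => by rw [(secondForm_linear_right w).map_add, add_smul],
      fun c x => by rw [(secondForm_linear_right w).map_smul, smul_assoc]⟩

/-- The formula of Weingarten. -/
lemma IsSurface.covAlong_normal_eq (v : Eu 2) :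
    covAlong h φ η u v = -fderiv ℝ φ u (shapeOp g h φ η u v) := by
  apply hF.ext hu
  · rw [hF.covAlong_normal_normal hu]
    simp only [map_neg, neg_apply]
    rw [(hF.inner hu).symm, hF.normal u hu, neg_zero]
  · intro w
    simp only [map_neg, neg_apply]
    rw [hF.isometric u hu, hF.shapeOp_inner hu, secondForm, neg_neg]

lemma IsSurface.smooth_shapeOp (v : Eu 2) : ContDiffAt ℝ ∞ (fun y => shapeOp g h φ η y v) u := by
  refine contDiffAt_sharp (hF.source.smooth u hu) (hF.source.eventually hu) fun z => ?_
  exact (hF.target.smooth_inner (hF.mapsTo u hu) (hF.smooth u hu)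
    (hF.smooth_covAlong_normal hu v) (hF.smooth_fderiv hu z)).neg

omit hF hu in
lemma hessNormal_linear_left (w : Eu 2) :
    IsLinearMap ℝ fun v => hessNormal h g φ η u v w :=
  ⟨fun x y => by
      simp only [hessNormal, covAlong_add_right, ← christoffelL_apply, map_add, add_apply]; abel,
    fun c x => by
      simp only [hessNormal, covAlong_smul_right, ← christoffelL_apply, map_smul, smul_apply]
      module⟩

lemma IsSurface.hessNormal_linear_right (v : Eu 2) :
    IsLinearMap ℝ (hessNormal h g φ η u v) :=
  ⟨fun x y => by
      have hd := fun w => differentiableAt_of_smooth (hF.smooth_covAlong_normal hu w)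
      simp only [hessNormal, covAlong_add_right, ← christoffelL_apply, map_add]
      rw [covAlong_add h φ (hd x) (hd y)]; abel,
    fun c x => by
      have hd := fun w => differentiableAt_of_smooth (hF.smooth_covAlong_normal hu w)
      simp only [hessNormal, covAlong_smul_right, ← christoffelL_apply, map_smul]
      rw [covAlong_const_smul h φ c (hd x)]; module⟩

/-- Derivative of ⟨∇_w η, η⟩ = 0. Its trace is the source of |A|². -/
lemma IsSurface.hessNormal_normal (v w : Eu 2) :
    h (φ u) (hessNormal h g φ η u v w) (η u) =
      -h (φ u) (covAlong h φ η u w) (covAlong h φ η u v) := by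
  have hd := differentiableAt_of_smooth (hF.smooth_covAlong_normal hu w)
  have h1 := hF.fderiv_inner hu hd (hF.diff_normal hu) v
  have h2 : (fun y => h (φ y) (covAlong h φ η y w) (η y)) =ᶠ[nhds u] fun _ => 0 :=
    hF.eventually hu fun y hy => hF.covAlong_normal_normal hy w
  rw [h2.fderiv_eq] at h1
  simp at h1
  simp only [hessNormal, map_sub, sub_apply, hF.covAlong_normal_normal hu]
  linarith

/-- The tangential part of ∇²η is -(∇_z II)(v, w), which inherits the symmetry of II. -/
lemma IsSurface.hessNormal_tangent_comm (z v w : Eu 2) :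
    h (φ u) (hessNormal h g φ η u z v) (fderiv ℝ φ u w) =
      h (φ u) (hessNormal h g φ η u z w) (fderiv ℝ φ u v) := by
  have hd := fun w => differentiableAt_of_smooth (hF.smooth_covAlong_normal hu w)
  have key : ∀ v w, fderiv ℝ (fun y => secondForm h φ η y v w) u z =
      -(h (φ u) (covAlong h φ (fun y => covAlong h φ η y v) u z) (fderiv ℝ φ u w)
        + h (φ u) (covAlong h φ η u (christoffel g u z w)) (fderiv ℝ φ u v)) := by
    intro v w
    have h1 := hF.fderiv_inner hu (hd v) (hF.diff_fderiv hu w) z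
    have h2 : covAlong h φ (fun y => fderiv ℝ φ y w) u z =
        fderiv ℝ φ u (christoffel g u z w) + secondForm h φ η u z w • η u := by
      rw [← hF.gauss_formula hu]; abel
    have h3 : fderiv ℝ (fun y => secondForm h φ η y v w) u z =
        -fderiv ℝ (fun y => h (φ y) (covAlong h φ η y v) (fderiv ℝ φ y w)) u z := by
      simp only [secondForm]
      rw [fderiv_fun_neg]; rfl
    have h4 := hF.secondForm_comm hu v (christoffel g u z w)
    rw [secondForm, secondForm] at h4
    rw [h2] at h1
    simp only [map_add, map_smul, hF.covAlong_normal_normal hu, smul_eq_mul] at h1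
    rw [h3, h1]
    linarith
  have h5 : (fun y => secondForm h φ η y v w) =ᶠ[nhds u] fun y => secondForm h φ η y w v :=
    hF.eventually hu fun y hy => hF.secondForm_comm hy v w
  have h6 := key v w
  rw [h5.fderiv_eq, key w v] at h6
  simp only [hessNormal, map_sub, sub_apply]
  linarith

/-- The trace of `∇²η` in the last two slots vanishes if the mean curvature is constant. -/
lemma IsSurface.sum_hessNormal_eq_zero {c : ℝ} (hc : ∀ y ∈ W, meanCurv g h φ η y = c)
    {e : Fin 2 → Eu 2} (he : IsOrtho (g u) e) (z : Eu 2) :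
    ∑ i, h (φ u) (hessNormal h g φ η u z (e i)) (fderiv ℝ φ u (e i)) = 0 := by
  have hA := fun v => differentiableAt_of_smooth (hF.smooth_shapeOp hu v)
  have hB := hF.source.inner u hu
  set A := shapeOp g h φ η u with hAdef
  set A' : Eu 2 → Eu 2 := fun v => fderiv ℝ (fun y => shapeOp g h φ η y v) u z with hA'
  have hlin : IsLinearMap ℝ A' := by
    constructor
    · intro x y
      have : (fun p => shapeOp g h φ η p (x + y)) =ᶠ[nhds u]
          fun p => shapeOp g h φ η p x + shapeOp g h φ η p y :=
        hF.eventually hu fun p hp => (hF.shapeOp_linear hp).map_add x y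
      simp only [hA']
      rw [this.fderiv_eq, fderiv_fun_add (hA x) (hA y)]; rfl
    · intro a x
      have : (fun p => shapeOp g h φ η p (a • x)) =ᶠ[nhds u]
          fun p => a • shapeOp g h φ η p x :=
        hF.eventually hu fun p hp => (hF.shapeOp_linear hp).map_smul a x
      simp only [hA']
      rw [this.fderiv_eq, fderiv_fun_const_smul (hA x)]; rfl
  -- The coordinate derivative of the shape operator has trace dH(z) = 0.
  have htr : ∑ i, A' (coordVec i) i = 0 := by
    have h1 : HasFDerivAt (meanCurv g h φ η) (∑ i : Fin 2, (EuclideanSpace.proj i : Eu 2 →L[ℝ] ℝ).comp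
        (fderiv ℝ (fun y => shapeOp g h φ η y (coordVec i)) u)) u := by
      have : ∀ i ∈ (Finset.univ : Finset (Fin 2)), HasFDerivAt
          (fun y => shapeOp g h φ η y (coordVec i) i) ((EuclideanSpace.proj i : Eu 2 →L[ℝ] ℝ).comp
          (fderiv ℝ (fun y => shapeOp g h φ η y (coordVec i)) u)) u := fun i _ =>
        (EuclideanSpace.proj i : Eu 2 →L[ℝ] ℝ).hasFDerivAt.comp u (hA (coordVec i)).hasFDerivAt
      exact HasFDerivAt.fun_sum this
    have h2 : meanCurv g h φ η =ᶠ[nhds u] fun _ => c := hF.eventually hu hc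
    have h3 := h1.fderiv
    rw [h2.fderiv_eq] at h3
    have h4 := congrArg (fun L : Eu 2 →L[ℝ] ℝ => L z) h3
    simp only [fderiv_fun_const, Pi.zero_apply, zero_apply, sum_apply,
      ContinuousLinearMap.comp_apply, PiLp.proj_apply] at h4
    exact h4.symm
  rw [he.sum_apply_eq hB hlin] at htr
  have key : ∀ v w, h (φ u) (covAlong h φ (fun y => covAlong h φ η y v) u z) (fderiv ℝ φ u w) =
      -(g u (christoffel g u z (A v)) w + g u (A' v) w) := by
    intro v w
    have h1 : (fun y => covAlong h φ η y v) =ᶠ[nhds u]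
        fun y => (-1 : ℝ) • fderiv ℝ φ y (shapeOp g h φ η y v) :=
      hF.eventually hu fun y hy => by simp [hF.covAlong_normal_eq hy]
    have hd := differentiableAt_of_smooth (contDiffAt_fderiv (hF.smooth u hu))
    have hd' : DifferentiableAt ℝ (fun y => fderiv ℝ φ y (shapeOp g h φ η y v)) u :=
      hd.clm_apply (hA v)
    have h2 : covAlong h φ (fun y => fderiv ℝ φ y (shapeOp g h φ η y v)) u z =
        covAlong h φ (fun y => fderiv ℝ φ y (A v)) u z + fderiv ℝ φ u (A' v) := by
      rw [covAlong, (hd.hasFDerivAt.clm_apply (hA v).hasFDerivAt).fderiv, covAlong,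
        (hd.hasFDerivAt.clm_apply (hasFDerivAt_const (A v) u)).fderiv]
      simp [hA', hAdef]
      abel
    rw [covAlong_congr h φ h1, covAlong_const_smul h φ (-1) hd', h2]
    simp only [map_smul, map_add, smul_apply, add_apply, smul_eq_mul, hF.isometric u hu,
      hF.tangential_part hu]
    ring
  -- ∇_z A differs from the coordinate derivative by the commutator of Γ_z with A, which has trace
  -- zero.
  have tr : ∑ i, g u (christoffel g u z (A (e i))) (e i) =
      ∑ i, g u (A (christoffel g u z (e i))) (e i) := by
    have ex : ∀ (T : Eu 2 → Eu 2) (_ : IsLinearMap ℝ T) (v w : Eu 2),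
        g u (T v) w = ∑ k, g u v (e k) * g u (T (e k)) w := by
      intro T hT v w
      have : T v = hT.mk' T v := rfl
      rw [this]
      conv_lhs => rw [he.expand hB v]
      simp only [map_sum, map_smul, sum_apply, smul_apply, smul_eq_mul]
      rfl
    have l1 : IsLinearMap ℝ (christoffel g u z) := by
      have := (christoffelL g u z).isLinear
      exact ⟨fun x y => (christoffelL g u z).map_add x y, fun c x => (christoffelL g u z).map_smul c x⟩
    have l2 : IsLinearMap ℝ A := hF.shapeOp_linear hu
    rw [Finset.sum_congr rfl fun i _ => ex _ l1 (A (e i)) (e i),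
      Finset.sum_congr rfl fun i _ => ex _ l2 (christoffel g u z (e i)) (e i), Finset.sum_comm]
    exact Finset.sum_congr rfl fun i _ => Finset.sum_congr rfl fun k _ => mul_comm _ _
  have wg : ∀ v w, h (φ u) (covAlong h φ η u v) (fderiv ℝ φ u w) = -g u (A v) w := by
    intro v w
    rw [hF.covAlong_normal_eq hu]
    simp only [map_neg, neg_apply, hF.isometric u hu, hAdef]
  simp only [hessNormal, map_sub, sub_apply, key, wg, Finset.sum_sub_distrib, Finset.sum_neg_distrib,
    Finset.sum_add_distrib, htr, tr]
  ring

/-- The equation of Codazzi. -/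
lemma IsSurface.hessNormal_sub (v w : Eu 2) :
    hessNormal h g φ η u v w - hessNormal h g φ η u w v =
      curvature h (φ u) (fderiv ℝ φ u v) (fderiv ℝ φ u w) (η u) := by
  rw [← hF.target.covAlong_covAlong_sub (hF.mapsTo u hu) (hF.smooth u hu) (hF.smooth_normal u hu)]
  simp only [hessNormal, hF.source.christoffel_comm hu v w]
  abel

/-- The contracted Codazzi equation: symmetry of ∇A and the commutation of ∇²η turn the trace over
the first two slots into the trace over the last two, which vanishes because H is constant, plus a
curvature trace. The missing η-term of the Ricci sum is zero by skew symmetry. -/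
lemma IsSurface.sum_hessNormal_tangent {c : ℝ} (hc : ∀ y ∈ W, meanCurv g h φ η y = c)
    {e : Fin 2 → Eu 2} (he : IsOrtho (g u) e) (w : Eu 2) :
    ∑ i, h (φ u) (hessNormal h g φ η u (e i) (e i)) (fderiv ℝ φ u w) =
      ricci h (normalFrame φ η u e) (φ u) (fderiv ℝ φ u w) (η u) := by
  have h0 := hF.sum_hessNormal_eq_zero hu hc he w
  have h1 : ∀ i, h (φ u) (hessNormal h g φ η u (e i) (e i)) (fderiv ℝ φ u w) =
      h (φ u) (hessNormal h g φ η u w (e i)) (fderiv ℝ φ u (e i)) +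
      h (φ u) (curvature h (φ u) (fderiv ℝ φ u (e i)) (fderiv ℝ φ u w) (η u))
        (fderiv ℝ φ u (e i)) := by
    intro i
    rw [hF.hessNormal_tangent_comm hu, ← hF.hessNormal_sub hu]
    simp
  have h2 := hF.target.curvature_skew (hF.mapsTo u hu) (η u) (fderiv ℝ φ u w) (η u) (η u)
  rw [Finset.sum_congr rfl fun i _ => h1 i, Finset.sum_add_distrib, h0, ricci]
  simp only [normalFrame, Fin.sum_univ_three, Fin.sum_univ_two, Matrix.cons_val_zero,
    Matrix.cons_val_one, Matrix.cons_val]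
  linarith

/-- The biharmonic equation for the normal field of a surface of constant mean curvature. -/
lemma IsSurface.sum_hessNormal_of_biharmonic {c : ℝ} (hc : ∀ y ∈ W, meanCurv g h φ η y = c)
    (hc0 : c ≠ 0) (hb : bitension g h φ u = 0) {e : Fin 2 → Eu 2} (he : IsOrtho (g u) e) :
    ∑ i, hessNormal h g φ η u (e i) (e i) =
      ∑ i, curvature h (φ u) (fderiv ℝ φ u (e i)) (η u) (fderiv ℝ φ u (e i)) := by
  have hcur := hF.target.curvature_eq_curvatureL (hF.mapsTo u hu)
  have ht : tension g h φ =ᶠ[nhds u] fun y => c • η y :=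
    hF.eventually hu fun y hy => by rw [hF.tension_eq hy, hc y hy]
  have e1 : ∀ w, (fun y => covAlong h φ (tension g h φ) y w) =ᶠ[nhds u]
      fun y => c • covAlong h φ η y w := by
    intro w
    have hW := hF.source.isOpen
    filter_upwards [hW.mem_nhds hu] with y hy
    have ht' : tension g h φ =ᶠ[nhds y] fun y => c • η y :=
      hF.eventually hy fun y hy => by rw [hF.tension_eq hy, hc y hy]
    rw [covAlong_congr h φ ht', covAlong_const_smul h φ c (hF.diff_normal hy)]
  have e2 : ∀ v w, covAlong h φ (fun y => covAlong h φ (tension g h φ) y w) u v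
      - covAlong h φ (tension g h φ) u (christoffel g u v w) = c • hessNormal h g φ η u v w := by
    intro v w
    rw [covAlong_congr h φ (e1 w), covAlong_const_smul h φ c
      (differentiableAt_of_smooth (hF.smooth_covAlong_normal hu w)), covAlong_congr h φ ht,
      covAlong_const_smul h φ c (hF.diff_normal hu), hessNormal, smul_sub]
  rw [bitension, roughLaplacian, neg_neg] at hb
  simp only [e2, ht.self_of_nhds] at hb
  rw [he.traceForm_eq, he.traceForm_eq, sub_eq_zero] at hb
  · simp only [hcur, map_smul, LinearMap.smul_apply] at hb
    -- As τ = cη near the point, both sides are c times the wanted expressions, and c ≠ 0 is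
    -- cancelled.
    rw [← Finset.smul_sum, ← Finset.smul_sum] at hb
    simp only [hcur]
    exact smul_right_injective _ hc0 hb
  · simp only [hcur]
    exact fun w => ⟨fun x y => by simp, fun a x => by simp [smul_comm a c]⟩
  · simp only [hcur]
    exact fun w => ⟨fun x y => by simp, fun a x => by simp [smul_comm a c]⟩
  · exact fun w => ⟨fun x y => by rw [(hessNormal_linear_left w).map_add, smul_add],
      fun a x => by rw [(hessNormal_linear_left w).map_smul, smul_comm]⟩
  · exact fun w => ⟨fun x y => by rw [(hF.hessNormal_linear_right hu w).map_add, smul_add],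
      fun a x => by rw [(hF.hessNormal_linear_right hu w).map_smul, smul_comm]⟩

omit hF hu in
lemma IsMetricOn.ricci_symm {n : ℕ} {h : Eu n → Form n} {O : Set (Eu n)} (hO : IsMetricOn h O)
    {u : Eu n} (hu : u ∈ O) (e : Fin n → Eu n) (X Y : Eu n) :
    ricci h e u X Y = ricci h e u Y X := by
  refine Finset.sum_congr rfl fun i _ => ?_
  rw [hO.curvature_pair hu, curvature_antisymm]
  simp only [map_neg, neg_apply]
  rw [hO.curvature_skew hu, neg_neg]

/-- Skew symmetry in the last pair of slots; the η-term needed to complete the Ricci sum is R(η, η)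
= 0. -/
lemma IsSurface.sum_curvature_eq {e : Fin 2 → Eu 2} (X : Eu 3) :
    h (φ u) (∑ i, curvature h (φ u) (fderiv ℝ φ u (e i)) (η u) (fderiv ℝ φ u (e i))) X =
      -ricci h (normalFrame φ η u e) (φ u) (η u) X := by
  have S := hF.target.curvature_skew (hF.mapsTo u hu)
  have h0 : curvature h (φ u) (η u) (η u) X = 0 := by simp [curvature]
  simp only [ricci, normalFrame, Fin.sum_univ_three, Fin.sum_univ_two, Matrix.cons_val_zero,
    Matrix.cons_val_one, Matrix.cons_val, map_add, add_apply, h0, map_zero, zero_apply]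
  rw [S, S _ _ (fderiv ℝ φ u (e 1))]
  ring

/-- A biharmonic surface of non-zero constant mean curvature: the normal is an eigenvector of the
Ricci tensor. -/
lemma IsSurface.ricci_normal_tangent {c : ℝ} (hc : ∀ y ∈ W, meanCurv g h φ η y = c)
    (hc0 : c ≠ 0) (hb : bitension g h φ u = 0) {e : Fin 2 → Eu 2} (he : IsOrtho (g u) e)
    (w : Eu 2) : ricci h (normalFrame φ η u e) (φ u) (η u) (fderiv ℝ φ u w) = 0 := by
  have h1 := hF.sum_hessNormal_tangent hu hc he w
  have h2 := congrArg (fun X => h (φ u) X (fderiv ℝ φ u w))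
    (hF.sum_hessNormal_of_biharmonic hu hc hc0 hb he)
  simp only [hF.sum_curvature_eq hu] at h2
  -- The tangential part of trace ∇²η is Ric(η, ·) by Codazzi and -Ric(η, ·) by biharmonicity, so it
  -- vanishes.
  rw [map_sum, sum_apply, h1, hF.target.ricci_symm (hF.mapsTo u hu)] at h2
  linarith

/-- The η-component of the biharmonic equation: trace ∇²η contributes -|∇η|² = -|A|² and the
curvature term contributes -Ric(η, η). -/
lemma IsSurface.ricci_normal_normal {c : ℝ} (hc : ∀ y ∈ W, meanCurv g h φ η y = c)
    (hc0 : c ≠ 0) (hb : bitension g h φ u = 0) {e : Fin 2 → Eu 2} (he : IsOrtho (g u) e) :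
    ricci h (normalFrame φ η u e) (φ u) (η u) (η u) =
      ∑ i, ∑ k, secondForm h φ η u (e i) (e k) ^ 2 := by
  have h2 := congrArg (fun X => h (φ u) X (η u))
    (hF.sum_hessNormal_of_biharmonic hu hc hc0 hb he)
  simp only [hF.sum_curvature_eq hu] at h2
  simp only [map_sum, sum_apply, hF.hessNormal_normal hu, Finset.sum_neg_distrib, neg_inj] at h2
  rw [← h2]
  refine Finset.sum_congr rfl fun i _ => ?_
  have ho := hF.isOrtho_normalFrame hu he
  have h3 := ho.expand (hF.inner hu) (covAlong h φ η u (e i))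
  conv_lhs => arg 2; rw [h3]
  simp only [Fin.sum_univ_three, Fin.sum_univ_two, normalFrame, Matrix.cons_val_zero,
    Matrix.cons_val_one, Matrix.cons_val, map_add, map_smul, smul_eq_mul,
    hF.covAlong_normal_normal hu, secondForm]
  ring

end

/-! ### Surfaces of constant mean curvature in spaces with a unit Killing field -/

/-- The gradient of `r` in coordinates. -/
def gradField (h : Eu 3 → Form 3) (r : Eu 3 → ℝ) (x : Eu 3) : Eu 3 := sharp (h x) (fderiv ℝ r x)

section Gradient

variable {h : Eu 3 → Form 3} {O : Set (Eu 3)} {ξ : Eu 3 → Eu 3} {j : Eu 3 → Form 3} {r : Eu 3 → ℝ}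
  (hK : IsKillingData h O ξ j r) {x : Eu 3} (hx : x ∈ O)
include hK hx

lemma IsKillingData.gradField_inner (z : Eu 3) : h x (gradField h r x) z = fderiv ℝ r x z :=
  (hK.metric.inner x hx).apply_sharp (fderiv ℝ r x).isLinear z

lemma IsKillingData.smooth_gradField : ContDiffAt ℝ ∞ (gradField h r) x :=
  contDiffAt_sharp (hK.metric.smooth x hx) (hK.metric.eventually hx) fun _ =>
    contDiffAt_fderiv_apply (hK.smooth_curv x hx) contDiffAt_const

lemma IsKillingData.gradField_field : h x (gradField h r x) (ξ x) = 0 := by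
  rw [hK.gradField_inner hx, hK.fderiv_curv_field hx]

lemma IsKillingData.hess_symm (v w : Eu 3) :
    h x (covDeriv h (gradField h r) x v) w = h x (covDeriv h (gradField h r) x w) v := by
  have key : ∀ v w, h x (covDeriv h (gradField h r) x v) w =
      fderiv ℝ (fderiv ℝ r) x v w - h x (gradField h r x) (christoffel h x v w) := by
    intro v w
    have h1 := hK.metric.fderiv_inner_field hx (differentiableAt_of_smooth (hK.smooth_gradField hx))
      (differentiableAt_const w) v
    have h2 : (fun y => h y (gradField h r y) w) =ᶠ[nhds x] fun y => fderiv ℝ r y w := by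
      filter_upwards [hK.metric.isOpen.mem_nhds hx] with y hy using hK.gradField_inner hy w
    have hd := differentiableAt_of_smooth (contDiffAt_fderiv (hK.smooth_curv x hx))
    rw [h2.fderiv_eq, covDeriv_const, (hd.hasFDerivAt.clm_apply (hasFDerivAt_const w x)).fderiv] at h1
    simp at h1
    linarith
  rw [key, key, hK.metric.christoffel_comm hx, (hK.smooth_curv x hx).isSymmSndFDerivAt
    two_le_smooth v w]

/-- Derivative of ⟨grad r, ξ⟩ = 0 along grad r; the other term r⟨grad r ∧ ξ, grad r⟩ is zero. -/
lemma IsKillingData.hess_grad_field :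
    h x (covDeriv h (gradField h r) x (gradField h r x)) (ξ x) = 0 := by
  have h1 := hK.metric.fderiv_inner_field hx (differentiableAt_of_smooth (hK.smooth_gradField hx))
    (hK.diff_field hx) (gradField h r x)
  have h2 : (fun y => h y (gradField h r y) (ξ y)) =ᶠ[nhds x] fun _ => 0 := by
    filter_upwards [hK.metric.isOpen.mem_nhds hx] with y hy using hK.gradField_field hy
  rw [h2.fderiv_eq, (hK.metric.inner x hx).symm (gradField h r x), hK.covDeriv_field x hx,
    hK.cross_self hx] at h1
  simp at h1
  exact h1.symm

end Gradient

lemma IsSurface.exists_tangent {h : Eu 3 → Form 3} {O : Set (Eu 3)} {g : Eu 2 → Form 2}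
    {W : Set (Eu 2)} {φ η : Eu 2 → Eu 3} (hF : IsSurface h O g W φ η) {u : Eu 2} (hu : u ∈ W)
    {X : Eu 3} (hX : h (φ u) X (η u) = 0) : ∃ Y, fderiv ℝ φ u Y = X := by
  obtain ⟨e, he⟩ := hF.exists_frame hu
  have ho := (hF.isOrtho_normalFrame hu he).expand (hF.inner hu) X
  refine ⟨h (φ u) X (fderiv ℝ φ u (e 0)) • e 0 + h (φ u) X (fderiv ℝ φ u (e 1)) • e 1, ?_⟩
  conv_rhs => rw [ho]
  simp [Fin.sum_univ_three, normalFrame, hX]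

/-- A surface of non-zero constant mean curvature that is biharmonic, in a space with a unit Killing
field in which the horizontal sectional curvature is `r²`. -/
structure IsBiharmonicSurface (h : Eu 3 → Form 3) (O : Set (Eu 3)) (ξ : Eu 3 → Eu 3)
    (j : Eu 3 → Form 3) (r : Eu 3 → ℝ) (g : Eu 2 → Form 2) (W : Set (Eu 2)) (φ η : Eu 2 → Eu 3)
    (c : ℝ) : Prop where
  killing : IsKillingData h O ξ j r
  surface : IsSurface h O g W φ η
  mean : ∀ u ∈ W, meanCurv g h φ η u = c
  mean_ne : c ≠ 0
  biharmonic : ∀ u ∈ W, bitension g h φ u = 0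
  sectional : ∀ u ∈ W, ∀ e, IsAdaptedFrame h ξ j (φ u) e →
    h (φ u) (curvature h (φ u) (e 0) (e 1) (e 1)) (e 0) = r (φ u) ^ 2
  grad_ne : ∀ u ∈ W, fderiv ℝ r (φ u) ≠ 0

/-! ### The eigenvector equation, the angle function and the contradiction -/

section

variable {h : Eu 3 → Form 3} {O : Set (Eu 3)} {ξ : Eu 3 → Eu 3} {j : Eu 3 → Form 3} {r : Eu 3 → ℝ}
  {g : Eu 2 → Form 2} {W : Set (Eu 2)} {φ η : Eu 2 → Eu 3} {c : ℝ}
  (hB : IsBiharmonicSurface h O ξ j r g W φ η c) {u : Eu 2} (hu : u ∈ W)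
include hB hu

lemma IsBiharmonicSurface.ricci_eq {e : Fin 2 → Eu 2} (he : IsOrtho (g u) e) (X Y : Eu 3) :
    ricci h (normalFrame φ η u e) (φ u) X Y =
      2 * r (φ u) ^ 2 * h (φ u) X Y
        + h (φ u) (ξ (φ u)) X * j (φ u) Y (gradField h r (φ u))
        + h (φ u) (ξ (φ u)) Y * j (φ u) X (gradField h r (φ u)) := by
  have hφ := hB.surface.mapsTo u hu
  obtain ⟨f, hf⟩ := hB.killing.exists_frame hφ
  rw [hB.killing.metric.ricci_frame hφ (hB.surface.isOrtho_normalFrame hu he) hf.ortho]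
  exact hB.killing.ricci_eq hφ hf (hB.sectional u hu f hf) (hB.killing.gradField_inner hφ) X Y

/-- The normal is an eigenvector of the Ricci tensor; `a = ⟨ξ, η⟩` and `b = ⟨η ∧ ξ, grad r⟩`. -/
lemma IsBiharmonicSurface.eigenvector :
    let a := h (φ u) (ξ (φ u)) (η u)
    let b := j (φ u) (η u) (gradField h r (φ u))
    a * (2 * a ^ 2 - 1) = 0 ∧ (2 * a * b ≠ 0 → h (φ u) (η u) (gradField h r (φ u)) = 0 ∧
      h (φ u) (gradField h r (φ u)) (gradField h r (φ u)) = (2 * a * b) ^ 2 ∧ a ≠ 0) := by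
  intro a b
  have hφ := hB.surface.mapsTo u hu
  have hin := hB.surface.inner hu
  have hK := hB.killing
  obtain ⟨f, hf⟩ := hK.exists_frame hφ
  obtain ⟨e, he⟩ := hB.surface.exists_frame hu
  obtain ⟨i1, i2, i3, i4, i5, i6, i7, i8, i9⟩ := hf.inner
  set G := gradField h r (φ u) with hG
  have hGξ : h (φ u) G (ξ (φ u)) = 0 := hK.gradField_field hφ
  set p := h (φ u) G (f 0) with hp
  set s := h (φ u) G (f 1) with hs
  set x := h (φ u) (η u) (f 0) with hx
  set y := h (φ u) (η u) (f 1) with hy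
  have hηξ : h (φ u) (η u) (ξ (φ u)) = a := hin.symm _ _
  have hb : b = x * s - y * p := hK.frame_cross hφ hf _ _
  have hηG : h (φ u) (η u) G = x * p + y * s := by
    rw [hK.frame_inner hφ hf, hGξ]; ring
  have hGG : h (φ u) G G = p ^ 2 + s ^ 2 := by
    rw [hK.frame_inner hφ hf, hGξ]; ring
  have hηη : x ^ 2 + y ^ 2 + a ^ 2 = 1 := by
    rw [← hB.surface.unit u hu, hK.frame_inner hφ hf, hηξ]; ring
  have hG0 : p ^ 2 + s ^ 2 ≠ 0 := by
    rw [← hGG]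
    refine (hin.pos _ fun h0 => hB.grad_ne u hu ?_).ne'
    ext z
    rw [← hK.gradField_inner hφ, ← hG, h0]; simp
  set V := (a * s) • f 0 + (-(a * p)) • f 1 + b • ξ (φ u) with hV
  have hVX : ∀ X, h (φ u) V X = a * j (φ u) X G + h (φ u) (ξ (φ u)) X * b := by
    intro X
    rw [hK.frame_cross hφ hf, hV]
    simp only [map_add, map_smul, add_apply, smul_apply, smul_eq_mul]
    rw [hin.symm (f 0) X, hin.symm (f 1) X]
    ring
  have hVη : V = (2 * a * b) • η u := by
    apply hB.surface.ext hu
    · rw [hVX]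
      simp only [map_smul, smul_apply, hB.surface.unit u hu, smul_eq_mul]
      ring
    · intro w
      have h1 := hB.surface.ricci_normal_tangent hu hB.mean hB.mean_ne (hB.biharmonic u hu) he w
      rw [hB.ricci_eq hu he, hB.surface.normal u hu] at h1
      rw [hVX]
      simp only [map_smul, smul_apply, hB.surface.normal u hu, smul_eq_mul, mul_zero]
      linarith
  have c0 := congrArg (fun Z => h (φ u) Z (f 0)) hVη
  have c1 := congrArg (fun Z => h (φ u) Z (f 1)) hVη
  have c2 := congrArg (fun Z => h (φ u) Z (ξ (φ u))) hVη
  simp only [hV, map_add, map_smul, add_apply, smul_apply, smul_eq_mul, i1, i2, i3, i4, i5, i6, i7,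
    i8, i9, hηξ, ← hx, ← hy] at c0 c1 c2
  -- The ξ-component of V = 2ab η.
  have hab : b * (1 - 2 * a ^ 2) = 0 := by linarith
  refine ⟨?_, fun hne => ⟨?_, ?_, ?_⟩⟩
  · rcases mul_eq_zero.mp hab with hb0 | hb0
    · rw [hb0] at c0 c1
      -- If b = 0 then V = 0, so its horizontal part, a times grad r rotated by a right angle,
      -- vanishes; grad r ≠ 0 leaves a = 0.
      have h2 : a * (p ^ 2 + s ^ 2) = 0 := by linear_combination s * c0 - p * c1
      rw [(mul_eq_zero.mp h2).resolve_right hG0, zero_mul]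
    · linear_combination -a * hb0
  · rw [hηG]
    refine (mul_eq_zero.mp ?_).resolve_left hne
    linear_combination -p * c0 - s * c1
  · rw [hGG]
    have ha0 : a ≠ 0 := fun h0 => hne (by rw [h0]; ring)
    have hb0 : b ≠ 0 := fun h0 => hne (by rw [h0]; ring)
    have ha2 : 2 * a ^ 2 = 1 := by linarith [(mul_eq_zero.mp hab).resolve_left hb0]
    -- |V|² computed from its components and from V = 2ab η. With 2a² = 1 it yields |grad r|² = 2b²
    -- = (2ab)².
    have h3 : a ^ 2 * (p ^ 2 + s ^ 2) + b ^ 2 = (2 * a * b) ^ 2 := by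
      linear_combination (a * s + 2 * a * b * x) * c0 + (-(a * p) + 2 * a * b * y) * c1
        + (b + 2 * a * b * a) * c2 + (2 * a * b) ^ 2 * hηη
    linear_combination 2 * h3 + (2 * b ^ 2 - (p ^ 2 + s ^ 2)) * ha2
  · exact fun h0 => hne (by rw [h0]; ring)

/-- The left side is the derivative of a = ⟨ξ, η⟩, which takes only finitely many values by
`IsBiharmonicSurface.eigenvector`. -/
lemma IsBiharmonicSurface.fderiv_angle (v : Eu 2) :
    r (φ u) * j (φ u) (fderiv ℝ φ u v) (η u)
      + h (φ u) (ξ (φ u)) (covAlong h φ η u v) = 0 := by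
  have hφ := hB.surface.mapsTo u hu
  have hd := hB.surface.diff hu
  have hξ : DifferentiableAt ℝ (fun y => ξ (φ y)) u := (hB.killing.diff_field hφ).comp u hd
  have h1 := hB.surface.fderiv_inner hu hξ (hB.surface.diff_normal hu) v
  rw [covAlong_comp h hd (hB.killing.diff_field hφ), hB.killing.covDeriv_field _ hφ] at h1
  rw [← h1]
  set a : Eu 2 → ℝ := fun y => h (φ y) (ξ (φ y)) (η y) with ha
  have hda : DifferentiableAt ℝ a u := differentiableAt_of_smooth
    (hB.surface.target.smooth_inner hφ (hB.surface.smooth u hu)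
      (ContDiffAt.comp u (hB.killing.smooth_field _ hφ) (hB.surface.smooth u hu))
      (hB.surface.smooth_normal u hu))
  have h2 : (fun y => a y * (2 * (a y * a y) - 1)) =ᶠ[nhds u] fun _ => 0 :=
    hB.surface.eventually hu fun y hy => by
      have := (hB.eigenvector hy).1
      simp only [ha]; linear_combination this
  have h3 := hda.hasFDerivAt.mul
    (((hda.hasFDerivAt.mul hda.hasFDerivAt).const_mul (2 : ℝ)).sub_const 1)
  have h4 := (h3.congr_of_eventuallyEq h2.symm).unique (hasFDerivAt_const (0 : ℝ) u)
  have h5 := congrArg (fun L : Eu 2 →L[ℝ] ℝ => L v) h4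
  simp only [add_apply, smul_apply, smul_eq_mul, zero_apply, Pi.mul_apply] at h5
  have h6 : a u * (2 * a u ^ 2 - 1) = 0 := (hB.eigenvector hu).1
  -- Derivative of a(2a² - 1) = 0. The roots are simple: 6a² - 1 is -1 or 2 there.
  have h7 : (6 * a u ^ 2 - 1) * fderiv ℝ a u v = 0 := by linear_combination h5
  refine (mul_eq_zero.mp h7).resolve_left fun h8 => ?_
  rcases mul_eq_zero.mp h6 with h9 | h9
  · rw [h9] at h8; norm_num at h8
  · linarith

/-- The shape of the second fundamental form in a frame adapted to the tangential part of `ξ`. -/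
lemma IsBiharmonicSurface.exists_frame :
    ∃ (T : Eu 2) (e : Fin 2 → Eu 2) (t : ℝ), IsOrtho (g u) e ∧ T = t • e 0 ∧ t ≠ 0 ∧
      ξ (φ u) = fderiv ℝ φ u T + h (φ u) (ξ (φ u)) (η u) • η u ∧
      secondForm h φ η u (e 1) (e 1) = c ∧
      c ^ 2 = 2 * h (φ u) (ξ (φ u)) (η u) * j (φ u) (η u) (gradField h r (φ u)) := by
  have hF := hB.surface
  have hK := hB.killing
  have hφ := hF.mapsTo u hu
  have hin := hF.inner hu
  have hgi := hF.source.inner u hu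
  set a := h (φ u) (ξ (φ u)) (η u) with ha
  have hX : h (φ u) (ξ (φ u) - a • η u) (η u) = 0 := by
    simp only [map_sub, sub_apply, map_smul, smul_apply, hF.unit u hu, smul_eq_mul, ha]; ring
  obtain ⟨T, hT⟩ := hF.exists_tangent hu hX
  have hξ : ξ (φ u) = fderiv ℝ φ u T + a • η u := by rw [hT]; abel
  have hTT : g u T T = 1 - a ^ 2 := by
    rw [← hF.isometric u hu, hT]
    simp only [map_sub, sub_apply, map_smul, smul_apply, hF.unit u hu, smul_eq_mul,
      hK.unit _ hφ, ← ha, hin.symm (η u) (ξ (φ u))]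
    ring
  have ha2 : a * (2 * a ^ 2 - 1) = 0 := (hB.eigenvector hu).1
  -- Since a² is 0 or 1/2, ξ is never normal to the surface and T ≠ 0.
  have hT0 : 1 - a ^ 2 ≠ 0 := by
    intro h0
    rcases mul_eq_zero.mp ha2 with h1 | h1
    · rw [h1] at h0; norm_num at h0
    · linarith
  obtain ⟨e₁, h11, h1⟩ := hgi.exists_unit_orthogonal (k := 1) (by norm_num) ![T]
  obtain ⟨e₀, h00, h0⟩ := hgi.exists_unit_orthogonal (k := 1) (by norm_num) ![e₁]
  have hT1 : g u T e₁ = 0 := h1 0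
  have h10 : g u e₁ e₀ = 0 := h0 0
  have h01 : g u e₀ e₁ = 0 := by rw [hgi.symm, h10]
  have he : IsOrtho (g u) ![e₀, e₁] := by
    intro i k
    fin_cases i <;> fin_cases k <;> simp <;> assumption
  set t := g u T e₀ with ht
  have hTt : T = t • e₀ := by
    have := he.expand hgi T
    rw [Fin.sum_univ_two] at this
    simpa [hT1, ← ht] using this
  have htt : t ^ 2 = 1 - a ^ 2 := by
    rw [← hTT, hTt]; simp [h00]; ring
  have ht0 : t ≠ 0 := fun h0 => hT0 (by rw [← htt, h0]; ring)
  -- The condition da = 0, with ξ = dφ(T) + aη and ∇_v η tangent.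
  have II : ∀ v, secondForm h φ η u v T = r (φ u) * j (φ u) (fderiv ℝ φ u v) (η u) := by
    intro v
    have h3 := hB.fderiv_angle hu v
    rw [hξ] at h3
    simp only [map_add, add_apply, map_smul, smul_apply, smul_eq_mul,
      hin.symm (η u) (covAlong h φ η u v), hF.covAlong_normal_normal hu] at h3
    rw [secondForm, hin.symm]
    linarith
  -- For v = T the right side is r⟨(ξ - aη) ∧ ξ, η⟩ = 0.
  have II00 : secondForm h φ η u e₀ e₀ = 0 := by
    have h3 := II T
    rw [hT] at h3
    simp only [map_sub, sub_apply, map_smul, smul_apply, hK.cross_self hφ, hK.cross_field _ hφ,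
      smul_zero, sub_zero, mul_zero] at h3
    rw [hTt, (secondForm_linear_left _).map_smul, (secondForm_linear_right _).map_smul] at h3
    simpa [ht0] using h3
  -- The Gram identity gives j(dφ e₁, η)² = 1 - a² = t², and t cancels.
  have II10 : secondForm h φ η u e₁ e₀ ^ 2 = r (φ u) ^ 2 := by
    have h3 := II e₁
    rw [hTt, (secondForm_linear_right _).map_smul, smul_eq_mul] at h3
    have h4 := hK.cross_sq _ hφ (fderiv ℝ φ u e₁) (η u)
    have h5 : h (φ u) (ξ (φ u)) (fderiv ℝ φ u e₁) = 0 := by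
      rw [hξ]
      simp only [map_add, add_apply, map_smul, smul_apply, hF.normal u hu, hF.isometric u hu, hT1]
      simp
    have h6 : h (φ u) (fderiv ℝ φ u e₁) (η u) = 0 := by rw [hin.symm, hF.normal u hu]
    rw [hF.isometric u hu, h11, hF.unit u hu, h5, h6, ← ha] at h4
    have h7 : t ^ 2 * (secondForm h φ η u e₁ e₀ ^ 2 - r (φ u) ^ 2) = 0 := by
      linear_combination (t * secondForm h φ η u e₁ e₀
        + r (φ u) * j (φ u) (fderiv ℝ φ u e₁) (η u)) * h3 + r (φ u) ^ 2 * h4 - r (φ u) ^ 2 * htt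
    have h8 := (mul_eq_zero.mp h7).resolve_left (pow_ne_zero 2 ht0)
    linarith
  have II11 : secondForm h φ η u e₁ e₁ = c := by
    have h3 := hF.meanCurv_eq hu he
    rw [hB.mean u hu, Fin.sum_univ_two] at h3
    simp [II00] at h3
    exact h3.symm
  refine ⟨T, ![e₀, e₁], t, he, hTt, ht0, hξ, II11, ?_⟩
  -- Ric(η, η) = 2r² + 2ab and |A|² = c² + 2r², so r cancels.
  have h3 := hF.ricci_normal_normal hu hB.mean hB.mean_ne (hB.biharmonic u hu) he
  rw [hB.ricci_eq hu he, hF.unit u hu, ← ha] at h3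
  simp only [Fin.sum_univ_two, Matrix.cons_val_zero, Matrix.cons_val_one, II00, II11,
    hF.secondForm_comm hu e₀ e₁, II10] at h3
  linarith

/-- Since 2ab = c² ≠ 0, the non-degenerate case of the eigenvector equation applies at every point,
so these identities may be differentiated along the surface. -/
lemma IsBiharmonicSurface.grad_facts :
    h (φ u) (η u) (gradField h r (φ u)) = 0 ∧
      h (φ u) (gradField h r (φ u)) (gradField h r (φ u)) = c ^ 4 ∧
      h (φ u) (ξ (φ u)) (η u) ≠ 0 := by
  obtain ⟨T, e, t, -, -, -, -, -, hc⟩ := hB.exists_frame hu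
  have hne := pow_ne_zero 2 hB.mean_ne
  obtain ⟨h1, h2, h3⟩ := (hB.eigenvector hu).2 (by rw [← hc]; exact hne)
  refine ⟨h1, ?_, h3⟩
  rw [h2, ← hc]; ring

/-- II(grad r, grad r) is evaluated twice: it is zero through Hess r and non-zero through the matrix
of II, where grad r points along e₁. -/
lemma IsBiharmonicSurface.false : False := by
  have hF := hB.surface
  have hK := hB.killing
  have hφ := hF.mapsTo u hu
  have hin := hF.inner hu
  have hd := hF.diff hu
  obtain ⟨T, e, t, he, hTt, ht0, hξ, h11, -⟩ := hB.exists_frame hu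
  obtain ⟨hηG, hGG, ha0⟩ := hB.grad_facts hu
  have hdG := differentiableAt_of_smooth (hK.smooth_gradField hφ)
  have hdGφ : DifferentiableAt ℝ (fun y => gradField h r (φ y)) u := hdG.comp u hd
  obtain ⟨Y, hY⟩ := hF.exists_tangent hu (X := gradField h r (φ u)) (by rw [hin.symm, hηG])
  set G := gradField h r (φ u) with hG
  -- Half the derivative of |grad r|² = c⁴ along the surface.
  have k1 : ∀ w, h (φ u) (covDeriv h (gradField h r) (φ u) (fderiv ℝ φ u w)) G = 0 := by
    intro w
    have h1 := hF.fderiv_inner hu hdGφ hdGφ w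
    have h2 : (fun y => h (φ y) (gradField h r (φ y)) (gradField h r (φ y))) =ᶠ[nhds u]
        fun _ => c ^ 4 := hF.eventually hu fun y hy => (hB.grad_facts hy).2.1
    rw [h2.fderiv_eq, covAlong_comp h hd hdG, hin.symm (gradField h r (φ u))] at h1
    simp at h1
    linarith
  -- Derivative of ⟨η, grad r⟩ = 0 in the direction grad r.
  have k2 : secondForm h φ η u Y Y = h (φ u) (covDeriv h (gradField h r) (φ u) G) (η u) := by
    have h1 := hF.fderiv_inner hu (hF.diff_normal hu) hdGφ Y
    have h2 : (fun y => h (φ y) (η y) (gradField h r (φ y))) =ᶠ[nhds u] fun _ => 0 :=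
      hF.eventually hu fun y hy => (hB.grad_facts hy).1
    rw [h2.fderiv_eq, covAlong_comp h hd hdG, hY] at h1
    simp at h1
    rw [secondForm, hY, hin.symm _ (η u)]
    linarith
  have k3 := hK.hess_grad_field hφ
  -- Hess r(grad r, ·) vanishes on ξ and on dφ(T), hence on aη.
  rw [← hG, hξ, map_add, map_smul, hK.hess_symm hφ, k1, zero_add, smul_eq_mul] at k3
  have k4 : secondForm h φ η u Y Y = 0 := by
    rw [k2]; exact (mul_eq_zero.mp k3).resolve_left ha0
  have hYT : g u Y T = 0 := by
    have h1 := hK.gradField_field hφ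
    rw [← hG, hξ] at h1
    rw [← hF.isometric u hu, hY]
    simpa [hin.symm G (η u), hηG] using h1
  have hY0 : g u Y (e 0) = 0 := by
    rw [hTt] at hYT
    simpa [ht0] using hYT
  have hYe : Y = g u Y (e 1) • e 1 := by
    have := he.expand (hF.source.inner u hu) Y
    rw [Fin.sum_univ_two, hY0] at this
    simpa using this
  have hYY : g u Y (e 1) ≠ 0 := by
    intro h0
    rw [h0, zero_smul] at hYe
    rw [← hY, hYe] at hGG
    simp at hGG
    exact pow_ne_zero 4 hB.mean_ne hGG.symm
  rw [hYe, (secondForm_linear_left _).map_smul, (secondForm_linear_right _).map_smul, h11,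
    smul_eq_mul, smul_eq_mul] at k4
  exact mul_ne_zero hYY (mul_ne_zero hYY hB.mean_ne) k4

end

/-! ### Charts -/

section Charts

variable {m n k : ℕ}
  {S : Type*} [TopologicalSpace S] [ChartedSpace (Eu m) S] [IsManifold (𝓡 m) ∞ S]
  {N : Type*} [TopologicalSpace N] [ChartedSpace (Eu n) N] [IsManifold (𝓡 n) ∞ N]
  {P : Type*} [TopologicalSpace P] [ChartedSpace (Eu k) P] [IsManifold (𝓡 k) ∞ P]

omit [IsManifold (𝓡 m) ∞ S] in
/-- The differential of a smooth map applied to a smooth field along a map. -/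
lemma contMDiffAt_mfderiv_apply {f : N → P} {s : Set N} (hs : IsOpen s)
    (hf : ContMDiffOn (𝓡 n) (𝓡 k) ∞ f s) {b : S → N} {V : ∀ q, TangentSpace (𝓡 n) (b q)} {q₀ : S}
    (hq : b q₀ ∈ s)
    (hV : ContMDiffAt (𝓡 m) (𝓡 n).tangent ∞ (fun q => (⟨b q, V q⟩ : TangentBundle (𝓡 n) N)) q₀) :
    ContMDiffAt (𝓡 m) (𝓡 k).tangent ∞
      (fun q => (⟨f (b q), mfderiv (𝓡 n) (𝓡 k) f (b q) (V q)⟩ : TangentBundle (𝓡 k) P)) q₀ := by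
  have : IsManifold (𝓡 n) 1 N := .of_le (n := ∞) (by exact_mod_cast le_top)
  have : IsManifold (𝓡 k) 1 P := .of_le (n := ∞) (by exact_mod_cast le_top)
  have h1 := hf.contMDiffOn_tangentMapWithin (m := ∞) (by simp) hs.uniqueMDiffOn
  have hb : ContinuousAt b q₀ :=
    (FiberBundle.continuous_proj (Eu n) (TangentSpace (𝓡 n) : N → Type _)).continuousAt.comp
      hV.continuousAt
  have hopen : IsOpen (Bundle.TotalSpace.proj ⁻¹' s : Set (TangentBundle (𝓡 n) N)) :=
    hs.preimage (FiberBundle.continuous_proj (Eu n) (TangentSpace (𝓡 n) : N → Type _))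
  have h2 : ContMDiffAt (𝓡 n).tangent (𝓡 k).tangent ∞ (tangentMapWithin (𝓡 n) (𝓡 k) f s)
      (⟨b q₀, V q₀⟩ : TangentBundle (𝓡 n) N) :=
    h1.contMDiffAt (hopen.mem_nhds hq)
  have h3 := ContMDiffAt.comp q₀ h2 hV
  refine h3.congr_of_eventuallyEq ?_
  filter_upwards [hb (hs.mem_nhds hq)] with q hq'
  have hq'' : b q ∈ s := hq'
  simp only [Function.comp, tangentMapWithin, mfderivWithin_of_isOpen hs hq'']

variable {ψ : OpenPartialHomeomorph N (Eu n)} (hψ : ψ ∈ atlas (Eu n) N)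
  {κ : OpenPartialHomeomorph S (Eu m)} (hκ : κ ∈ atlas (Eu m) S)

lemma mem_maximalAtlas_of_mem_atlas {ψ : OpenPartialHomeomorph N (Eu n)}
    (hψ : ψ ∈ atlas (Eu n) N) : ψ ∈ IsManifold.maximalAtlas (𝓡 n) ∞ N :=
  IsManifold.subset_maximalAtlas hψ

include hψ in
lemma chart_mdifferentiable : ψ.MDifferentiable (𝓡 n) (𝓡 n) :=
  have : IsManifold (𝓡 n) 1 N := .of_le (n := ∞) (by exact_mod_cast le_top)
  mdifferentiable_of_mem_atlas hψ

include hψ in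
lemma toChart_fromChart {u : Eu n} (hu : u ∈ ψ.target) (v : Eu n) :
    toChart ψ (ψ.symm u) (fromChart ψ u v) = v :=
  congrArg (fun L : Eu n →L[ℝ] Eu n => L v) ((chart_mdifferentiable hψ).comp_symm_deriv hu)

include hψ in
lemma fromChart_toChart {u : Eu n} (hu : u ∈ ψ.target) (w : TangentSpace (𝓡 n) (ψ.symm u)) :
    fromChart ψ u (toChart ψ (ψ.symm u) w) = w := by
  apply (chart_mdifferentiable hψ).mfderiv_injective (ψ.map_target hu)
  exact toChart_fromChart hψ hu _

include hψ in
lemma contMDiffAt_fromChart {u : Eu n} (hu : u ∈ ψ.target) (v : Eu n) :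
    ContMDiffAt (𝓡 n) (𝓡 n).tangent ∞
      (fun y => (⟨ψ.symm y, fromChart ψ y v⟩ : TangentBundle (𝓡 n) N)) u := by
  refine contMDiffAt_mfderiv_apply (S := Eu n) (b := fun y => y) (V := fun _ => v) ψ.open_target
    (contMDiffOn_symm_of_mem_maximalAtlas (mem_maximalAtlas_of_mem_atlas hψ)) hu ?_
  exact contMDiffAt_vectorSpace_iff_contDiffAt.mpr contDiffAt_const

include hψ in
omit [IsManifold (𝓡 m) ∞ S] in
lemma contMDiffAt_toChart {b : S → N} {V : ∀ q, TangentSpace (𝓡 n) (b q)} {q₀ : S}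
    (hq : b q₀ ∈ ψ.source)
    (hV : ContMDiffAt (𝓡 m) (𝓡 n).tangent ∞ (fun q => (⟨b q, V q⟩ : TangentBundle (𝓡 n) N)) q₀) :
    ContMDiffAt (𝓡 m) 𝓘(ℝ, Eu n) ∞ (fun q => (toChart ψ (b q) (V q) : Eu n)) q₀ := by
  have h1 := contMDiffAt_mfderiv_apply ψ.open_source
    (contMDiffOn_of_mem_maximalAtlas (mem_maximalAtlas_of_mem_atlas hψ)) hq hV
  exact (contMDiff_snd_tangentBundle_modelSpace (Eu n) (𝓡 n)).contMDiffAt.comp q₀ h1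

lemma chartMetric_apply (g : RMetric n N) (ψ : OpenPartialHomeomorph N (Eu n)) (u v w : Eu n) :
    chartMetric g ψ u v w = g.inner (ψ.symm u) (fromChart ψ u v) (fromChart ψ u w) := rfl

include hψ in
lemma contDiffAt_inner_fromChart (g : RMetric n N) {u : Eu n} (hu : u ∈ ψ.target) (v w : Eu n) :
    ContDiffAt ℝ ∞ (fun y => g.inner (ψ.symm y) (fromChart ψ y v) (fromChart ψ y w)) u := by
  have hs : ContMDiffAt (𝓡 n) (𝓡 n) ∞ ψ.symm u :=
    contMDiffAt_symm_of_mem_maximalAtlas (mem_maximalAtlas_of_mem_atlas hψ) hu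
  have hg := ContMDiffAt.comp u g.contMDiff.contMDiffAt hs
  have h1 : ContMDiffAt (𝓡 n) ((𝓡 n).prod 𝓘(ℝ)) ∞
      (fun y => Bundle.TotalSpace.mk' ℝ (E := Bundle.Trivial N ℝ) (ψ.symm y)
        (g.inner (ψ.symm y) (fromChart ψ y v) (fromChart ψ y w))) u := by
    apply ContMDiffAt.clm_bundle_apply₂ (F₁ := Eu n) (F₂ := Eu n)
    · exact hg
    · exact contMDiffAt_fromChart hψ hu v
    · exact contMDiffAt_fromChart hψ hu w
  simp only [Bundle.contMDiffAt_totalSpace] at h1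
  exact contMDiffAt_iff_contDiffAt.mp h1.2

include hψ in
lemma fromChart_ne_zero {u : Eu n} (hu : u ∈ ψ.target) {v : Eu n} (hv : v ≠ 0) :
    fromChart ψ u v ≠ 0 := by
  intro h0
  have := toChart_fromChart hψ hu v
  rw [h0, map_zero] at this
  exact hv this.symm

include hψ in
lemma contDiffAt_chartMetric (g : RMetric n N) {u : Eu n} (hu : u ∈ ψ.target) :
    ContDiffAt ℝ ∞ (chartMetric g ψ) u := by
  have key : ∀ v w : Eu n, ContDiffAt ℝ ∞ (fun y => chartMetric g ψ y v w) u := by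
    intro v w
    simp only [chartMetric_apply]
    exact contDiffAt_inner_fromChart hψ g hu v w
  refine contDiffAt_clm_apply_iff.mpr fun v => ?_
  refine contDiffAt_clm_apply_iff.mpr fun w => ?_
  exact key v w

include hψ in
lemma isInner_chartMetric (g : RMetric n N) {u : Eu n} (hu : u ∈ ψ.target) :
    IsInner (chartMetric g ψ u) where
  symm v w := by
    rw [chartMetric_apply, chartMetric_apply]
    exact g.symm (ψ.symm u) (fromChart ψ u v) (fromChart ψ u w)
  pos v hv := by
    rw [chartMetric_apply]
    exact g.pos (ψ.symm u) (fromChart ψ u v) (fromChart_ne_zero hψ hu hv)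

include hψ in
lemma isMetricOn_chartMetric (g : RMetric n N) : IsMetricOn (chartMetric g ψ) ψ.target where
  isOpen := ψ.open_target
  smooth _ hu := contDiffAt_chartMetric hψ g hu
  inner _ hu := isInner_chartMetric hψ g hu

omit [ChartedSpace (Eu m) S] [IsManifold (𝓡 m) ∞ S] [ChartedSpace (Eu n) N]
  [IsManifold (𝓡 n) ∞ N] in
lemma isOpen_chartDomain {f : S → N} (hf : Continuous f) : IsOpen (chartDomain f κ ψ) := by
  have : chartDomain f κ ψ = κ.target ∩ κ.symm ⁻¹' (f ⁻¹' ψ.source) := rfl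
  rw [this]
  exact κ.isOpen_inter_preimage_symm (ψ.open_source.preimage hf)

include hψ hκ in
lemma contDiffAt_chartMap {f : S → N} (hf : ContMDiff (𝓡 m) (𝓡 n) ∞ f) {u : Eu m}
    (hu : u ∈ chartDomain f κ ψ) : ContDiffAt ℝ ∞ (chartMap f κ ψ) u := by
  rw [← contMDiffAt_iff_contDiffAt]
  have h1 : ContMDiffAt (𝓡 m) (𝓡 m) ∞ κ.symm u :=
    contMDiffAt_symm_of_mem_maximalAtlas (mem_maximalAtlas_of_mem_atlas hκ) hu.1
  have h2 : ContMDiffAt (𝓡 n) (𝓡 n) ∞ ψ (f (κ.symm u)) :=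
    contMDiffAt_of_mem_maximalAtlas (mem_maximalAtlas_of_mem_atlas hψ) hu.2
  exact ContMDiffAt.comp u h2 (ContMDiffAt.comp u hf.contMDiffAt h1)

include hψ hκ in
lemma fderiv_chartMap {f : S → N} (hf : ContMDiff (𝓡 m) (𝓡 n) ∞ f) {u : Eu m}
    (hu : u ∈ chartDomain f κ ψ) (v : Eu m) :
    fderiv ℝ (chartMap f κ ψ) u v =
      toChart ψ (f (κ.symm u)) (mfderiv (𝓡 m) (𝓡 n) f (κ.symm u) (fromChart κ u v)) := by
  have d1 : MDifferentiableAt (𝓡 m) (𝓡 m) κ.symm u :=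
    (chart_mdifferentiable hκ).mdifferentiableAt_symm hu.1
  have d2 : MDifferentiableAt (𝓡 m) (𝓡 n) f (κ.symm u) :=
    hf.contMDiffAt.mdifferentiableAt (by simp)
  have d3 : MDifferentiableAt (𝓡 n) (𝓡 n) ψ (f (κ.symm u)) :=
    (chart_mdifferentiable hψ).mdifferentiableAt hu.2
  have h1 : HasMFDerivAt (𝓡 m) (𝓡 n) (chartMap f κ ψ) u
      ((mfderiv (𝓡 n) (𝓡 n) ψ (f (κ.symm u))).comp
        ((mfderiv (𝓡 m) (𝓡 n) f (κ.symm u)).comp (mfderiv (𝓡 m) (𝓡 m) κ.symm u))) :=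
    HasMFDerivAt.comp u d3.hasMFDerivAt (HasMFDerivAt.comp u d2.hasMFDerivAt d1.hasMFDerivAt)
  have h2 : mfderiv (𝓡 m) (𝓡 n) (chartMap f κ ψ) u = fderiv ℝ (chartMap f κ ψ) u :=
    mfderiv_eq_fderiv
  rw [← h2, h1.mfderiv]
  rfl

omit [ChartedSpace (Eu m) S] [IsManifold (𝓡 m) ∞ S] [ChartedSpace (Eu n) N]
  [IsManifold (𝓡 n) ∞ N] in
lemma chartMap_mem_target {f : S → N} {u : Eu m} (hu : u ∈ chartDomain f κ ψ) :
    chartMap f κ ψ u ∈ ψ.target := ψ.map_source hu.2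

omit [ChartedSpace (Eu m) S] [IsManifold (𝓡 m) ∞ S] [ChartedSpace (Eu n) N]
  [IsManifold (𝓡 n) ∞ N] in
lemma symm_chartMap {f : S → N} {u : Eu m} (hu : u ∈ chartDomain f κ ψ) :
    ψ.symm (chartMap f κ ψ u) = f (κ.symm u) := ψ.left_inv hu.2

include hψ in
/-- The metric of the chart evaluated on vectors given at the point itself. -/
lemma chartMetric_toChart (g : RMetric n N) {x : N} (hx : x ∈ ψ.source)
    (v w : TangentSpace (𝓡 n) x) :
    chartMetric g ψ (ψ x) (toChart ψ x v) (toChart ψ x w) = g.inner x v w := by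
  -- Stated at points ψ.symm u first, where the tangent spaces match definitionally; ψ.symm (ψ x) =
  -- x is rewritten only afterwards.
  have key : ∀ u ∈ ψ.target, ∀ v w : TangentSpace (𝓡 n) (ψ.symm u),
      chartMetric g ψ u (toChart ψ (ψ.symm u) v) (toChart ψ (ψ.symm u) w) =
        g.inner (ψ.symm u) v w := by
    intro u hu v w
    rw [chartMetric_apply, fromChart_toChart hψ hu, fromChart_toChart hψ hu]
  have h1 := key (ψ x) (ψ.map_source hx)
  rw [ψ.left_inv hx] at h1
  exact h1 v w

include hψ in
lemma contDiffAt_chartField {ξ : ∀ x : N, TangentSpace (𝓡 n) x}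
    (hξ : ContMDiff (𝓡 n) (𝓡 n).tangent ∞ (fun x => (⟨x, ξ x⟩ : TangentBundle (𝓡 n) N)))
    {u : Eu n} (hu : u ∈ ψ.target) : ContDiffAt ℝ ∞ (chartField ξ ψ) u := by
  rw [← contMDiffAt_iff_contDiffAt]
  have h1 : ContMDiffAt (𝓡 n) (𝓡 n) ∞ ψ.symm u :=
    contMDiffAt_symm_of_mem_maximalAtlas (mem_maximalAtlas_of_mem_atlas hψ) hu
  exact contMDiffAt_toChart hψ (S := Eu n) (b := ψ.symm) (ψ.map_target hu)
    (ContMDiffAt.comp u hξ.contMDiffAt h1)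

include hψ hκ in
lemma contDiffAt_chartAlong {f : S → N} {η : ∀ p : S, TangentSpace (𝓡 n) (f p)} {U : Set S}
    (hU : IsOpen U)
    (hη : ContMDiffOn (𝓡 m) (𝓡 n).tangent ∞ (fun p => (⟨f p, η p⟩ : TangentBundle (𝓡 n) N)) U)
    {u : Eu m} (hu : u ∈ chartDomain f κ ψ) (huU : κ.symm u ∈ U) :
    ContDiffAt ℝ ∞ (chartAlong f η κ ψ) u := by
  rw [← contMDiffAt_iff_contDiffAt]
  have h1 : ContMDiffAt (𝓡 m) (𝓡 m) ∞ κ.symm u :=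
    contMDiffAt_symm_of_mem_maximalAtlas (mem_maximalAtlas_of_mem_atlas hκ) hu.1
  have h2 := hη.contMDiffAt (hU.mem_nhds huU)
  exact contMDiffAt_toChart hψ (S := Eu m) (b := fun y => f (κ.symm y)) hu.2
    (ContMDiffAt.comp u h2 h1)

end Charts

/-! ### Volume forms in charts -/

lemma IsInner.exists_ortho {B : Form 3} (hB : IsInner B) : ∃ e : Fin 3 → Eu 3, IsOrtho B e := by
  obtain ⟨e₀, h00, -⟩ := hB.exists_unit_orthogonal (k := 0) (by norm_num) ![]
  obtain ⟨e₁, h11, h1⟩ := hB.exists_unit_orthogonal (k := 1) (by norm_num) ![e₀]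
  obtain ⟨e₂, h22, h2⟩ := hB.exists_unit_orthogonal (k := 2) (by norm_num) ![e₀, e₁]
  have a1 : B e₀ e₁ = 0 := h1 0
  have a2 : B e₀ e₂ = 0 := h2 0
  have a3 : B e₁ e₂ = 0 := h2 1
  have b1 := hB.symm e₀ e₁
  have b2 := hB.symm e₀ e₂
  have b3 := hB.symm e₁ e₂
  refine ⟨![e₀, e₁, e₂], fun i k => ?_⟩
  fin_cases i <;> fin_cases k <;> simp <;> linarith

/-- The bilinear form `(v, w) ↦ d det(v, x, w)`. -/
def crossForm (d : ℝ) (x : Eu 3) : Form 3 :=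
  LinearMap.toContinuousLinearMap
    ((LinearMap.toContinuousLinearMap :
        (Eu 3 →ₗ[ℝ] ℝ) ≃ₗ[ℝ] (Eu 3 →L[ℝ] ℝ)).toLinearMap ∘ₗ
      LinearMap.mk₂ ℝ (fun v w => d * (coordMatrix ![v, x, w]).det)
        (fun v v' w => by simp [coordMatrix, Matrix.det_fin_three]; ring)
        (fun c v w => by simp [coordMatrix, Matrix.det_fin_three]; ring)
        (fun v w w' => by simp [coordMatrix, Matrix.det_fin_three]; ring)
        (fun c v w => by simp [coordMatrix, Matrix.det_fin_three]; ring))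

lemma crossForm_apply (d : ℝ) (x v w : Eu 3) :
    crossForm d x v w = d * (coordMatrix ![v, x, w]).det := rfl

/-- Determinant of PᵀΓP for P with columns v, x, w: (det P)² det Γ is their Gram determinant. -/
lemma crossForm_sq {B : Form 3} (hB : IsInner B) {d : ℝ} (hd : d ^ 2 = (gram B).det) {x : Eu 3}
    (hx : B x x = 1) (v w : Eu 3) :
    crossForm d x v w ^ 2 = B v v * B w w + 2 * B v w * B x v * B x w - B v v * B x w ^ 2
      - B w w * B x v ^ 2 - B v w ^ 2 := by
  have h1 := congrArg Matrix.det (transpose_mul_gram_mul B ![v, x, w])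
  rw [Matrix.det_mul, Matrix.det_mul, Matrix.det_transpose] at h1
  rw [crossForm_apply, mul_pow, hd]
  have h2 : (gram B).det * (coordMatrix ![v, x, w]).det ^ 2 =
      (coordMatrix ![v, x, w]).det * (gram B).det * (coordMatrix ![v, x, w]).det := by ring
  rw [h2, h1, Matrix.det_fin_three]
  have b1 := hB.symm v x
  have b2 := hB.symm w x
  have b3 := hB.symm w v
  simp [hx, b1, b2, b3]
  ring

section Volume

variable {E : Type*} [TopologicalSpace E] [ChartedSpace (Eu 3) E] [IsManifold (𝓡 3) ∞ E]
  {gE : RMetric 3 E} {vol : ∀ x : E, (TangentSpace (𝓡 3) x) [⋀^Fin 3]→ₗ[ℝ] ℝ}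
  {ψ : OpenPartialHomeomorph E (Eu 3)}

/-- The volume of the coordinate frame. -/
def chartDensity (vol : ∀ x : E, (TangentSpace (𝓡 3) x) [⋀^Fin 3]→ₗ[ℝ] ℝ)
    (ψ : OpenPartialHomeomorph E (Eu 3)) (u : Eu 3) : ℝ :=
  vol (ψ.symm u) fun i => fromChart ψ u (coordVec i)

omit [IsManifold (𝓡 3) ∞ E] in
-- An alternating 3-form on a three-dimensional space is a multiple of the determinant.
lemma vol_fromChart (u : Eu 3) (e : Fin 3 → Eu 3) :
    vol (ψ.symm u) (fun i => fromChart ψ u (e i)) =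
      chartDensity vol ψ u * (coordMatrix e).det := by
  let b := (EuclideanSpace.basisFun (Fin 3) ℝ).toBasis
  let L : Eu 3 →ₗ[ℝ] TangentSpace (𝓡 3) (ψ.symm u) := (fromChart ψ u).toLinearMap
  have h1 := ((vol (ψ.symm u)).compLinearMap L).eq_smul_basis_det b
  have h2 := congrArg (fun A => A e) h1
  simp only [AlternatingMap.smul_apply, smul_eq_mul, Module.Basis.det_apply] at h2
  have h3 : b.toMatrix e = coordMatrix e := by
    ext i k
    simp [b, Module.Basis.toMatrix_apply, coordMatrix]
  rw [h3] at h2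
  have h4 : ((vol (ψ.symm u)).compLinearMap L) b = chartDensity vol ψ u := by
    have : (b : Fin 3 → Eu 3) = fun i => coordVec i := by
      ext i
      simp [b, coordVec]
    rw [this]; rfl
  rw [h4] at h2
  exact h2

/-- Evaluation on an orthonormal frame with matrix P: both the squared volume and (det P)² det Γ
equal 1. -/
lemma chartDensity_sq (hvol : IsVolumeForm gE vol) (hψ : ψ ∈ atlas (Eu 3) E) {u : Eu 3}
    (hu : u ∈ ψ.target) : chartDensity vol ψ u ^ 2 = (gram (chartMetric gE ψ u)).det := by
  obtain ⟨e, he⟩ := (isInner_chartMetric hψ gE hu).exists_ortho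
  have h1 := hvol.1 (ψ.symm u) (fun i => fromChart ψ u (e i)) fun i k => he i k
  rw [vol_fromChart] at h1
  have h2 : (chartDensity vol ψ u * (coordMatrix e).det) ^ 2 = 1 := by
    rw [← sq_abs, h1, one_pow]
  have h3 := he.det_sq_mul
  have h4 : (coordMatrix e).det ^ 2 ≠ 0 := left_ne_zero_of_mul_eq_one h3
  apply mul_left_cancel₀ h4
  rw [h3, ← h2]
  ring

lemma IsMetricOn.contDiffAt_gram_det {h : Eu 3 → Form 3} {O : Set (Eu 3)} (hO : IsMetricOn h O)
    {u : Eu 3} (hu : u ∈ O) : ContDiffAt ℝ ∞ (fun y => (gram (h y)).det) u := by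
  have key : ∀ v w : Eu 3, ContDiffAt ℝ ∞ (fun y => h y v w) u := fun v w =>
    ((hO.smooth u hu).clm_apply contDiffAt_const).clm_apply contDiffAt_const
  simp only [Matrix.det_fin_three, gram, Matrix.of_apply]
  have k3 : ∀ a b c d e f : Eu 3, ContDiffAt ℝ ∞ (fun y => h y a b * h y c d * h y e f) u :=
    fun a b c d e f => ((key a b).mul (key c d)).mul (key e f)
  exact (((((k3 _ _ _ _ _ _).sub (k3 _ _ _ _ _ _)).sub (k3 _ _ _ _ _ _)).add
    (k3 _ _ _ _ _ _)).add (k3 _ _ _ _ _ _)).sub (k3 _ _ _ _ _ _)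

/-- The volume form is only assumed continuous. Its density has square det g ≠ 0, so by continuity
its sign is locally constant and it is ±√(det g), which is smooth. -/
lemma contDiffAt_chartDensity (hvol : IsVolumeForm gE vol) (hψ : ψ ∈ atlas (Eu 3) E) {u : Eu 3}
    (hu : u ∈ ψ.target) : ContDiffAt ℝ ∞ (chartDensity vol ψ) u := by
  have hM := isMetricOn_chartMetric hψ gE
  have hD := hM.contDiffAt_gram_det hu
  have hne : (gram (chartMetric gE ψ u)).det ≠ 0 := (hM.inner u hu).gram_isUnit.ne_zero
  have hS := hD.sqrt hne
  have hO : ∀ᶠ y in nhds u, y ∈ ψ.target := ψ.open_target.mem_nhds hu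
  have hc : ContinuousAt (chartDensity vol ψ) u :=
    (hvol.2 ψ hψ).continuousAt (ψ.open_target.mem_nhds hu)
  have h0 : chartDensity vol ψ u ≠ 0 := by
    intro h0
    rw [← chartDensity_sq hvol hψ hu, h0] at hne
    simp at hne
  rcases h0.lt_or_gt with h0 | h0
  · refine hS.neg.congr_of_eventuallyEq ?_
    filter_upwards [hO, hc.eventually_lt_const h0] with y hy hy0
    rw [← chartDensity_sq hvol hψ hy, Real.sqrt_sq_eq_abs, abs_of_neg hy0, neg_neg]
  · refine hS.congr_of_eventuallyEq ?_
    filter_upwards [hO, hc.eventually_const_lt h0] with y hy hy0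
    rw [← chartDensity_sq hvol hψ hy, Real.sqrt_sq_eq_abs, abs_of_pos hy0]

/-- The form `(v, w) ↦ ⟨v ∧ ξ, w⟩` in the chart `ψ`. -/
def chartCrossForm (vol : ∀ x : E, (TangentSpace (𝓡 3) x) [⋀^Fin 3]→ₗ[ℝ] ℝ)
    (ξ : ∀ x : E, TangentSpace (𝓡 3) x) (ψ : OpenPartialHomeomorph E (Eu 3)) (u : Eu 3) : Form 3 :=
  crossForm (chartDensity vol ψ u) (chartField ξ ψ u)

lemma chartMetric_chartCross (hψ : ψ ∈ atlas (Eu 3) E) {u : Eu 3} (hu : u ∈ ψ.target)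
    (ξ : ∀ x : E, TangentSpace (𝓡 3) x) (v z : Eu 3) :
    chartMetric gE ψ u (chartCross gE vol ψ u v (chartField ξ ψ u)) z =
      chartCrossForm vol ξ ψ u v z := by
  have key : ∀ z, vol (ψ.symm u) ![fromChart ψ u v, fromChart ψ u (chartField ξ ψ u),
      fromChart ψ u z] = chartCrossForm vol ξ ψ u v z := by
    intro z
    rw [chartCrossForm, crossForm_apply, ← vol_fromChart]
    congr 1
    ext i
    fin_cases i <;> rfl
  rw [chartCross]
  simp only [key]
  exact (isInner_chartMetric hψ gE hu).apply_sharp (chartCrossForm vol ξ ψ u v).toLinearMap.isLinear z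

lemma contDiffAt_chartCrossForm (hvol : IsVolumeForm gE vol) (hψ : ψ ∈ atlas (Eu 3) E)
    {ξ : ∀ x : E, TangentSpace (𝓡 3) x}
    (hξ : ContMDiff (𝓡 3) (𝓡 3).tangent ∞ (fun x => (⟨x, ξ x⟩ : TangentBundle (𝓡 3) E)))
    {u : Eu 3} (hu : u ∈ ψ.target) : ContDiffAt ℝ ∞ (chartCrossForm vol ξ ψ) u := by
  refine contDiffAt_clm_apply_iff.mpr fun v => ?_
  refine contDiffAt_clm_apply_iff.mpr fun w => ?_
  have hc : ∀ i, ContDiffAt ℝ ∞ (fun y => chartField ξ ψ y i) u :=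
    (contDiffAt_euclidean).mp (contDiffAt_chartField hψ hξ hu)
  have hd := contDiffAt_chartDensity hvol hψ hu
  simp only [chartCrossForm, crossForm_apply, coordMatrix, Matrix.det_fin_three, Matrix.of_apply]
  have h0 := hc 0
  have h1 := hc 1
  have h2 := hc 2
  simp
  fun_prop

lemma IsKillingSubmersion.isKillingData
    {M : Type*} [TopologicalSpace M] [ChartedSpace (Eu 2) M] [IsManifold (𝓡 2) ∞ M]
    {gM : RMetric 2 M} {π : E → M} {ξ : ∀ x : E, TangentSpace (𝓡 3) x}
    (hπ : IsKillingSubmersion gE gM π ξ) (hvol : IsVolumeForm gE vol) {r : E → ℝ}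
    (hr : IsBundleCurvature gE ξ vol r) (hψ : ψ ∈ atlas (Eu 3) E) :
    IsKillingData (chartMetric gE ψ) ψ.target (chartField ξ ψ) (chartCrossForm vol ξ ψ)
      (fun y => r (ψ.symm y)) := by
  have hunit : ∀ u ∈ ψ.target, chartMetric gE ψ u (chartField ξ ψ u) (chartField ξ ψ u) = 1 := by
    intro u hu
    rw [chartMetric_apply, chartField, fromChart_toChart hψ hu]
    exact hπ.unit _
  exact
    { metric := isMetricOn_chartMetric hψ gE
      smooth_field := fun u hu => contDiffAt_chartField hψ hπ.smooth hu
      unit := hunit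
      smooth_cross := fun u hu => contDiffAt_chartCrossForm hvol hψ hπ.smooth hu
      cross_skew := fun u _ v w => by
        simp only [chartCrossForm, crossForm_apply, coordMatrix, Matrix.det_fin_three]
        simp
        ring
      cross_field := fun u _ v => by
        simp only [chartCrossForm, crossForm_apply, coordMatrix, Matrix.det_fin_three]
        simp
      cross_sq := fun u hu v w => crossForm_sq (isInner_chartMetric hψ gE hu)
        (chartDensity_sq hvol hψ hu) (hunit u hu) v w
      smooth_curv := fun u hu => by
        rw [← contMDiffAt_iff_contDiffAt]
        exact ContMDiffAt.comp u hr.1.contMDiffAt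
          (contMDiffAt_symm_of_mem_maximalAtlas (mem_maximalAtlas_of_mem_atlas hψ) hu)
      covDeriv_field := fun u hu v z => by
        rw [hr.2 ψ hψ u hu v, map_smul, ← chartMetric_chartCross (gE := gE) hψ hu]
        rfl }

end Volume

/-! ### Killing submersions and surfaces in charts -/

lemma IsKillingData.mono {h : Eu 3 → Form 3} {O O' : Set (Eu 3)} {ξ : Eu 3 → Eu 3}
    {j : Eu 3 → Form 3} {r : Eu 3 → ℝ} (hK : IsKillingData h O ξ j r) (hO : IsOpen O')
    (hsub : O' ⊆ O) : IsKillingData h O' ξ j r where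
  metric :=
    { isOpen := hO
      smooth := fun u hu => hK.metric.smooth u (hsub hu)
      inner := fun u hu => hK.metric.inner u (hsub hu) }
  smooth_field u hu := hK.smooth_field u (hsub hu)
  unit u hu := hK.unit u (hsub hu)
  smooth_cross u hu := hK.smooth_cross u (hsub hu)
  cross_skew u hu := hK.cross_skew u (hsub hu)
  cross_field u hu := hK.cross_field u (hsub hu)
  cross_sq u hu := hK.cross_sq u (hsub hu)
  smooth_curv u hu := hK.smooth_curv u (hsub hu)
  covDeriv_field u hu := hK.covDeriv_field u (hsub hu)

lemma exists_smul_eq_of_apply_eq_zero {L : Eu 3 →L[ℝ] Eu 2} (hL : Function.Surjective L) {x z : Eu 3}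
    (hx0 : x ≠ 0) (hx : L x = 0) (hz : L z = 0) : ∃ c : ℝ, c • x = z := by
  have h1 := LinearMap.finrank_range_add_finrank_ker L.toLinearMap
  rw [LinearMap.range_eq_top.mpr hL] at h1
  simp only [finrank_top, finrank_euclideanSpace, Fintype.card_fin] at h1
  have h2 : Module.finrank ℝ (LinearMap.ker L.toLinearMap) = 1 := by omega
  have h3 : (⟨x, hx⟩ : LinearMap.ker L.toLinearMap) ≠ 0 := fun h => hx0 (congrArg Subtype.val h)
  obtain ⟨c, hc⟩ := (finrank_eq_one_iff_of_nonzero' _ h3).mp h2 ⟨z, hz⟩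
  exact ⟨c, congrArg Subtype.val hc⟩

/-- A linear surjection which is isometric orthogonally to its kernel, the kernel being spanned by
a unit vector. -/
lemma inner_eq_of_horizontal_isometry {B : Form 3} (hsymm : ∀ v w, B v w = B w v) {C : Form 2}
    {L : Eu 3 →L[ℝ] Eu 2} (hL : Function.Surjective L) {x : Eu 3} (hx : L x = 0) (hx1 : B x x = 1)
    (hiso : ∀ v w, (∀ z, L z = 0 → B v z = 0) → (∀ z, L z = 0 → B w z = 0) →
      C (L v) (L w) = B v w) (v w : Eu 3) :
    B v w = C (L v) (L w) + B x v * B x w := by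
  have hx0 : x ≠ 0 := by rintro rfl; simp at hx1
  have hor : ∀ v z, L z = 0 → B (v - B x v • x) z = 0 := by
    intro v z hz
    -- The kernel is a line by rank-nullity, so orthogonality to the kernel is orthogonality to `x`.
    obtain ⟨c, rfl⟩ := exists_smul_eq_of_apply_eq_zero hL hx0 hx hz
    simp [hx1, hsymm v x]
  have h1 := hiso (v - B x v • x) (w - B x w • x) (hor v) (hor w)
  simp only [map_sub, map_smul, hx, smul_zero, sub_zero, sub_apply,
    smul_apply, smul_eq_mul, hx1, hsymm v x] at h1
  linarith

section

variable {E : Type*} [TopologicalSpace E] [ChartedSpace (Eu 3) E] [IsManifold (𝓡 3) ∞ E]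
  {M : Type*} [TopologicalSpace M] [ChartedSpace (Eu 2) M] [IsManifold (𝓡 2) ∞ M]
  {S : Type*} [TopologicalSpace S] [ChartedSpace (Eu 2) S] [IsManifold (𝓡 2) ∞ S]
  {gE : RMetric 3 E} {gM : RMetric 2 M} {gS : RMetric 2 S} {π : E → M}
  {ξ : ∀ x : E, TangentSpace (𝓡 3) x} {vol : ∀ x : E, (TangentSpace (𝓡 3) x) [⋀^Fin 3]→ₗ[ℝ] ℝ}
  {r : E → ℝ} {ψ : OpenPartialHomeomorph E (Eu 3)}

/-- The trajectory of ξ through `x` stays in one fibre, so π is constant along it. -/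
lemma IsKillingSubmersion.mfderiv_field (hπ : IsKillingSubmersion gE gM π ξ) (x : E) :
    mfderiv (𝓡 3) (𝓡 2) π x (ξ x) = 0 := by
  obtain ⟨γ, rfl, hγ, hfib⟩ := hπ.fiber x
  have h1 := hγ 0
  have h2 : MDifferentiableAt (𝓡 3) (𝓡 2) π (γ 0) :=
    hπ.riemannianSubmersion.smooth.contMDiffAt.mdifferentiableAt (by simp)
  have h3 := HasMFDerivAt.comp 0 h2.hasMFDerivAt h1
  have h4 : π ∘ γ = fun _ => π (γ 0) := by
    funext t
    have : γ t ∈ π ⁻¹' {π (γ 0)} := hfib ▸ mem_range_self t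
    exact this
  rw [h4] at h3
  have h5 := hasMFDerivAt_unique h3 (hasMFDerivAt_const (π (γ 0)) (0 : ℝ))
  have h6 := congrArg (fun A : ℝ →L[ℝ] Eu 2 => A 1) h5
  have h7 : mfderiv (𝓡 3) (𝓡 2) π (γ 0) ((1 : ℝ) • ξ (γ 0)) = 0 := h6
  rwa [one_smul] at h7

lemma IsKillingSubmersion.inner_eq (hπ : IsKillingSubmersion gE gM π ξ) (x : E)
    (v w : TangentSpace (𝓡 3) x) :
    gE.inner x v w = gM.inner (π x) (mfderiv (𝓡 3) (𝓡 2) π x v) (mfderiv (𝓡 3) (𝓡 2) π x w) +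
      gE.inner x (ξ x) v * gE.inner x (ξ x) w :=
  inner_eq_of_horizontal_isometry (B := gE.inner x) (C := gM.inner (π x))
    (L := mfderiv (𝓡 3) (𝓡 2) π x) (x := ξ x) (gE.symm x)
    (hπ.riemannianSubmersion.submersion x) (hπ.mfderiv_field x) (hπ.unit x)
    (hπ.riemannianSubmersion.isometry x) v w

lemma IsKillingSubmersion.isSubmersionData (hπ : IsKillingSubmersion gE gM π ξ)
    (hψ : ψ ∈ atlas (Eu 3) E) {κ : OpenPartialHomeomorph M (Eu 2)} (hκ : κ ∈ atlas (Eu 2) M) :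
    IsSubmersionData (chartMetric gE ψ) (chartDomain π ψ κ) (chartField ξ ψ) (chartMetric gM κ)
      κ.target (chartMap π ψ κ) where
  metric := isMetricOn_chartMetric hκ gM
  mapsTo _ hu := chartMap_mem_target hu
  smooth _ hu := contDiffAt_chartMap hκ hψ hπ.riemannianSubmersion.smooth hu
  surj u hu := by
    intro z
    obtain ⟨y, hy⟩ := (chart_mdifferentiable hκ).mfderiv_surjective hu.2 z
    obtain ⟨w, hw⟩ := hπ.riemannianSubmersion.submersion (ψ.symm u) y
    refine ⟨toChart ψ (ψ.symm u) w, ?_⟩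
    rw [fderiv_chartMap hκ hψ hπ.riemannianSubmersion.smooth hu, fromChart_toChart hψ hu.1, hw]
    exact hy
  inner_eq u hu v w := by
    have h1 : ∀ v, chartMetric gE ψ u (chartField ξ ψ u) v =
        gE.inner (ψ.symm u) (ξ (ψ.symm u)) (fromChart ψ u v) := by
      intro v
      rw [chartMetric_apply, chartField, fromChart_toChart hψ hu.1]
    rw [h1, h1, fderiv_chartMap hκ hψ hπ.riemannianSubmersion.smooth hu,
      fderiv_chartMap hκ hψ hπ.riemannianSubmersion.smooth hu, chartMap,
      chartMetric_toChart hκ gM hu.2, chartMetric_apply]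
    exact hπ.inner_eq _ _ _

/-- O'Neill's formula on the part of the chart of E lying over the preferred chart at the base
point. That is the chart in which the Gaussian curvature is defined, so its chart independence is
not needed. -/
lemma IsKillingSubmersion.gaussCurvature_eq (hπ : IsKillingSubmersion gE gM π ξ)
    (hvol : IsVolumeForm gE vol) (hr : IsBundleCurvature gE ξ vol r) (hψ : ψ ∈ atlas (Eu 3) E)
    {u : Eu 3} (hu : u ∈ ψ.target) {e : Fin 3 → Eu 3}
    (he : IsAdaptedFrame (chartMetric gE ψ) (chartField ξ ψ) (chartCrossForm vol ξ ψ) u e) :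
    gaussCurvature gM (π (ψ.symm u)) =
      chartMetric gE ψ u (curvature (chartMetric gE ψ) u (e 0) (e 1) (e 1)) (e 0) +
        3 * r (ψ.symm u) ^ 2 := by
  have hκ := chart_mem_atlas (Eu 2) (π (ψ.symm u))
  have hO : IsOpen (chartDomain π ψ (chartAt (Eu 2) (π (ψ.symm u)))) :=
    isOpen_chartDomain hπ.riemannianSubmersion.smooth.continuous
  have hK := (hπ.isKillingData hvol hr hψ).mono hO fun _ hy => hy.1
  exact (hπ.isSubmersionData hψ hκ).sectional_eq hK ⟨hu, mem_chart_source _ _⟩ he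

lemma gradient_eq_zero (hψ : ψ ∈ atlas (Eu 3) E) (hr : ContMDiff (𝓡 3) 𝓘(ℝ, ℝ) ∞ r)
    {u : Eu 3} (hu : u ∈ ψ.target) (h0 : fderiv ℝ (fun y => r (ψ.symm y)) u = 0) :
    gradient gE r (ψ.symm u) = 0 := by
  have d1 : MDifferentiableAt (𝓡 3) (𝓡 3) ψ.symm u :=
    (chart_mdifferentiable hψ).mdifferentiableAt_symm hu
  have d2 : MDifferentiableAt (𝓡 3) 𝓘(ℝ, ℝ) r (ψ.symm u) :=
    hr.contMDiffAt.mdifferentiableAt (by simp)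
  have h1 := (HasMFDerivAt.comp u d2.hasMFDerivAt d1.hasMFDerivAt).mfderiv
  have h2 : mfderiv (𝓡 3) 𝓘(ℝ, ℝ) (r ∘ ψ.symm) u = fderiv ℝ (fun y => r (ψ.symm y)) u :=
    mfderiv_eq_fderiv
  have key : ∀ w : TangentSpace (𝓡 3) (ψ.symm u), mfderiv (𝓡 3) 𝓘(ℝ, ℝ) r (ψ.symm u) w = 0 := by
    intro w
    have h3 := congrArg (fun A : Eu 3 →L[ℝ] ℝ => A (toChart ψ (ψ.symm u) w)) (h1.symm.trans (h2.trans h0))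
    have h4 : mfderiv (𝓡 3) 𝓘(ℝ, ℝ) r (ψ.symm u) (fromChart ψ u (toChart ψ (ψ.symm u) w)) = 0 := h3
    rwa [fromChart_toChart hψ hu] at h4
  have h5 : (fun w : TangentSpace (𝓡 3) (ψ.symm u) => mfderiv (𝓡 3) 𝓘(ℝ, ℝ) r (ψ.symm u) w) =
      fun _ => (0 : ℝ) := funext key
  have h6 : sharp (n := 3) (gE.inner (ψ.symm u)) (fun _ => (0 : ℝ)) = 0 := by simp [sharp]
  exact (congrArg (sharp (n := 3) (gE.inner (ψ.symm u))) h5).trans h6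

lemma IsIsometricImmersion.isSurface {f : S → E} (hf : IsIsometricImmersion gS gE f)
    {η : ∀ p : S, TangentSpace (𝓡 3) (f p)} {U : Set S} (hU : IsOpen U)
    (hη : IsUnitNormalOn (m := 2) gE f η U) (hψ : ψ ∈ atlas (Eu 3) E)
    {κ : OpenPartialHomeomorph S (Eu 2)} (hκ : κ ∈ atlas (Eu 2) S) :
    IsSurface (chartMetric gE ψ) ψ.target (chartMetric gS κ)
      {u | u ∈ chartDomain f κ ψ ∧ κ.symm u ∈ U} (chartMap f κ ψ) (chartAlong f η κ ψ) where
  target := isMetricOn_chartMetric hψ gE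
  source :=
    { isOpen := by
        have h1 : IsOpen (chartDomain f κ ψ) := isOpen_chartDomain hf.1.continuous
        have h2 : IsOpen (κ.target ∩ κ.symm ⁻¹' U) := κ.isOpen_inter_preimage_symm hU
        convert h1.inter h2 using 1
        ext u
        exact ⟨fun h => ⟨h.1, h.1.1, h.2⟩, fun h => ⟨h.1, h.2.2⟩⟩
      smooth := fun u hu => contDiffAt_chartMetric hκ gS hu.1.1
      inner := fun u hu => isInner_chartMetric hκ gS hu.1.1 }
  mapsTo _ hu := chartMap_mem_target hu.1
  smooth _ hu := contDiffAt_chartMap hψ hκ hf.1 hu.1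
  smooth_normal _ hu := contDiffAt_chartAlong hψ hκ hU hη.1 hu.1 hu.2
  isometric u hu v w := by
    rw [fderiv_chartMap hψ hκ hf.1 hu.1, fderiv_chartMap hψ hκ hf.1 hu.1, chartMap,
      chartMetric_toChart hψ gE hu.1.2, hf.2, chartMetric_apply]
  unit u hu := by
    rw [chartMap, chartAlong, chartMetric_toChart hψ gE hu.1.2]
    exact (hη.2 _ hu.2).1
  normal u hu v := by
    rw [fderiv_chartMap hψ hκ hf.1 hu.1, chartMap, chartAlong, chartMetric_toChart hψ gE hu.1.2]
    exact (hη.2 _ hu.2).2 _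

end

end KillingBiharmonic

end

/-! ### Localisation of the theorem at a point where the tension field is non-zero -/

open KillingBiharmonic in
theorem proposition4p2
    {E : Type*} [TopologicalSpace E] [ChartedSpace (Eu 3) E] [IsManifold (𝓡 3) ∞ E]
    {M : Type*} [TopologicalSpace M] [ChartedSpace (Eu 2) M] [IsManifold (𝓡 2) ∞ M]
    {S : Type*} [TopologicalSpace S] [ChartedSpace (Eu 2) S] [IsManifold (𝓡 2) ∞ S]
    (gE : RMetric 3 E) (gM : RMetric 2 M) (gS : RMetric 2 S)
    (π : E → M) (ξ : ∀ x : E, TangentSpace (𝓡 3) x)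
    (hπ : IsKillingSubmersion gE gM π ξ)
    (vol : ∀ x : E, (TangentSpace (𝓡 3) x) [⋀^Fin 3]→ₗ[ℝ] ℝ) (hvol : IsVolumeForm gE vol)
    (r : E → ℝ) (hr : IsBundleCurvature gE ξ vol r)
    (f : S → E) (hf : IsIsometricImmersion gS gE f) (hcmc : IsCMC gS gE f)
    (hG : ∀ p : S, gaussCurvature gM (π (f p)) - 4 * r (f p) ^ 2 = 0)
    (hgrad : ∀ p : S, gradient gE r (f p) ≠ 0) :
    ¬ IsProperBiharmonic gS gE f := by
  rintro ⟨hbi, hnot⟩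
  simp only [IsHarmonic, not_forall] at hnot
  obtain ⟨κ, hκ, ψ, hψ, u, hu, hτ⟩ := hnot
  obtain ⟨c, hc⟩ := hcmc
  obtain ⟨U, hU, huU, η, hη, hmean⟩ := hc (κ.symm u)
  have hF := hf.isSurface hU hη hψ hκ
  have huW : u ∈ {u | u ∈ chartDomain f κ ψ ∧ κ.symm u ∈ U} := ⟨hu, huU⟩
  have hK := hπ.isKillingData hvol hr hψ
  have hB : IsBiharmonicSurface (chartMetric gE ψ) ψ.target (chartField ξ ψ)
      (chartCrossForm vol ξ ψ) (fun y => r (ψ.symm y)) (chartMetric gS κ)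
      {u | u ∈ chartDomain f κ ψ ∧ κ.symm u ∈ U} (chartMap f κ ψ) (chartAlong f η κ ψ) c :=
    { killing := hK
      surface := hF
      mean := fun y hy => hmean κ hκ ψ hψ y hy.1 hy.2
      mean_ne := by
        -- If c were 0, then τ = cη would vanish at the chosen non-harmonic point.
        rintro rfl
        apply hτ
        rw [hF.tension_eq huW, hmean κ hκ ψ hψ u hu huU, zero_smul]
      biharmonic := fun y hy => hbi κ hκ ψ hψ y hy.1
      -- O'Neill's formula with G = 4r²: the horizontal curvature is 4r² - 3r² = r².
      sectional := fun y hy e he => by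
        have h1 := hπ.gaussCurvature_eq hvol hr hψ (chartMap_mem_target hy.1) he
        have h2 := hG (κ.symm y)
        rw [symm_chartMap hy.1] at h1
        simp only [symm_chartMap hy.1]
        linarith
      grad_ne := fun y hy h0 => by
        have h1 := gradient_eq_zero (gE := gE) hψ hr.1 (chartMap_mem_target hy.1) h0
        apply hgrad (κ.symm y)
        rwa [symm_chartMap hy.1] at h1 }
  exact hB.false huW
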